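/- Smooth means $C^\infty$. Let $V$ be a smooth finite-dimensional manifold (Hausdorff, second countable) fibred over the time axis by a smooth submersion $t:V\to\mathbb R$, with fibred coordinates $t,q^1,\dots,q^n$, and let $j_1(V)=\{z\in TV:\langle z,dt\rangle=1\}$. Let $i:\mathcal A\hookrightarrow j_1(V)$ be an embedded submanifold such that the induced map $\pi:\mathcal A\to V$ is a submersion; in fibred coordinates $t,q^i,z^A$ of $\mathcal A$ it is given by $\dot q^i=\psi^i(t,q,z)$. Let $L:\mathcal A\to\mathbb R$ be a smooth function and let $t_0<t_1$. *Constrained problem.* A section of $V$ or of $\mathcal A$ over $[t_0,t_1]$ is a smooth curve $c$ on $[t_0,t_1]$ with $t(c(s))=s$. A section $\gamma$ of $V$ is admissible if there is a section $\hat\gamma$ of $\mathcal A$ (its lift, necessarily unique) with $\pi\circ\hat\gamma=\gamma$ and $\dot\gamma=i\circ\hat\gamma$. Put $\mathcal I[\gamma]=\int_{t_0}^{t_1}L(\hat\gamma(s))\,ds$. An admissible $\gamma$ is an extremal of $\mathcal I$ if $\frac{d}{d\xi}\mathcal I[\gamma_\xi]\big|_{\xi=0}=0$ for every deformation $\gamma_\xi=\pi\circ\hat\gamma_\xi$,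 $|\xi|<\varepsilon$, of $\gamma$ through admissible sections with the same end-points, where $\hat\gamma_\xi(s)$ is smooth in $(\xi,s)$ and $\hat\gamma_0=\hat\gamma$. *Free problem.* Let $\mathscr C(\mathcal A)$ be the bundle over $\mathcal A$ whose fibre at $a$ consists of the contact forms at $a$, i.e. the covectors $\sigma\in T^*_{\pi(a)}V$ with $\langle\sigma,i(a)\rangle=0$; in coordinates $\sigma=p_i(dq^i-\psi^i\,dt)$, so that $\mathscr C(\mathcal A)$ is the pull-back to $\mathcal A$ of the dual vertical bundle $V^*(V)$ and has coordinates $t,q^i,z^A,p_i$. (This is the description in a fixed trivialization of the bundle of affine scalars over $V$.) Let $\upsilon:\mathscr C(\mathcal A)\to V$ be the projection. For a smooth section $\tilde\gamma=(\hat\gamma,\sigma)$ of $\mathscr C(\mathcal A)$ over $[t_0,t_1]$, where $\hat\gamma$ is not required to be admissible, put $$\mathcal I_L[\tilde\gamma]=\int_{t_0}^{t_1}\Big(L(\hat\gamma(s))+\Big\langle\sigma(s),\tfrac{d}{ds}(\upsilon\circ\tilde\gamma)(s)\Big\rangle\Big)\,ds=\int_{t_0}^{t_1}\Big(L+p_i\big(\dot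 q^i-\psi^i\big)\Big)\,dt .$$ The section $\tilde\gamma$ is an extremal of $\mathcal I_L$ if $\frac{d}{d\xi}\mathcal I_L[\tilde\gamma_\xi]\big|_{\xi=0}=0$ for every smooth deformation $\tilde\gamma_\xi$ of $\tilde\gamma$ through sections of $\mathscr C(\mathcal A)$ for which $\upsilon\circ\tilde\gamma_\xi$ has the same end-points as $\upsilon\circ\tilde\gamma$. *Normality.* The abnormality index of an admissible $\gamma$ is the dimension of the real vector space of the extremals $(\hat\gamma,\sigma)$ of $\mathcal I_0$ (the functional $\mathcal I_L$ with $L=0$) that project onto $\gamma$; equivalently, of the space of solutions $p(t)$ of $$\dot p_i=-p_k\,\frac{\partial\psi^k}{\partial q^i},\qquad p_k\,\frac{\partial\psi^k}{\partial z^A}=0$$ along $\hat\gamma$. The curve $\gamma$ is normal if its abnormality index is $0$. **Theorem.** Every normal extremal $\gamma$ of $\mathcal I$ is the projection $\upsilon\circ\tilde\gamma$ of exactly one extremal $\tilde\gamma$ of the free functional $\mathcal I_L$ on $\mathscr C(\mathcal A)$. -/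

import Mathlib

open Set Bundle MeasureTheory
open scoped Manifold ContDiff Topology

noncomputable section

/-- A fibred manifold `time : V → ℝ` (the event space), together with non-holonomic constraints:
a manifold `A` embedded in the first jet space `j₁(V) = {z ∈ T V | ⟨z, dt⟩ = 1}` and fibred
over `V`. In fibred coordinates `incl` reads `(t, q, z) ↦ ∂/∂t + ψⁱ(t, q, z) ∂/∂qⁱ`. -/
structure ConstrainedSystem (E F : Type*) [NormedAddCommGroup E] [NormedSpace ℝ E]
    [NormedAddCommGroup F] [NormedSpace ℝ F]
    (V : Type*) [TopologicalSpace V] [ChartedSpace E V] [IsManifold 𝓘(ℝ, E) ∞ V]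
    (A : Type*) [TopologicalSpace A] [ChartedSpace F A] [IsManifold 𝓘(ℝ, F) ∞ A] where
  /-- the absolute time function -/
  time : V → ℝ
  contMDiff_time : ContMDiff 𝓘(ℝ, E) 𝓘(ℝ, ℝ) ∞ time
  submersion_time : ∀ x, Function.Surjective (mfderiv 𝓘(ℝ, E) 𝓘(ℝ, ℝ) time x)
  /-- the embedding of the constraint manifold into `T V` -/
  incl : A → TangentBundle 𝓘(ℝ, E) V
  contMDiff_incl : ContMDiff 𝓘(ℝ, F) 𝓘(ℝ, E).tangent ∞ incl
  isEmbedding_incl : Topology.IsEmbedding incl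
  immersion_incl : ∀ a, Function.Injective (mfderiv 𝓘(ℝ, F) 𝓘(ℝ, E).tangent incl a)
  /-- the image of `incl` lies in the first jet space -/
  time_incl : ∀ a, (mfderiv 𝓘(ℝ, E) 𝓘(ℝ, ℝ) time (incl a).proj (incl a).2 : ℝ) = 1
  /-- `A` is fibred over `V` -/
  submersion_proj : ∀ a,
    Function.Surjective (mfderiv 𝓘(ℝ, F) 𝓘(ℝ, E) (fun b => (incl b).proj) a)

/-- The cotangent bundle of `V`. -/
abbrev CotangentBundle (E : Type*) [NormedAddCommGroup E] [NormedSpace ℝ E]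
    (V : Type*) [TopologicalSpace V] [ChartedSpace E V] [IsManifold 𝓘(ℝ, E) ∞ V] : Type _ :=
  TotalSpace (E →L[ℝ] ℝ) (fun x : V => TangentSpace 𝓘(ℝ, E) x →L[ℝ] Trivial V ℝ x)

namespace ConstrainedSystem

variable {E F : Type*} [NormedAddCommGroup E] [NormedSpace ℝ E]
  [NormedAddCommGroup F] [NormedSpace ℝ F]
  {V : Type*} [TopologicalSpace V] [ChartedSpace E V] [IsManifold 𝓘(ℝ, E) ∞ V]
  {A : Type*} [TopologicalSpace A] [ChartedSpace F A] [IsManifold 𝓘(ℝ, F) ∞ A]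

/-- The projection `π : A → V`. -/
def proj (S : ConstrainedSystem E F V A) (a : A) : V := (S.incl a).proj

/-! ### Admissible curves and the constrained functional -/

/-- `c : [t₀, t₁] → V` is a (smooth) section of `time`. -/
structure IsSection (S : ConstrainedSystem E F V A) (t₀ t₁ : ℝ) (c : ℝ → V) : Prop where
  contMDiffOn : ContMDiffOn 𝓘(ℝ, ℝ) 𝓘(ℝ, E) ∞ c (Icc t₀ t₁)
  time_eq : ∀ s ∈ Icc t₀ t₁, S.time (c s) = s

/-- The velocity of a curve defined on `[t₀, t₁]` (one-sided at the end-points). -/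
def velocity (E : Type*) [NormedAddCommGroup E] [NormedSpace ℝ E]
    {V : Type*} [TopologicalSpace V] [ChartedSpace E V]
    (t₀ t₁ : ℝ) (c : ℝ → V) (s : ℝ) : TangentSpace 𝓘(ℝ, E) (c s) :=
  mfderivWithin 𝓘(ℝ, ℝ) 𝓘(ℝ, E) c (Icc t₀ t₁) s (1 : ℝ)

/-- `a : [t₀, t₁] → A` is an admissible section: `j₁(π ∘ a) = i ∘ a`. -/
structure IsAdmissible (S : ConstrainedSystem E F V A) (t₀ t₁ : ℝ) (a : ℝ → A) : Prop where
  contMDiffOn : ContMDiffOn 𝓘(ℝ, ℝ) 𝓘(ℝ, F) ∞ a (Icc t₀ t₁)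
  isSection : S.IsSection t₀ t₁ (fun s => S.proj (a s))
  jet_eq : ∀ s ∈ Icc t₀ t₁, velocity E t₀ t₁ (fun s => S.proj (a s)) s = (S.incl (a s)).2

/-- `a` is the lift to `A` of the admissible evolution `γ`. -/
structure IsLift (S : ConstrainedSystem E F V A) (t₀ t₁ : ℝ) (γ : ℝ → V) (a : ℝ → A) : Prop where
  isAdmissible : S.IsAdmissible t₀ t₁ a
  proj_eq : ∀ s ∈ Icc t₀ t₁, S.proj (a s) = γ s

/-- `H ξ`, `|ξ| < ε`, is an admissible deformation of the admissible section `a` of `A`, with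
fixed end-points in `V`. -/
structure IsAdmissibleDeformation (S : ConstrainedSystem E F V A) (t₀ t₁ : ℝ) (a : ℝ → A)
    (ε : ℝ) (H : ℝ → ℝ → A) : Prop where
  contMDiffOn : ContMDiffOn 𝓘(ℝ, ℝ × ℝ) 𝓘(ℝ, F) ∞ (fun y : ℝ × ℝ => H y.1 y.2)
    (Ioo (-ε) ε ×ˢ Icc t₀ t₁)
  isAdmissible : ∀ ξ ∈ Ioo (-ε) ε, S.IsAdmissible t₀ t₁ (H ξ)
  zero_eq : ∀ s ∈ Icc t₀ t₁, H 0 s = a s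
  left_eq : ∀ ξ ∈ Ioo (-ε) ε, S.proj (H ξ t₀) = S.proj (a t₀)
  right_eq : ∀ ξ ∈ Ioo (-ε) ε, S.proj (H ξ t₁) = S.proj (a t₁)

/-- The action functional `∫ L(t, q, z) dt` along a section of `A`. -/
def action (L : A → ℝ) (t₀ t₁ : ℝ) (a : ℝ → A) : ℝ := ∫ s in t₀..t₁, L (a s)

/-- `γ` is an extremal of the constrained functional: it is admissible, and the action of its
lift is stationary under all admissible deformations with fixed end-points. -/
def IsExtremal (S : ConstrainedSystem E F V A) (L : A → ℝ) (t₀ t₁ : ℝ) (γ : ℝ → V) : Prop :=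
  ∃ a : ℝ → A, S.IsLift t₀ t₁ γ a ∧
    ∀ (ε : ℝ) (H : ℝ → ℝ → A), 0 < ε → S.IsAdmissibleDeformation t₀ t₁ a ε H →
      HasDerivAt (fun ξ => action L t₀ t₁ (H ξ)) 0 0

/-! ### The bundle `𝒞(A)` and the free functional -/

/-- The bundle `𝒞(A) → A` (in the given trivialization): a point is a point `pt` of `A` with a
contact `1`-form there, i.e. a covector `form` on `V` at `π(pt)` annihilating `i(pt)`. In
coordinates `form = pᵢ (dqⁱ - ψⁱ dt)`. Restriction of `form` to vertical vectors identifies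
the fibre over `pt` with the fibre of the dual vertical bundle `V*(V)` at `π(pt)`. -/
structure ContactBundle (S : ConstrainedSystem E F V A) where
  /-- the base point -/
  pt : A
  /-- the contact form -/
  form : TangentSpace 𝓘(ℝ, E) (S.proj pt) →L[ℝ] ℝ
  form_incl : form (S.incl pt).2 = 0

/-- The projection `υ : 𝒞(A) → V`. -/
def ContactBundle.base {S : ConstrainedSystem E F V A} (w : S.ContactBundle) : V := S.proj w.pt

/-- The contact form, as a point of the cotangent bundle of `V`. -/
def ContactBundle.toCotangent {S : ConstrainedSystem E F V A} (w : S.ContactBundle) :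
    CotangentBundle E V := ⟨w.base, w.form⟩

/-- Smoothness of a map into `𝒞(A)`, regarded as a submanifold of `A × T*V`. -/
def SmoothOn {S : ConstrainedSystem E F V A} {M : Type*} [NormedAddCommGroup M]
    [NormedSpace ℝ M] (f : M → S.ContactBundle) (s : Set M) : Prop :=
  ContMDiffOn 𝓘(ℝ, M) 𝓘(ℝ, F) ∞ (fun y => (f y).pt) s ∧
    ContMDiffOn 𝓘(ℝ, M) (𝓘(ℝ, E).prod 𝓘(ℝ, E →L[ℝ] ℝ)) ∞ (fun y => (f y).toCotangent) s

/-- `c : [t₀, t₁] → 𝒞(A)` is a (smooth) section over the time axis. -/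
structure IsFreeSection (S : ConstrainedSystem E F V A) (t₀ t₁ : ℝ)
    (c : ℝ → S.ContactBundle) : Prop where
  smoothOn : SmoothOn c (Icc t₀ t₁)
  time_eq : ∀ s ∈ Icc t₀ t₁, S.time (c s).base = s

/-- `G ξ`, `|ξ| < ε`, is a deformation of the section `c` of `𝒞(A)` preserving the end-points
of the projection `υ ∘ c`. -/
structure IsFreeDeformation (S : ConstrainedSystem E F V A) (t₀ t₁ : ℝ)
    (c : ℝ → S.ContactBundle) (ε : ℝ) (G : ℝ → ℝ → S.ContactBundle) : Prop where
  smoothOn : SmoothOn (fun y : ℝ × ℝ => G y.1 y.2) (Ioo (-ε) ε ×ˢ Icc t₀ t₁)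
  isFreeSection : ∀ ξ ∈ Ioo (-ε) ε, S.IsFreeSection t₀ t₁ (G ξ)
  zero_eq : ∀ s ∈ Icc t₀ t₁, G 0 s = c s
  left_eq : ∀ ξ ∈ Ioo (-ε) ε, (G ξ t₀).base = (c t₀).base
  right_eq : ∀ ξ ∈ Ioo (-ε) ε, (G ξ t₁).base = (c t₁).base

/-- The integral of the Pontryagin–Poincaré–Cartan form `L dt + pᵢ (dqⁱ - ψⁱ dt)` along a section
of `𝒞(A)`: the contact form is evaluated on the velocity of the projected curve. -/
def freeAction {S : ConstrainedSystem E F V A} (L : A → ℝ) (t₀ t₁ : ℝ)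
    (c : ℝ → S.ContactBundle) : ℝ :=
  ∫ s in t₀..t₁, (L (c s).pt + (c s).form (velocity E t₀ t₁ (fun s => (c s).base) s))

/-- `c` is an extremal of the free functional on `𝒞(A)` with Lagrangian `L`. -/
def IsFreeExtremal (S : ConstrainedSystem E F V A) (L : A → ℝ) (t₀ t₁ : ℝ)
    (c : ℝ → S.ContactBundle) : Prop :=
  S.IsFreeSection t₀ t₁ c ∧
    ∀ (ε : ℝ) (G : ℝ → ℝ → S.ContactBundle), 0 < ε → S.IsFreeDeformation t₀ t₁ c ε G →
      HasDerivAt (fun ξ => freeAction L t₀ t₁ (G ξ)) 0 0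

/-! ### Normality -/

/-- The space of the extremals of the free functional with `L = 0` that project onto `γ`, each
recorded through its contact forms along `γ`. (These forms are the solutions of a homogeneous
linear system, so passing to the linear span adds nothing to the set.) -/
def abnormalSpace (S : ConstrainedSystem E F V A) (t₀ t₁ : ℝ) (γ : ℝ → V) :
    Submodule ℝ ((s : Icc t₀ t₁) → (TangentSpace 𝓘(ℝ, E) (γ s) →L[ℝ] ℝ)) :=
  Submodule.span ℝ {w | ∃ c : ℝ → S.ContactBundle, S.IsFreeExtremal (fun _ => 0) t₀ t₁ c ∧
    ∀ s : Icc t₀ t₁, (c s).toCotangent = ⟨γ s, w s⟩}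

/-- The abnormality index of `γ`. -/
def abnormalityIndex (S : ConstrainedSystem E F V A) (t₀ t₁ : ℝ) (γ : ℝ → V) : Cardinal :=
  Module.rank ℝ (S.abnormalSpace t₀ t₁ γ)

/-- An admissible curve is normal when its abnormality index vanishes. -/
def IsNormal (S : ConstrainedSystem E F V A) (t₀ t₁ : ℝ) (γ : ℝ → V) : Prop :=
  (∃ a : ℝ → A, S.IsLift t₀ t₁ γ a) ∧ S.abnormalityIndex t₀ t₁ γ = 0

end ConstrainedSystem

end

/-!
# Normal extremals of a constrained problem as projections of free extremals

In coordinates `(t, q, z)` of `A` in which the constraint reads `q' = ψ(t, q, z)`, a section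
of `𝒞(A)` is a curve `(q, z)` together with a momentum `p`, and the free action is
`∫ (L + p (q' - ψ))`. A computation of the first variation shows that a section is a free extremal
exactly when `q' = ψ` and

  `p' = ∂L/∂q - p ∂ψ/∂q`,  `∂L/∂z = p ∂ψ/∂z`.

These equations are `IsMultiplier`; the two implications are `isFreeExtremal_of_isMultiplier` and
`derivWithin_q_eq_slope_of_isFreeExtremal`, `isMultiplier_of_isFreeExtremal`. With `L = 0` they
describe the abnormal momenta, so along a normal curve the homogeneous equations have only the zero
solution. The inhomogeneous equations then have at most one solution, and this is uniqueness: the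
point of `A` is determined by the velocity of the curve, since `A` is embedded in `j₁(V)`.

Existence is the multiplier rule. The accumulated action `c` is added to the state, giving the
controlled system `q' = ψ`, `c' = L` with control `z`, and one asks whether its final state can be
moved freely by varying the control. If no nonzero solution of the adjoint system annihilates the
control directions, then the derivative of the final state with respect to suitable control
variations is onto, and `exists_endpoint_family` produces a smooth family of solutions which fixes
the end-points of `q` and increases the final value of `c` with unit speed. This is an admissible
deformation along which the action has derivative `1`, which is impossible for an extremal. Hence
there is a nonzero adjoint solution `(p, ν)`, in which `ν` is constant
(`exists_multiplier_pair_of_stationary`). If `ν` vanished, `p` would be a nonzero abnormal momentum;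
so normality gives `ν ≠ 0`, and `-p / ν` is the momentum sought.

Three constructions support this argument.

* Deformations have to be smooth jointly in the parameter and in time, up to the ends of the
  interval. Solutions of a differential equation are treated as zeros of `odeResidual` on the Banach
  space `C([0, 1], Q)`, whose derivative is the identity minus a Volterra operator and thus
  invertible. Rescaling makes the final time one of the parameters, so smoothness in time is
  obtained along with smoothness in the parameters.
* Control variations are supported in the interior of the interval, and solutions are continued
  outside the support by uniqueness and by the invariance of the system under translations of `c`.
* A single coordinate system covers the whole curve (`exists_adaptedChart`). Coordinates along the
  fibres are built piece by piece along the curve (`exists_complement_along`), and the inverse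
  function theorem along a compact set turns them into charts.
-/

set_option linter.unusedSectionVars false

noncomputable section

/-! ### Superposition operators on spaces of continuous functions -/

section Superposition

variable {K : Type} [TopologicalSpace K] [CompactSpace K]
  {E G : Type} [NormedAddCommGroup E] [NormedSpace ℝ E] [NormedAddCommGroup G] [NormedSpace ℝ G]

-- Shortcut instances: the search for a norm on `C(K, E →L[ℝ] G)` does not end in reasonable time.
instance ContinuousMap.normedAddCommGroupCLM : NormedAddCommGroup C(K, E →L[ℝ] G) :=
  ContinuousMap.instNormedAddCommGroup

instance ContinuousMap.seminormedAddCommGroupCLM : SeminormedAddCommGroup C(K, E →L[ℝ] G) :=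
  NormedAddCommGroup.toSeminormedAddCommGroup

instance ContinuousMap.normedSpaceCLM : NormedSpace ℝ C(K, E →L[ℝ] G) := inferInstance

variable (K E G) in
/-- Pointwise application `(A, h) ↦ (k ↦ A k (h k))`, as a continuous bilinear map between spaces
of continuous functions. -/
def pointwiseApply : C(K, E →L[ℝ] G) →L[ℝ] C(K, E) →L[ℝ] C(K, G) :=
  LinearMap.mkContinuous₂
    (LinearMap.mk₂ ℝ
      (fun (A : C(K, E →L[ℝ] G)) (h : C(K, E)) =>
        (⟨fun k => A k (h k), A.continuous.clm_apply h.continuous⟩ : C(K, G)))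
      (fun _ _ _ => by ext; simp) (fun _ _ _ => by ext; simp)
      (fun _ _ _ => by ext; simp) (fun _ _ _ => by ext; simp))
    1 (fun A h => by
      rw [one_mul]
      refine (ContinuousMap.norm_le _ (by positivity)).2 fun k => ?_
      exact ((A k).le_opNorm _).trans
        (mul_le_mul (A.norm_coe_le_norm k) (h.norm_coe_le_norm k) (norm_nonneg _) (norm_nonneg _)))

@[simp] theorem pointwiseApply_apply (A : C(K, E →L[ℝ] G)) (h : C(K, E)) (k : K) :
    pointwiseApply K E G A h k = A k (h k) := rfl

/-- Composition with `f` is differentiable in the sup norm: on a small neighbourhood of the compact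
range of `x` the derivative of `f` varies little, so the mean value inequality is uniform. -/
theorem ContinuousMap.hasFDerivAt_comp_left (f : C(E, G)) (f' : C(E, E →L[ℝ] G))
    (hf : ∀ x, HasFDerivAt f (f' x) x) (x : C(K, E)) :
    HasFDerivAt (fun x : C(K, E) => f.comp x) (pointwiseApply K E G (f'.comp x)) x := by
  rw [hasFDerivAt_iff_isLittleO, Asymptotics.isLittleO_iff]
  intro ε hε
  have hcomp : IsCompact (range x) := isCompact_range x.continuous
  -- `f'` is uniformly continuous at the points of the compact set `range x`, jointly with points
  -- outside that set, although it need not be uniformly continuous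
  have hu := hcomp.uniformContinuousAt_of_continuousAt (f := f')
    (r := {p | dist p.1 p.2 < ε}) (fun a _ => f'.continuous.continuousAt)
    (Metric.dist_mem_uniformity hε)
  obtain ⟨δ, hδ, hδ'⟩ := Metric.mem_uniformity_dist.1 hu
  filter_upwards [Metric.ball_mem_nhds x hδ] with y hy
  refine (ContinuousMap.norm_le _ (by positivity)).2 fun k => ?_
  have hyk : y k ∈ Metric.ball (x k) δ := by
    rw [Metric.mem_ball]
    exact (ContinuousMap.dist_apply_le_dist k).trans_lt hy
  have := (convex_ball (x k) δ).norm_image_sub_le_of_norm_hasFDerivWithin_le' (f := f)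
    (f' := f') (φ := f' (x k)) (C := ε) (fun z _ => (hf z).hasFDerivWithinAt)
    (fun z hz => by
      rw [← dist_eq_norm, dist_comm]
      exact (hδ' (by rw [dist_comm]; exact hz) ⟨k, rfl⟩).le)
    (Metric.mem_ball_self hδ) hyk
  refine le_trans this ?_
  gcongr
  exact (y - x).norm_coe_le_norm k

/-- A smooth map acts smoothly by composition on spaces of continuous functions. -/
theorem ContinuousMap.contDiff_comp_left (f : C(E, G)) (hf : ContDiff ℝ ∞ f) :
    ContDiff ℝ ∞ (fun x : C(K, E) => f.comp x) := by
  rw [contDiff_infty]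
  intro n
  induction n generalizing G with
  | zero =>
    exact contDiff_zero.2 (ContinuousMap.continuous_postcomp f)
  | succ n ih =>
    have hf' : ContDiff ℝ ∞ (fderiv ℝ f) := hf.fderiv_right (by simp)
    let f' : C(E, E →L[ℝ] G) := ⟨fderiv ℝ f, hf'.continuous⟩
    refine contDiff_succ_iff_hasFDerivAt.2
      ⟨fun x => pointwiseApply K E G (f'.comp x),
        (pointwiseApply K E G).contDiff.comp (ih f' hf'), fun x => ?_⟩
    exact ContinuousMap.hasFDerivAt_comp_left f f'
      (fun z => (hf.differentiable (by simp) z).hasFDerivAt) x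

end Superposition

/-! ### Volterra operators and smooth dependence of solutions on parameters -/

section Volterra

variable {Q : Type} [NormedAddCommGroup Q]

theorem continuous_IccExtend_unit (h : C(Icc (0 : ℝ) 1, Q)) :
    Continuous (IccExtend (zero_le_one (α := ℝ)) h) := h.continuous.Icc_extend'

theorem norm_IccExtend_le (h : C(Icc (0 : ℝ) 1, Q)) (t : ℝ) :
    ‖IccExtend (zero_le_one (α := ℝ)) h t‖ ≤ ‖h‖ := h.norm_coe_le_norm _

variable [NormedSpace ℝ Q]

variable (Q) in
/-- The primitive vanishing at `0`, as an operator on `C([0, 1], Q)`. -/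
def primitiveCLM : C(Icc (0 : ℝ) 1, Q) →L[ℝ] C(Icc (0 : ℝ) 1, Q) :=
  LinearMap.mkContinuous
    { toFun := fun h => ⟨fun s => ∫ τ in (0 : ℝ)..s, IccExtend zero_le_one h τ, by
        refine Continuous.comp (g := fun s : ℝ => ∫ τ in (0 : ℝ)..s, IccExtend zero_le_one h τ)
          ?_ continuous_subtype_val
        exact intervalIntegral.continuous_primitive
          (fun a b => (continuous_IccExtend_unit h).intervalIntegrable a b) 0⟩
      map_add' := fun h k => by
        ext s
        have : IccExtend (zero_le_one (α := ℝ)) (h + k) =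
          fun τ => IccExtend zero_le_one h τ + IccExtend zero_le_one k τ := rfl
        simp only [ContinuousMap.coe_mk, ContinuousMap.add_apply]
        rw [← intervalIntegral.integral_add
          ((continuous_IccExtend_unit h).intervalIntegrable _ _)
          ((continuous_IccExtend_unit k).intervalIntegrable _ _)]
        rfl
      map_smul' := fun c h => by
        ext s
        simp only [ContinuousMap.coe_mk, ContinuousMap.smul_apply, RingHom.id_apply]
        rw [← intervalIntegral.integral_smul]
        rfl }
    1 (fun h => by
      refine (ContinuousMap.norm_le _ (by positivity)).2 fun s => ?_
      have := intervalIntegral.norm_integral_le_of_norm_le_const (a := 0) (b := (s : ℝ))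
        (f := IccExtend (zero_le_one (α := ℝ)) h) (C := ‖h‖) fun x _ => norm_IccExtend_le h x
      refine this.trans ?_
      rw [mul_comm, sub_zero, abs_of_nonneg s.2.1]
      gcongr
      exact s.2.2)

theorem primitiveCLM_apply (h : C(Icc (0 : ℝ) 1, Q)) (s : Icc (0 : ℝ) 1) :
    primitiveCLM Q h s = ∫ τ in (0 : ℝ)..s, IccExtend zero_le_one h τ := rfl

variable [CompleteSpace Q]

theorem hasDerivWithinAt_primitiveCLM (h : C(Icc (0 : ℝ) 1, Q)) (s : ℝ) (hs : s ∈ Icc (0 : ℝ) 1) :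
    HasDerivWithinAt (IccExtend zero_le_one (primitiveCLM Q h)) (h ⟨s, hs⟩) (Icc 0 1) s := by
  have h1 : HasDerivAt (fun s => ∫ τ in (0 : ℝ)..s, IccExtend zero_le_one h τ)
      (IccExtend zero_le_one h s) s :=
    intervalIntegral.integral_hasDerivAt_right
      ((continuous_IccExtend_unit h).intervalIntegrable _ _)
      ((continuous_IccExtend_unit h).stronglyMeasurableAtFilter _ _)
      (continuous_IccExtend_unit h).continuousAt
  rw [IccExtend_of_mem _ _ hs] at h1
  refine h1.hasDerivWithinAt.congr (fun x hx => ?_) ?_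
  · rw [IccExtend_of_mem _ _ hx]; rfl
  · rw [IccExtend_of_mem _ _ hs]; rfl

/-- The `n`-th power of a Volterra operator gains a factor `1 / n!` from the volume of a simplex. -/
theorem norm_iterate_volterra_le (A : C(Icc (0 : ℝ) 1, Q →L[ℝ] Q)) (n : ℕ)
    (h : C(Icc (0 : ℝ) 1, Q)) (s : Icc (0 : ℝ) 1) :
    ‖((primitiveCLM Q ∘L pointwiseApply _ Q Q A) ^ n) h s‖ ≤
      (‖A‖ * s) ^ n / n.factorial * ‖h‖ := by
  induction n generalizing s with
  | zero => simpa using h.norm_coe_le_norm s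
  | succ n ih =>
    set T := primitiveCLM Q ∘L pointwiseApply (Icc (0 : ℝ) 1) Q Q A with hT
    set g := (T ^ n) h with hg
    have h1 : (T ^ (n + 1)) h = T g := by rw [pow_succ']; rfl
    rw [h1]
    have h2 : T g s = ∫ τ in (0 : ℝ)..s,
        IccExtend zero_le_one (pointwiseApply (Icc (0 : ℝ) 1) Q Q A g) τ := rfl
    rw [h2]
    have h3 := intervalIntegral.norm_integral_le_of_norm_le (μ := volume) s.2.1
      (f := IccExtend zero_le_one (pointwiseApply (Icc (0 : ℝ) 1) Q Q A g))
      (g := fun τ => ‖A‖ * ((‖A‖ * τ) ^ n / n.factorial * ‖h‖))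
      (Filter.Eventually.of_forall fun τ hτ => by
        have hτ' : τ ∈ Icc (0 : ℝ) 1 := ⟨hτ.1.le, hτ.2.trans s.2.2⟩
        rw [IccExtend_of_mem _ _ hτ', pointwiseApply_apply]
        exact ((A _).le_opNorm _).trans
          (mul_le_mul (A.norm_coe_le_norm _) (ih ⟨τ, hτ'⟩) (norm_nonneg _) (norm_nonneg _)))
      (Continuous.intervalIntegrable (by fun_prop) _ _)
    refine h3.trans (le_of_eq ?_)
    have h4 : ∀ τ : ℝ, ‖A‖ * ((‖A‖ * τ) ^ n / n.factorial * ‖h‖) =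
        (‖A‖ ^ (n + 1) / n.factorial * ‖h‖) * τ ^ n := fun τ => by ring
    simp_rw [h4]
    rw [intervalIntegral.integral_const_mul, integral_pow, Nat.factorial_succ]
    push_cast
    have : ((n : ℝ) + 1) ≠ 0 := by positivity
    have : (n.factorial : ℝ) ≠ 0 := by positivity
    field_simp
    ring

/-- `1 - T` is invertible for a Volterra operator `T`: the powers of `T` tend to `0`. -/
theorem isUnit_one_sub_volterra (A : C(Icc (0 : ℝ) 1, Q →L[ℝ] Q)) :
    IsUnit (1 - primitiveCLM Q ∘L pointwiseApply _ Q Q A) := by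
  set T := primitiveCLM Q ∘L pointwiseApply (Icc (0 : ℝ) 1) Q Q A with hT
  obtain ⟨n, hn⟩ := ((FloorSemiring.tendsto_pow_div_factorial_atTop ‖A‖).eventually
    (gt_mem_nhds one_pos)).exists
  have hTn : ‖T ^ n‖ < 1 := by
    refine lt_of_le_of_lt (ContinuousLinearMap.opNorm_le_bound _ (by positivity) fun h => ?_) hn
    refine (ContinuousMap.norm_le _ (by positivity)).2 fun s => ?_
    refine (norm_iterate_volterra_le A n h s).trans ?_
    gcongr
    · exact mul_nonneg (norm_nonneg A) s.2.1
    · exact mul_le_of_le_one_right (norm_nonneg A) s.2.2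
  -- `1 - T` divides the unit `1 - T ^ n`
  have h1 : IsUnit (1 - T ^ n) := (Units.oneSub (T ^ n) hTn).isUnit
  rw [← mul_neg_geom_sum T n] at h1
  have hc : Commute (1 - T) (∑ i ∈ Finset.range n, T ^ i) :=
    Commute.sum_right _ _ _ fun i _ =>
      ((Commute.one_left _).sub_left ((Commute.refl T).pow_right i))
  exact (hc.isUnit_mul_iff.1 h1).1

variable {P : Type} [NormedAddCommGroup P] [NormedSpace ℝ P]

/-- The curve `r ↦ (r, y, x r)` attached to a parameter `y` and a curve `x`. -/
def graphMap (v : P × C(Icc (0 : ℝ) 1, Q)) : C(Icc (0 : ℝ) 1, ℝ × P × Q) :=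
  ⟨fun r => ((r : ℝ), v.1, v.2 r), by fun_prop⟩

variable (P Q) in
/-- The linear part of the affine map `graphMap`. -/
def graphCLM : P × C(Icc (0 : ℝ) 1, Q) →L[ℝ] C(Icc (0 : ℝ) 1, ℝ × P × Q) :=
  ContinuousLinearMap.compLeftContinuous ℝ (Icc (0 : ℝ) 1)
      (ContinuousLinearMap.inr ℝ ℝ (P × Q) ∘L ContinuousLinearMap.inl ℝ P Q) ∘L
        ContinuousLinearMap.const ℝ (Icc (0 : ℝ) 1) ∘L ContinuousLinearMap.fst ℝ P _ +
    ContinuousLinearMap.compLeftContinuous ℝ (Icc (0 : ℝ) 1)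
      (ContinuousLinearMap.inr ℝ ℝ (P × Q) ∘L ContinuousLinearMap.inr ℝ P Q) ∘L
        ContinuousLinearMap.snd ℝ P _

@[simp] theorem graphCLM_apply (w : P × C(Icc (0 : ℝ) 1, Q)) (r : Icc (0 : ℝ) 1) :
    graphCLM Q P w r = (0, w.1, w.2 r) := by
  simp [graphCLM]

theorem graphMap_eq (v : P × C(Icc (0 : ℝ) 1, Q)) :
    graphMap v = graphMap 0 + graphCLM Q P v := by
  ext r <;> simp [graphMap]

theorem contDiff_graphMap : ContDiff ℝ ∞ (graphMap : P × C(Icc (0 : ℝ) 1, Q) → _) := by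
  rw [show (graphMap : P × C(Icc (0 : ℝ) 1, Q) → _) = fun v => graphMap 0 + graphCLM Q P v from
    funext graphMap_eq]
  exact contDiff_const.add (graphCLM Q P).contDiff

theorem hasFDerivAt_graphMap (v : P × C(Icc (0 : ℝ) 1, Q)) :
    HasFDerivAt graphMap (graphCLM Q P) v := by
  rw [show (graphMap : P × C(Icc (0 : ℝ) 1, Q) → _) = fun v => graphMap 0 + graphCLM Q P v from
    funext graphMap_eq]
  exact (graphCLM Q P).hasFDerivAt.const_add _

/-- The map whose zeros are the pairs of a parameter `y` and a solution on `[0, 1]` of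
`x' = g (r, y, x)`, `x 0 = c`. -/
def odeResidual (g : C(ℝ × P × Q, Q)) (c : Q) (v : P × C(Icc (0 : ℝ) 1, Q)) :
    C(Icc (0 : ℝ) 1, Q) :=
  v.2 - ContinuousMap.const _ c - primitiveCLM Q (g.comp (graphMap v))

theorem odeResidual_eq_zero_iff (g : C(ℝ × P × Q, Q)) (c : Q) (v : P × C(Icc (0 : ℝ) 1, Q)) :
    odeResidual g c v = 0 ↔
      v.2 = ContinuousMap.const _ c + primitiveCLM Q (g.comp (graphMap v)) := by
  rw [odeResidual, sub_sub, sub_eq_zero]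

variable {g : C(ℝ × P × Q, Q)} {c : Q}

theorem contDiff_odeResidual (hg : ContDiff ℝ ∞ g) : ContDiff ℝ ∞ (odeResidual g c) :=
  (contDiff_snd.sub contDiff_const).sub
    ((primitiveCLM Q).contDiff.comp
      ((ContinuousMap.contDiff_comp_left g hg).comp contDiff_graphMap))

/-- The derivative of a smooth map, as a continuous map. -/
def fderivCM (g : C(ℝ × P × Q, Q)) (hg : ContDiff ℝ ∞ g) :
    C(ℝ × P × Q, (ℝ × P × Q) →L[ℝ] Q) :=
  ⟨fderiv ℝ g, (hg.fderiv_right (m := ∞) (by simp)).continuous⟩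

theorem hasFDerivAt_odeResidual (hg : ContDiff ℝ ∞ g) (v : P × C(Icc (0 : ℝ) 1, Q)) :
    HasFDerivAt (odeResidual g c)
      (ContinuousLinearMap.snd ℝ P _ - primitiveCLM Q ∘L
        (pointwiseApply _ _ Q ((fderivCM g hg).comp (graphMap v))) ∘L graphCLM Q P) v :=
  (hasFDerivAt_snd.sub_const _).sub
    ((primitiveCLM Q).hasFDerivAt.comp v
      ((ContinuousMap.hasFDerivAt_comp_left g (fderivCM g hg)
        (fun z => (hg.differentiable (by simp) z).hasFDerivAt) (graphMap v)).comp v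
          (hasFDerivAt_graphMap v)))

/-- The derivative of `odeResidual` in the curve is the identity minus a Volterra operator, so the
implicit function theorem applies at every solution, with no smallness assumption. -/
theorem isInvertible_fderiv_odeResidual (hg : ContDiff ℝ ∞ g) (v : P × C(Icc (0 : ℝ) 1, Q)) :
    (fderiv ℝ (odeResidual g c) v ∘L ContinuousLinearMap.inr ℝ P _).IsInvertible := by
  let A : C(Icc (0 : ℝ) 1, Q →L[ℝ] Q) :=
    ⟨fun r => (fderivCM g hg (graphMap v r)) ∘L
      (ContinuousLinearMap.inr ℝ ℝ (P × Q) ∘L ContinuousLinearMap.inr ℝ P Q), by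
        have : Continuous fun r => fderivCM g hg (graphMap v r) := by fun_prop
        exact this.clm_comp continuous_const⟩
  obtain ⟨u, hu⟩ := isUnit_one_sub_volterra A
  refine ⟨ContinuousLinearEquiv.unitsEquiv ℝ _ u, ?_⟩
  rw [(hasFDerivAt_odeResidual hg v).fderiv]
  ext1 h
  have h1 : (ContinuousLinearEquiv.unitsEquiv ℝ _ u) h =
      (u : C(Icc (0 : ℝ) 1, Q) →L[ℝ] C(Icc (0 : ℝ) 1, Q)) h := rfl
  refine h1.trans ?_
  rw [hu]
  have h2 : pointwiseApply _ _ Q ((fderivCM g hg).comp (graphMap v))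
      (graphCLM Q P (0, h)) = pointwiseApply _ _ Q A h := by
    ext r
    simp [A]
  simp only [sub_apply, ContinuousLinearMap.comp_apply,
    one_apply_eq_self, ContinuousLinearMap.inr_apply, ContinuousLinearMap.coe_snd', h2]

variable [CompleteSpace P]

/-- A continuous family of solutions of a smooth differential equation depending smoothly on
parameters is smooth, since it agrees near each of its points with an implicit function. -/
theorem contDiffWithinAt_of_odeResidual_eq_zero (hg : ContDiff ℝ ∞ g) {S : Set P}
    {Y : P → C(Icc (0 : ℝ) 1, Q)} {y₀ : P} (hy₀ : y₀ ∈ S) (hY : ContinuousWithinAt Y S y₀)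
    (h : ∀ᶠ y in 𝓝[S] y₀, odeResidual g c (y, Y y) = 0) : ContDiffWithinAt ℝ ∞ Y S y₀ := by
  have cdf : ContDiffAt ℝ ∞ (odeResidual g c) (y₀, Y y₀) := (contDiff_odeResidual hg).contDiffAt
  have hinv := isInvertible_fderiv_odeResidual (c := c) hg (y₀, Y y₀)
  have h1 := cdf.eventually_apply_eq_iff_implicitFunction (by simp) hinv
  have h2 : Filter.Tendsto (fun y => (y, Y y)) (𝓝[S] y₀) (𝓝 (y₀, Y y₀)) :=
    (Filter.tendsto_id.mono_left nhdsWithin_le_nhds).prodMk_nhds hY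
  have h3 : odeResidual g c (y₀, Y y₀) = 0 := h.self_of_nhdsWithin hy₀
  refine (cdf.contDiffAt_implicitFunction (by simp) hinv).contDiffWithinAt.congr_of_eventuallyEq
    ?_ ?_
  · filter_upwards [h2.eventually h1, h] with y hy hy'
    exact (hy.1 (hy'.trans h3.symm)).symm
  · exact (h1.self_of_nhds.1 rfl).symm

/-- A solution on the whole of `[0, 1]` extends to a smooth family of solutions with the same
initial value, parametrized by a neighbourhood of the parameter. -/
theorem exists_family_of_odeResidual_eq_zero (hg : ContDiff ℝ ∞ g) {y₀ : P}
    {x₀ : C(Icc (0 : ℝ) 1, Q)} (h : odeResidual g c (y₀, x₀) = 0) :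
    ∃ X : P → C(Icc (0 : ℝ) 1, Q), X y₀ = x₀ ∧
      ∀ᶠ y in 𝓝 y₀, ContDiffAt ℝ ∞ X y ∧ odeResidual g c (y, X y) = 0 := by
  have cdf : ContDiffAt ℝ ∞ (odeResidual g c) (y₀, x₀) := (contDiff_odeResidual hg).contDiffAt
  have hinv := isInvertible_fderiv_odeResidual (c := c) hg (y₀, x₀)
  refine ⟨cdf.implicitFunction (by simp) hinv, cdf.implicitFunction_apply_self (by simp) hinv, ?_⟩
  have h1 := cdf.eventually_apply_implicitFunction (by simp) hinv
  rw [h] at h1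
  have h2 : ∀ᶠ y in 𝓝 y₀, ContDiffAt ℝ 1 (cdf.implicitFunction (by simp) hinv) y :=
    ((cdf.contDiffAt_implicitFunction (by simp) hinv).of_le (by simp)).eventually (by simp)
  filter_upwards [h1, h2, h1.eventually_nhds] with y hy1 hy2 hy3
  refine ⟨?_, hy1⟩
  rw [← contDiffWithinAt_univ]
  exact contDiffWithinAt_of_odeResidual_eq_zero hg (mem_univ y)
    hy2.continuousAt.continuousWithinAt (by rwa [nhdsWithin_univ])

/-- The derivative of a family of solutions solves the linearized equation. -/
theorem fderiv_family_eq (hg : ContDiff ℝ ∞ g) {y₀ : P} {X : P → C(Icc (0 : ℝ) 1, Q)}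
    {X' : P →L[ℝ] C(Icc (0 : ℝ) 1, Q)} (hX : HasFDerivAt X X' y₀)
    (h : ∀ᶠ y in 𝓝 y₀, odeResidual g c (y, X y) = 0) (e : P) :
    X' e = primitiveCLM Q
      (pointwiseApply _ _ Q ((fderivCM g hg).comp (graphMap (y₀, X y₀))) (graphCLM Q P (e, X' e)))
    := by
  have h1 := (hasFDerivAt_odeResidual (c := c) hg (y₀, X y₀)).comp y₀
    ((hasFDerivAt_id y₀).prodMk hX)
  have h2 : HasFDerivAt (odeResidual g c ∘ fun y => (id y, X y)) (0 : P →L[ℝ] _) y₀ :=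
    (hasFDerivAt_const (0 : C(Icc (0 : ℝ) 1, Q)) y₀).congr_of_eventuallyEq h
  have h3 := congrArg (fun T => T e) (h1.unique h2)
  simp only [ContinuousLinearMap.comp_apply, sub_apply,
    ContinuousLinearMap.coe_snd', ContinuousLinearMap.prod_apply, zero_apply,
    ContinuousLinearMap.id_apply] at h3
  exact sub_eq_zero.1 h3

end Volterra

/-! ### Calculus preliminaries -/

/-- Inverse function theorem, with an inverse that is smooth on its whole domain. -/
theorem exists_openPartialHomeomorph_of_hasFDerivAt {E G : Type*}
    [NormedAddCommGroup E] [NormedSpace ℝ E] [CompleteSpace E]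
    [NormedAddCommGroup G] [NormedSpace ℝ G]
    {f : E → G} {U : Set E} (hU : IsOpen U) (hf : ContDiffOn ℝ ∞ f U) {x : E} (hx : x ∈ U)
    (e : E ≃L[ℝ] G) (he : HasFDerivAt f (e : E →L[ℝ] G) x) :
    ∃ φ : OpenPartialHomeomorph E G, x ∈ φ.source ∧ φ.source ⊆ U ∧ (∀ y, φ y = f y) ∧
      ContDiffOn ℝ ∞ φ.symm φ.target := by
  have hfx : ContDiffAt ℝ ∞ f x := hf.contDiffAt (hU.mem_nhds hx)
  let φ₀ := hfx.toOpenPartialHomeomorph f he (by simp)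
  have hφ₀ : ∀ y, φ₀ y = f y := fun y => rfl
  have hcont : ContinuousOn (fderiv ℝ f) U := hf.continuousOn_fderiv_of_isOpen hU (by simp)
  have hV : IsOpen (U ∩ fderiv ℝ f ⁻¹' range ((↑) : (E ≃L[ℝ] G) → E →L[ℝ] G)) :=
    hcont.isOpen_inter_preimage hU ContinuousLinearEquiv.isOpen
  refine ⟨φ₀.restrOpen _ hV, ⟨hfx.mem_toOpenPartialHomeomorph_source he (by simp), hx, ?_⟩,
    fun y hy => hy.2.1, fun y => rfl, fun y hy => ?_⟩
  · exact ⟨e, he.fderiv.symm⟩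
  · have hy' := (φ₀.restrOpen _ hV).map_target hy
    obtain ⟨hyU, e', he'⟩ := hy'.2
    have hd : HasFDerivAt f (e' : E →L[ℝ] G) ((φ₀.restrOpen _ hV).symm y) := by
      rw [he']
      exact ((hf.contDiffAt (hU.mem_nhds hyU)).differentiableAt (by simp)).hasFDerivAt
    exact ((φ₀.restrOpen _ hV).contDiffAt_symm hy hd
      (hf.contDiffAt (hU.mem_nhds hyU))).contDiffWithinAt

/-- The fundamental lemma of the calculus of variations on a compact interval. -/
theorem eqOn_zero_of_forall_integral_smul_eq_zero {t₀ t₁ : ℝ} (ht : t₀ < t₁) {f : ℝ → ℝ}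
    (hf : ContinuousOn f (Icc t₀ t₁))
    (h : ∀ χ : ℝ → ℝ, ContDiff ℝ ∞ χ → HasCompactSupport χ → tsupport χ ⊆ Ioo t₀ t₁ →
      ∫ s in t₀..t₁, χ s * f s = 0) : ∀ s ∈ Icc t₀ t₁, f s = 0 := by
  have h1 : ∀ᵐ s ∂volume, s ∈ Ioo t₀ t₁ → f s = 0 := by
    refine isOpen_Ioo.ae_eq_zero_of_integral_contDiff_smul_eq_zero
      ((hf.mono Ioo_subset_Icc_self).locallyIntegrableOn measurableSet_Ioo) fun χ hχ hc hs => ?_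
    rw [← h χ hχ hc hs, intervalIntegral.integral_of_le ht.le, ← integral_indicator
      measurableSet_Ioc]
    congr 1
    ext s
    by_cases hs' : s ∈ Ioc t₀ t₁
    · rw [indicator_of_mem hs', smul_eq_mul]
    · have h0 : χ s = 0 :=
        image_eq_zero_of_notMem_tsupport fun hmem => hs' (Ioo_subset_Ioc_self (hs hmem))
      rw [indicator_of_notMem hs', h0, zero_smul]
  have h2 : f =ᵐ[volume.restrict (Ioo t₀ t₁)] fun _ => (0 : ℝ) :=
    (ae_restrict_iff' measurableSet_Ioo).2 h1
  have h3 : EqOn f (fun _ => 0) (Ioo t₀ t₁) :=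
    Measure.eqOn_open_of_ae_eq h2 isOpen_Ioo (hf.mono Ioo_subset_Icc_self) continuousOn_const
  have h4 := h3.of_subset_closure hf continuousOn_const Ioo_subset_Icc_self
    (closure_Ioo ht.ne).ge
  exact h4

theorem integral_eq_sub_of_hasDerivWithinAt_Icc {E : Type*} [NormedAddCommGroup E]
    [NormedSpace ℝ E] [CompleteSpace E] {a b : ℝ} (hab : a ≤ b) {f f' : ℝ → E}
    (hf : ∀ s ∈ Icc a b, HasDerivWithinAt f (f' s) (Icc a b) s) (hf' : ContinuousOn f' (Icc a b)) :
    ∫ s in a..b, f' s = f b - f a :=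
  intervalIntegral.integral_eq_sub_of_hasDerivAt_of_le hab
    (fun s hs => (hf s hs).continuousWithinAt)
    (fun s hs => (hf s (Ioo_subset_Icc_self hs)).hasDerivAt (Icc_mem_nhds hs.1 hs.2))
    (ContinuousOn.intervalIntegrable (by rwa [uIcc_of_le hab]))

/-- A compact subset of an open interval lies in a smaller open interval. -/
theorem IsCompact.exists_subset_Ioo {t₀ t₁ : ℝ} (ht : t₀ < t₁) {K : Set ℝ} (hK : IsCompact K)
    (hKt : K ⊆ Ioo t₀ t₁) : ∃ a b, t₀ < a ∧ a < b ∧ b < t₁ ∧ K ⊆ Ioo a b := by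
  rcases K.eq_empty_or_nonempty with rfl | hne
  · obtain ⟨a, ha, ha'⟩ := exists_between ht
    obtain ⟨b, hb, hb'⟩ := exists_between ha'
    exact ⟨a, b, ha, hb, hb', empty_subset _⟩
  · obtain ⟨m, hm, hm'⟩ := hK.exists_isLeast hne
    obtain ⟨M, hM, hM'⟩ := hK.exists_isGreatest hne
    obtain ⟨a, ha, ha'⟩ := exists_between (hKt hm).1
    obtain ⟨b, hb, hb'⟩ := exists_between (hKt hM).2
    exact ⟨a, b, ha, ha'.trans_le ((hm' hM).trans hb.le), hb', fun x hx =>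
      ⟨ha'.trans_le (hm' hx), (hM' hx).trans_lt hb⟩⟩

/-- A smooth cutoff function equal to `1` on `[a, b]` and supported in a larger open interval. -/
theorem exists_smooth_cutoff {t₀ a b t₁ : ℝ} (ha : t₀ < a) (hab : a < b) (hb : b < t₁) :
    ∃ χ : ℝ → ℝ, ContDiff ℝ ∞ χ ∧ tsupport χ ⊆ Ioo t₀ t₁ ∧ ∀ s ∈ Icc a b, χ s = 1 := by
  let δ := min (a - t₀) (t₁ - b)
  have hδ : 0 < δ := lt_min (by linarith) (by linarith)
  have h1 : δ ≤ a - t₀ := min_le_left _ _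
  have h2 : δ ≤ t₁ - b := min_le_right _ _
  let φ : ContDiffBump ((a + b) / 2) :=
    ⟨(b - a) / 2, (b - a) / 2 + δ / 2, by linarith, by linarith⟩
  refine ⟨φ, φ.contDiff, ?_, fun s hs => φ.one_of_mem_closedBall ?_⟩
  · rw [φ.tsupport_eq, Real.closedBall_eq_Icc]
    refine fun s hs => ⟨?_, ?_⟩
    · have := hs.1; simp only [φ] at this; linarith
    · have := hs.2; simp only [φ] at this; linarith
  · rw [Real.closedBall_eq_Icc]
    exact ⟨by simp only [φ]; linarith [hs.1], by simp only [φ]; linarith [hs.2]⟩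

/-- Multiplication by a cutoff extends a curve that is smooth on `[t₀, t₁]` to all of `ℝ`. -/
theorem contDiff_smul_of_tsupport_subset {Z : Type*} [NormedAddCommGroup Z] [NormedSpace ℝ Z]
    {t₀ t₁ : ℝ} {χ : ℝ → ℝ} (hχ : ContDiff ℝ ∞ χ) (hs : tsupport χ ⊆ Ioo t₀ t₁) {z : ℝ → Z}
    (hz : ContDiffOn ℝ ∞ z (Icc t₀ t₁)) : ContDiff ℝ ∞ (fun s => χ s • z s) := by
  rw [contDiff_iff_contDiffAt]
  intro s
  by_cases h : s ∈ Ioo t₀ t₁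
  · exact hχ.contDiffAt.smul (hz.contDiffAt (Icc_mem_nhds h.1 h.2))
  · have h1 : χ =ᶠ[𝓝 s] 0 := notMem_tsupport_iff_eventuallyEq.1 fun hmem => h (hs hmem)
    refine (contDiffAt_const (c := (0 : Z))).congr_of_eventuallyEq ?_
    filter_upwards [h1] with τ hτ
    simp [hτ]

/-! ### Linear differential equations -/

section LinearODE

variable {Q : Type} [NormedAddCommGroup Q] [NormedSpace ℝ Q] [CompleteSpace Q]

theorem hasDerivWithinAt_of_eq_const_add_primitive {c : Q} {x h : C(Icc (0 : ℝ) 1, Q)}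
    (hx : x = ContinuousMap.const _ c + primitiveCLM Q h) {r : ℝ} (hr : r ∈ Icc (0 : ℝ) 1) :
    HasDerivWithinAt (IccExtend zero_le_one x) (h ⟨r, hr⟩) (Icc 0 1) r := by
  have h2 : IccExtend (zero_le_one (α := ℝ)) x = fun s =>
      c + IccExtend zero_le_one (primitiveCLM Q h) s := by
    rw [hx]
    rfl
  rw [h2]
  exact (hasDerivWithinAt_primitiveCLM h r hr).const_add c

theorem div_sub_mem_unit {a b s : ℝ} (hab : a < b) (hs : s ∈ Icc a b) :
    (s - a) / (b - a) ∈ Icc (0 : ℝ) 1 :=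
  ⟨div_nonneg (by linarith [hs.1]) (by linarith),
    (div_le_one (by linarith)).2 (by linarith [hs.2])⟩

theorem add_mul_sub_mem_Icc {a b r : ℝ} (hab : a ≤ b) (hr : r ∈ Icc (0 : ℝ) 1) :
    a + r * (b - a) ∈ Icc a b :=
  ⟨by nlinarith [hr.1], by nlinarith [hr.2]⟩

/-- The curve on `[a, b]` encoded by its reparametrization to `[0, 1]`. -/
def unscale (a b : ℝ) (x : C(Icc (0 : ℝ) 1, Q)) (s : ℝ) : Q :=
  IccExtend zero_le_one x ((s - a) / (b - a))

theorem unscale_of_mem {a b : ℝ} {x : C(Icc (0 : ℝ) 1, Q)} (hab : a < b) {s : ℝ}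
    (hs : s ∈ Icc a b) :
    unscale a b x s = x ⟨(s - a) / (b - a), div_sub_mem_unit hab hs⟩ :=
  IccExtend_of_mem _ _ _

theorem unscale_right {a b : ℝ} {x : C(Icc (0 : ℝ) 1, Q)} (hab : a < b) :
    unscale a b x b = x ⟨1, right_mem_Icc.2 zero_le_one⟩ := by
  rw [unscale_of_mem hab (right_mem_Icc.2 hab.le)]
  congr
  exact div_self (sub_pos.2 hab).ne'

theorem unscale_left {a b : ℝ} (hab : a < b) {c : Q} {x h : C(Icc (0 : ℝ) 1, Q)}
    (hx : x = ContinuousMap.const _ c + primitiveCLM Q h) : unscale a b x a = c := by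
  rw [unscale_of_mem hab (left_mem_Icc.2 hab.le), hx]
  simp [primitiveCLM_apply]

theorem hasDerivWithinAt_unscale {a b : ℝ} (hab : a < b) {c : Q} {x h : C(Icc (0 : ℝ) 1, Q)}
    (hx : x = ContinuousMap.const _ c + primitiveCLM Q h) {s : ℝ} (hs : s ∈ Icc a b) :
    HasDerivWithinAt (unscale a b x)
      ((b - a)⁻¹ • h ⟨(s - a) / (b - a), div_sub_mem_unit hab hs⟩) (Icc a b) s := by
  have h1 : HasDerivWithinAt (fun s => (s - a) / (b - a)) (1 / (b - a)) (Icc a b) s :=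
    (((hasDerivAt_id s).sub_const a).div_const _).hasDerivWithinAt
  have h2 := (hasDerivWithinAt_of_eq_const_add_primitive hx (div_sub_mem_unit hab hs)).scomp s h1
    fun _ => div_sub_mem_unit hab
  rw [one_div] at h2
  exact h2

/-- Linear differential equations have solutions on the whole interval of definition. -/
theorem exists_linear_ode_solution {t₀ t₁ : ℝ} (ht : t₀ < t₁) {A : ℝ → Q →L[ℝ] Q}
    (hA : ContinuousOn A (Icc t₀ t₁)) (c : Q) :
    ∃ y : ℝ → Q, y t₀ = c ∧ ∀ s ∈ Icc t₀ t₁, HasDerivWithinAt y (A s (y s)) (Icc t₀ t₁) s := by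
  have hT : 0 < t₁ - t₀ := sub_pos.2 ht
  have hA' : Continuous fun r : Icc (0 : ℝ) 1 => A (t₀ + (r : ℝ) * (t₁ - t₀)) :=
    hA.comp_continuous (by fun_prop) fun r => add_mul_sub_mem_Icc ht.le r.2
  -- rescaled to `[0, 1]`, the equation is linear with a Volterra operator of coefficient `B`
  let B : C(Icc (0 : ℝ) 1, Q →L[ℝ] Q) :=
    ⟨fun r => (t₁ - t₀) • A (t₀ + r * (t₁ - t₀)), hA'.const_smul (t₁ - t₀)⟩
  obtain ⟨u, hu⟩ := isUnit_one_sub_volterra B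
  let x : C(Icc (0 : ℝ) 1, Q) := (↑u⁻¹ : C(Icc (0 : ℝ) 1, Q) →L[ℝ] C(Icc (0 : ℝ) 1, Q))
    (ContinuousMap.const _ c)
  have hx : x - primitiveCLM Q (pointwiseApply _ Q Q B x) = ContinuousMap.const _ c := by
    have h1 : (u * u⁻¹ : (C(Icc (0 : ℝ) 1, Q) →L[ℝ] C(Icc (0 : ℝ) 1, Q))ˣ) = 1 := mul_inv_cancel u
    have h2 := congrArg (fun T : (C(Icc (0 : ℝ) 1, Q) →L[ℝ] C(Icc (0 : ℝ) 1, Q))ˣ =>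
      (T : C(Icc (0 : ℝ) 1, Q) →L[ℝ] C(Icc (0 : ℝ) 1, Q)) (ContinuousMap.const _ c)) h1
    have h3 : (u : C(Icc (0 : ℝ) 1, Q) →L[ℝ] C(Icc (0 : ℝ) 1, Q)) x = ContinuousMap.const _ c := h2
    rw [hu] at h3
    exact h3
  have hx' : x = ContinuousMap.const _ c + primitiveCLM Q (pointwiseApply _ Q Q B x) := by
    rw [← hx, sub_add_cancel]
  refine ⟨unscale t₀ t₁ x, unscale_left ht hx', fun s hs => ?_⟩
  refine (hasDerivWithinAt_unscale ht hx' hs).congr_deriv ?_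
  have h3 : t₀ + (s - t₀) / (t₁ - t₀) * (t₁ - t₀) = s := by field_simp; ring
  rw [unscale_of_mem ht hs]
  simp only [B, pointwiseApply_apply, ContinuousMap.coe_mk, smul_apply, h3,
    smul_smul]
  rw [inv_mul_cancel₀ hT.ne', one_smul]

/-- The transition operator `R s` from time `s` to time `t₁` of the equation `x' = A x`. -/
theorem exists_adjoint_transition {t₀ t₁ : ℝ} (ht : t₀ < t₁) {A : ℝ → Q →L[ℝ] Q}
    (hA : ContinuousOn A (Icc t₀ t₁)) :
    ∃ R : ℝ → Q →L[ℝ] Q, R t₁ = ContinuousLinearMap.id ℝ Q ∧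
      ∀ s ∈ Icc t₀ t₁, HasDerivWithinAt R (-(R s ∘L A s)) (Icc t₀ t₁) s := by
  have hrev : MapsTo (fun s => t₀ + t₁ - s) (Icc t₀ t₁) (Icc t₀ t₁) := fun s hs =>
    ⟨by linarith [hs.2], by linarith [hs.1]⟩
  obtain ⟨S, hS0, hS⟩ := exists_linear_ode_solution (Q := Q →L[ℝ] Q) ht
    (A := fun s => (ContinuousLinearMap.compL ℝ Q Q Q).flip (A (t₀ + t₁ - s)))
    ((ContinuousLinearMap.continuous _).comp_continuousOn
      (hA.comp (by fun_prop) hrev)) (ContinuousLinearMap.id ℝ Q)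
  refine ⟨fun s => S (t₀ + t₁ - s), by simp [hS0], fun s hs => ?_⟩
  have h1 : HasDerivWithinAt (fun s => t₀ + t₁ - s) (-1) (Icc t₀ t₁) s :=
    ((hasDerivAt_id s).const_sub (t₀ + t₁)).hasDerivWithinAt
  have h2 := (hS _ (hrev hs)).scomp s h1 hrev
  refine h2.congr_deriv ?_
  simp

end LinearODE

/-! ### Spanning by control variations -/

section Controls

variable {Q Z : Type} [NormedAddCommGroup Q] [NormedSpace ℝ Q] [FiniteDimensional ℝ Q]
  [NormedAddCommGroup Z] [NormedSpace ℝ Z]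

/-- If no nonzero covector annihilates all the operators `C s`, the vectors `∫ C s (ζ s) ds`, with
`ζ` a test function, fill the space; the conclusion chooses such a `ζ` linearly. -/
theorem exists_control_right_inverse {t₀ t₁ : ℝ} (ht : t₀ < t₁) {C : ℝ → Z →L[ℝ] Q}
    (hC : ContinuousOn C (Icc t₀ t₁))
    (h : ∀ w : Q →L[ℝ] ℝ, (∀ s ∈ Icc t₀ t₁, w ∘L C s = 0) → w = 0) :
    ∃ ζ : ℝ → Q →L[ℝ] Z, ContDiff ℝ ∞ ζ ∧ IsCompact (tsupport ζ) ∧ tsupport ζ ⊆ Ioo t₀ t₁ ∧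
      ∀ u, ∫ s in t₀..t₁, C s (ζ s u) = u := by
  have hint : ∀ ζ : ℝ → Z, Continuous ζ →
      IntervalIntegrable (fun s => C s (ζ s)) volume t₀ t₁ := fun ζ hζ =>
    ContinuousOn.intervalIntegrable (by
      rw [uIcc_of_le ht.le]
      exact hC.clm_apply hζ.continuousOn)
  let 𝓢 : Submodule ℝ Q :=
    { carrier := {v | ∃ ζ : ℝ → Z, ContDiff ℝ ∞ ζ ∧ HasCompactSupport ζ ∧ tsupport ζ ⊆ Ioo t₀ t₁ ∧
        ∫ s in t₀..t₁, C s (ζ s) = v}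
      zero_mem' := ⟨fun _ => 0, contDiff_const, HasCompactSupport.zero, by simp [tsupport], by simp⟩
      add_mem' := by
        rintro _ _ ⟨ζ, h1, h2, h3, rfl⟩ ⟨η, h1', h2', h3', rfl⟩
        refine ⟨fun s => ζ s + η s, h1.add h1', h2.add h2',
          (tsupport_add ζ η).trans (union_subset h3 h3'), ?_⟩
        rw [← intervalIntegral.integral_add (hint _ h1.continuous) (hint _ h1'.continuous)]
        simp
      smul_mem' := by
        rintro c _ ⟨ζ, h1, h2, h3, rfl⟩
        refine ⟨fun s => c • ζ s, h1.const_smul c, h2.smul_left (f := fun _ => c),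
          (closure_mono (Function.support_const_smul_subset c ζ)).trans h3, ?_⟩
        rw [← intervalIntegral.integral_smul]
        simp }
  have htop : 𝓢 = ⊤ := by
    by_contra hne
    -- a functional vanishing on `𝓢` annihilates all `C s`, by the fundamental lemma
    obtain ⟨f, hf, hle⟩ := Submodule.exists_le_ker_of_lt_top 𝓢 (lt_top_iff_ne_top.2 hne)
    refine hf ?_
    let w : Q →L[ℝ] ℝ := LinearMap.toContinuousLinearMap f
    have hw : w = 0 := by
      refine h w fun s hs => ?_
      ext z
      refine eqOn_zero_of_forall_integral_smul_eq_zero ht (f := fun s => w (C s z))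
        (w.continuous.comp_continuousOn (hC.clm_apply continuousOn_const)) (fun χ h1 h2 h3 => ?_)
        s hs
      have hmem : ∫ s in t₀..t₁, C s (χ s • z) ∈ 𝓢 :=
        ⟨fun s => χ s • z, h1.smul contDiff_const, h2.smul_right,
          (closure_mono (Function.support_smul_subset_left χ fun _ => z)).trans h3, rfl⟩
      have h4 : w (∫ s in t₀..t₁, C s (χ s • z)) = 0 := hle hmem
      rw [← w.intervalIntegral_comp_comm
        (hint (fun s => χ s • z) (h1.continuous.smul continuous_const))] at h4
      simpa using h4
    ext v
    exact congrArg (fun T : Q →L[ℝ] ℝ => T v) hw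
  let b := Module.finBasis ℝ Q
  have hb : ∀ i, ∃ ζ : ℝ → Z, ContDiff ℝ ∞ ζ ∧ HasCompactSupport ζ ∧ tsupport ζ ⊆ Ioo t₀ t₁ ∧
      ∫ s in t₀..t₁, C s (ζ s) = b i := fun i => by
    have : b i ∈ 𝓢 := htop ▸ Submodule.mem_top
    exact this
  choose ζ h1 h2 h3 h4 using hb
  let co : ∀ i, Q →L[ℝ] ℝ := fun i => LinearMap.toContinuousLinearMap (b.coord i)
  have hsub : tsupport (fun s => ∑ i, (co i).smulRight (ζ i s)) ⊆ ⋃ i, tsupport (ζ i) := by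
    refine closure_minimal (fun s hs => ?_)
      (isClosed_iUnion_of_finite fun i => isClosed_tsupport _)
    by_contra hs'
    refine hs (Finset.sum_eq_zero fun i _ => ?_)
    rw [image_eq_zero_of_notMem_tsupport (fun hi => hs' (mem_iUnion.2 ⟨i, hi⟩))]
    simp
  refine ⟨fun s => ∑ i, (co i).smulRight (ζ i s), ?_, ?_, ?_, fun u => ?_⟩
  · exact ContDiff.sum fun i _ => contDiff_const.smulRight (h1 i)
  · exact (isCompact_iUnion fun i => (h2 i).isCompact).of_isClosed_subset
      (isClosed_tsupport _) hsub
  · exact hsub.trans (iUnion_subset h3)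
  · have h5 : ∀ s, C s ((∑ i, (co i).smulRight (ζ i s)) u) = ∑ i, co i u • C s (ζ i s) := by
      intro s
      simp [map_sum]
    simp_rw [h5]
    rw [intervalIntegral.integral_finsetSum (f := fun i s => co i u • C s (ζ i s))
      fun i _ => (hint _ (h1 i).continuous).smul (co i u)]
    simp_rw [intervalIntegral.integral_smul, h4]
    exact b.sum_repr u

end Controls

/-! ### Endpoint variations of a controlled differential equation -/

section Endpoint

variable {Q Z : Type} [NormedAddCommGroup Q] [NormedSpace ℝ Q] [FiniteDimensional ℝ Q]
  [NormedAddCommGroup Z] [NormedSpace ℝ Z] [FiniteDimensional ℝ Z]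

/-- The right-hand side of the equation `x' = ψ (s, x, z s + ζ s u)` on `[a, s]`, rescaled to the
time interval `[0, 1]`; the final time `s` has become a parameter, along with `u`. -/
def rescaledRHS (ψ : ℝ × Q × Z → Q) (a : ℝ) (z : ℝ → Z) (ζ : ℝ → Q →L[ℝ] Z)
    (v : ℝ × (Q × ℝ) × Q) : Q :=
  (v.2.1.2 - a) • ψ (a + v.1 * (v.2.1.2 - a), v.2.2,
    z (a + v.1 * (v.2.1.2 - a)) + ζ (a + v.1 * (v.2.1.2 - a)) v.2.1.1)

variable {ψ : ℝ × Q × Z → Q} {z : ℝ → Z} {ζ : ℝ → Q →L[ℝ] Z} {a b : ℝ}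

theorem contDiff_rescaledRHS (hψ : ContDiff ℝ ∞ ψ) (hz : ContDiff ℝ ∞ z) (hζ : ContDiff ℝ ∞ ζ) :
    ContDiff ℝ ∞ (rescaledRHS ψ a z ζ) := by
  have h1 : ContDiff ℝ ∞ fun v : ℝ × (Q × ℝ) × Q => a + v.1 * (v.2.1.2 - a) := by fun_prop
  have h2 : ContDiff ℝ ∞ fun v : ℝ × (Q × ℝ) × Q => v.2.1.2 - a := by fun_prop
  exact h2.smul (hψ.comp (h1.prodMk (contDiff_snd.snd.prodMk
    ((hz.comp h1).add ((hζ.comp h1).clm_apply contDiff_snd.fst.fst)))))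

theorem fderiv_rescaledRHS (hψ : ContDiff ℝ ∞ ψ) (hz : ContDiff ℝ ∞ z) (hζ : ContDiff ℝ ∞ ζ)
    (r : ℝ) (x e v : Q) :
    fderiv ℝ (rescaledRHS ψ a z ζ) (r, (0, b), x) (0, (e, 0), v) =
      (b - a) • fderiv ℝ ψ (a + r * (b - a), x, z (a + r * (b - a)))
        (0, v, ζ (a + r * (b - a)) e) := by
  set σ := a + r * (b - a) with hσ
  have h1 : HasDerivAt (fun τ : ℝ => ((r, (τ • e, b), x + τ • v) : ℝ × (Q × ℝ) × Q))
      (0, (e, 0), v) 0 := by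
    refine (hasDerivAt_const _ _).prodMk (HasDerivAt.prodMk (HasDerivAt.prodMk ?_
      (hasDerivAt_const _ _)) ?_)
    · simpa using (hasDerivAt_id (0 : ℝ)).smul_const e
    · simpa using ((hasDerivAt_id (0 : ℝ)).smul_const v).const_add x
  have h2 : HasDerivAt (fun τ : ℝ => ((σ, x + τ • v, z σ + ζ σ (τ • e)) : ℝ × Q × Z))
      (0, v, ζ σ e) 0 := by
    refine (hasDerivAt_const _ _).prodMk (HasDerivAt.prodMk ?_ ?_)
    · simpa using ((hasDerivAt_id (0 : ℝ)).smul_const v).const_add x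
    · simpa using ((hasDerivAt_id (0 : ℝ)).smul_const (ζ σ e)).const_add (z σ)
  have h3 : HasFDerivAt (rescaledRHS ψ a z ζ) (fderiv ℝ (rescaledRHS ψ a z ζ) (r, (0, b), x))
      ((r, ((0 : ℝ) • e, b), x + (0 : ℝ) • v) : ℝ × (Q × ℝ) × Q) := by
    rw [zero_smul, zero_smul, add_zero]
    exact ((contDiff_rescaledRHS hψ hz hζ).differentiable (by simp) _).hasFDerivAt
  have h4 : HasFDerivAt ψ (fderiv ℝ ψ (σ, x, z σ))
      ((σ, x + (0 : ℝ) • v, z σ + ζ σ ((0 : ℝ) • e)) : ℝ × Q × Z) := by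
    rw [zero_smul, zero_smul, add_zero, map_zero, add_zero]
    exact (hψ.differentiable (by simp) _).hasFDerivAt
  exact (h3.comp_hasDerivAt (0 : ℝ) h1).unique ((h4.comp_hasDerivAt (0 : ℝ) h2).const_smul (b - a))

/-- `rescaledRHS` as a continuous map. -/
def rescaledCM (hψ : ContDiff ℝ ∞ ψ) (hz : ContDiff ℝ ∞ z) (hζ : ContDiff ℝ ∞ ζ) (a : ℝ) :
    C(ℝ × (Q × ℝ) × Q, Q) := ⟨rescaledRHS ψ a z ζ, (contDiff_rescaledRHS hψ hz hζ).continuous⟩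

/-- A solution on `[a, b]`, restricted to `[a, s]` and rescaled to `[0, 1]`, is a zero of the
residual with the final time `s` as a parameter. -/
theorem odeResidual_rescaledCM_eq_zero (hψ : ContDiff ℝ ∞ ψ) (hz : ContDiff ℝ ∞ z)
    (hζ : ContDiff ℝ ∞ ζ) {X : ℝ → Q} {u : Q}
    (hX : ∀ τ ∈ Icc a b, HasDerivWithinAt X (ψ (τ, X τ, z τ + ζ τ u)) (Icc a b) τ)
    {s : ℝ} (hs : s ∈ Icc a b) {x : C(Icc (0 : ℝ) 1, Q)}
    (hx : ∀ r : Icc (0 : ℝ) 1, x r = X (a + r * (s - a))) :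
    odeResidual (Q := Q) (P := Q × ℝ) (rescaledCM hψ hz hζ a) (X a) ((u, s), x) = 0 := by
  rw [odeResidual_eq_zero_iff]
  ext r
  have hmem : MapsTo (fun ρ : ℝ => a + ρ * (s - a)) (Icc 0 (r : ℝ)) (Icc a b) := fun ρ hρ =>
    Icc_subset_Icc_right hs.2 (add_mul_sub_mem_Icc hs.1 ⟨hρ.1, hρ.2.trans r.2.2⟩)
  have hd : ∀ ρ ∈ Icc (0 : ℝ) r, HasDerivWithinAt (fun ρ : ℝ => X (a + ρ * (s - a)))
      (IccExtend zero_le_one ((rescaledCM hψ hz hζ a).comp (graphMap ((u, s), x))) ρ)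
      (Icc 0 (r : ℝ)) ρ := by
    intro ρ hρ
    have h1 : HasDerivWithinAt (fun ρ : ℝ => a + ρ * (s - a)) (s - a) (Icc 0 (r : ℝ)) ρ := by
      simpa using (((hasDerivAt_id ρ).mul_const (s - a)).const_add a).hasDerivWithinAt
    have h2 := (hX _ (hmem hρ)).scomp ρ h1 hmem
    refine h2.congr_deriv ?_
    have hρ' : ρ ∈ Icc (0 : ℝ) 1 := ⟨hρ.1, hρ.2.trans r.2.2⟩
    rw [IccExtend_of_mem _ _ hρ']
    simp [rescaledCM, rescaledRHS, graphMap, hx]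
  have h3 := integral_eq_sub_of_hasDerivWithinAt_Icc r.2.1 hd
    (continuous_IccExtend_unit _).continuousOn
  have h4 : (ContinuousMap.const (Icc (0 : ℝ) 1) (X a) +
      primitiveCLM Q ((rescaledCM hψ hz hζ a).comp (graphMap ((u, s), x)))) r =
      X a + ∫ τ in (0 : ℝ)..r, IccExtend zero_le_one
        ((rescaledCM hψ hz hζ a).comp (graphMap ((u, s), x))) τ := rfl
  rw [h4, h3]
  simp [hx]

/-- A zero of the rescaled residual gives a solution on `[a, b]` of the original equation. -/
theorem unscale_solution (hψ : ContDiff ℝ ∞ ψ) (hz : ContDiff ℝ ∞ z)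
    (hζ : ContDiff ℝ ∞ ζ) (hab : a < b) {u c : Q} {x : C(Icc (0 : ℝ) 1, Q)}
    (hx : odeResidual (Q := Q) (P := Q × ℝ) (rescaledCM hψ hz hζ a) c ((u, b), x) = 0) :
    unscale a b x a = c ∧ ∀ τ ∈ Icc a b, HasDerivWithinAt (unscale a b x)
      (ψ (τ, unscale a b x τ, z τ + ζ τ u)) (Icc a b) τ := by
  rw [odeResidual_eq_zero_iff] at hx
  refine ⟨unscale_left hab hx, fun τ hτ => ?_⟩
  refine (hasDerivWithinAt_unscale hab hx hτ).congr_deriv ?_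
  have hne : b - a ≠ 0 := (sub_pos.2 hab).ne'
  have h3 : a + (τ - a) / (b - a) * (b - a) = τ := by field_simp; ring
  rw [unscale_of_mem hab hτ]
  simp only [rescaledCM, rescaledRHS, graphMap, ContinuousMap.comp_apply, ContinuousMap.coe_mk,
    h3, smul_smul]
  rw [inv_mul_cancel₀ hne, one_smul]

/-- Joint smoothness in the parameter and in time: the final time is one more parameter of the
rescaled problem. -/
theorem contDiffOn_unscale (hψ : ContDiff ℝ ∞ ψ) (hz : ContDiff ℝ ∞ z)
    (hζ : ContDiff ℝ ∞ ζ) (hab : a < b) {c : Q} {U : Set Q}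
    {Y : Q → C(Icc (0 : ℝ) 1, Q)} (hY : ContinuousOn Y U)
    (h : ∀ u ∈ U, odeResidual (Q := Q) (P := Q × ℝ) (rescaledCM hψ hz hζ a) c ((u, b), Y u) = 0) :
    ContDiffOn ℝ ∞ (fun p : Q × ℝ => unscale a b (Y p.1) p.2) (U ×ˢ Icc a b) := by
  let m : ℝ → C(Icc (0 : ℝ) 1, Icc (0 : ℝ) 1) := fun s =>
    ⟨fun r => projIcc 0 1 zero_le_one ((r : ℝ) * ((s - a) / (b - a))), by fun_prop⟩
  have hm : Continuous m := ContinuousMap.continuous_of_continuous_uncurry _ (by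
    change Continuous fun p : ℝ × Icc (0 : ℝ) 1 =>
      projIcc 0 1 zero_le_one ((p.2 : ℝ) * ((p.1 - a) / (b - a)))
    fun_prop)
  -- the solution with parameter `u`, restricted to `[a, s]` and rescaled
  let W : Q × ℝ → C(Icc (0 : ℝ) 1, Q) := fun p => (Y p.1).comp (m p.2)
  have hW : ContinuousOn W (U ×ˢ Icc a b) :=
    ContinuousOn.compCM (hY.comp continuousOn_fst fun p hp => hp.1)
      (hm.comp continuous_snd).continuousOn
  have hres : ∀ p ∈ U ×ˢ Icc a b,
      odeResidual (Q := Q) (P := Q × ℝ) (rescaledCM hψ hz hζ a) c (p, W p) = 0 := by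
    rintro ⟨u, s⟩ ⟨hu, hs⟩
    obtain ⟨h1, h2⟩ := unscale_solution hψ hz hζ hab (h u hu)
    have h3 := odeResidual_rescaledCM_eq_zero hψ hz hζ h2 hs (x := W (u, s)) fun r => ?_
    · rwa [h1] at h3
    · have h5 : (r : ℝ) * ((s - a) / (b - a)) = (a + r * (s - a) - a) / (b - a) := by ring
      simp only [W, m, ContinuousMap.comp_apply, ContinuousMap.coe_mk, unscale, IccExtend,
        Function.comp_apply, h5]
  have hsm : ContDiffOn ℝ ∞ W (U ×ˢ Icc a b) := fun p hp =>
    contDiffWithinAt_of_odeResidual_eq_zero (contDiff_rescaledRHS hψ hz hζ) hp (hW p hp)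
      (Filter.eventually_of_mem self_mem_nhdsWithin hres)
  refine (((ContinuousMap.evalCLM ℝ (⟨1, right_mem_Icc.2 zero_le_one⟩ : Icc (0 : ℝ) 1) :
    C(Icc (0 : ℝ) 1, Q) →L[ℝ] Q)).contDiff.comp_contDiffOn hsm).congr fun p hp => ?_
  simp [W, m, unscale, IccExtend]

end Endpoint

section Endpoint

variable {Q Z : Type} [NormedAddCommGroup Q] [NormedSpace ℝ Q] [FiniteDimensional ℝ Q]
  [NormedAddCommGroup Z] [NormedSpace ℝ Z] [FiniteDimensional ℝ Z]

/-- The derivative of a family of solutions in the direction of a control variation `e` solves the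
linearized equation on `[a, b]`, with forcing term `ζ e` in the control and initial value `0`. -/
theorem hasDerivWithinAt_unscale_variation {ψ : ℝ × Q × Z → Q} {z : ℝ → Z} {ζ : ℝ → Q →L[ℝ] Z}
    {a b : ℝ} (hψ : ContDiff ℝ ∞ ψ) (hz : ContDiff ℝ ∞ z) (hζ : ContDiff ℝ ∞ ζ) (hab : a < b)
    {c : Q} {X : Q × ℝ → C(Icc (0 : ℝ) 1, Q)} {X' : Q × ℝ →L[ℝ] C(Icc (0 : ℝ) 1, Q)}
    (hX : HasFDerivAt X X' (0, b))
    (h : ∀ᶠ y in 𝓝 ((0 : Q), b),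
      odeResidual (Q := Q) (P := Q × ℝ) (rescaledCM hψ hz hζ a) c (y, X y) = 0) (e : Q) :
    unscale a b (X' (e, 0)) a = 0 ∧ ∀ τ ∈ Icc a b,
      HasDerivWithinAt (unscale a b (X' (e, 0)))
        (fderiv ℝ ψ (τ, unscale a b (X (0, b)) τ, z τ) (0, unscale a b (X' (e, 0)) τ, ζ τ e))
        (Icc a b) τ := by
  have h1 := fderiv_family_eq (Q := Q) (P := Q × ℝ) (c := c) (g := rescaledCM hψ hz hζ a)
    (contDiff_rescaledRHS hψ hz hζ) (y₀ := ((0 : Q), b)) (X := X) (X' := X') hX h (e, 0)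
  have h2 : ∀ w, X' (e, 0) = w → X' (e, 0) = ContinuousMap.const _ (0 : Q) + w := by
    intro w hw
    ext r
    simp [hw]
  replace h2 := h2 _ h1
  refine ⟨unscale_left hab h2, fun τ hτ => (hasDerivWithinAt_unscale hab h2 hτ).congr_deriv ?_⟩
  have hne : b - a ≠ 0 := (sub_pos.2 hab).ne'
  have h3 : a + (τ - a) / (b - a) * (b - a) = τ := by field_simp; ring
  rw [unscale_of_mem hab hτ, unscale_of_mem hab hτ, pointwiseApply_apply, graphCLM_apply]
  have h4 := fderiv_rescaledRHS (a := a) (b := b) hψ hz hζ ((τ - a) / (b - a))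
    (X (0, b) ⟨(τ - a) / (b - a), div_sub_mem_unit hab hτ⟩) e
    (X' (e, 0) ⟨(τ - a) / (b - a), div_sub_mem_unit hab hτ⟩)
  rw [h3] at h4
  refine (congrArg (fun w => (b - a)⁻¹ • w) h4).trans ?_
  rw [smul_smul, inv_mul_cancel₀ hne, one_smul]

open scoped NNReal in
/-- If the equation `x' = ψ (s, x, z)` is unchanged by translations along `e`, and its
linearization along a solution `(x, z)` has no adjoint solution annihilating the control
directions, then `(x, z)` deforms smoothly through solutions with fixed initial point whose final
point moves along `e` with unit speed. -/
theorem exists_endpoint_family {ψ : ℝ × Q × Z → Q} (hψ : ContDiff ℝ ∞ ψ) {K : ℝ≥0}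
    (hK : ∀ s z, LipschitzWith K fun x => ψ (s, x, z)) {e : Q}
    (he : ∀ s x z (τ : ℝ), ψ (s, x + τ • e, z) = ψ (s, x, z)) {t₀ t₁ : ℝ} (ht : t₀ < t₁)
    {x : ℝ → Q} {z : ℝ → Z} (hz : ContDiffOn ℝ ∞ z (Icc t₀ t₁))
    (hx : ∀ s ∈ Icc t₀ t₁, HasDerivWithinAt x (ψ (s, x s, z s)) (Icc t₀ t₁) s)
    (hnd : ∀ p : ℝ → Q →L[ℝ] ℝ,
      (∀ s ∈ Icc t₀ t₁, HasDerivWithinAt p (-(p s ∘L fderiv ℝ ψ (s, x s, z s) ∘L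
        ContinuousLinearMap.inr ℝ ℝ (Q × Z) ∘L ContinuousLinearMap.inl ℝ Q Z)) (Icc t₀ t₁) s) →
      (∀ s ∈ Icc t₀ t₁, p s ∘L fderiv ℝ ψ (s, x s, z s) ∘L
        ContinuousLinearMap.inr ℝ ℝ (Q × Z) ∘L ContinuousLinearMap.inr ℝ Q Z = 0) → p t₁ = 0) :
    ∃ ε > 0, ∃ (X : ℝ → ℝ → Q) (W : ℝ → ℝ → Z),
      ContDiffOn ℝ ∞ (fun y : ℝ × ℝ => X y.1 y.2) (Ioo (-ε) ε ×ˢ Icc t₀ t₁) ∧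
      ContDiffOn ℝ ∞ (fun y : ℝ × ℝ => W y.1 y.2) (Ioo (-ε) ε ×ˢ Icc t₀ t₁) ∧
      (∀ s ∈ Icc t₀ t₁, X 0 s = x s ∧ W 0 s = z s) ∧
      ∀ ξ ∈ Ioo (-ε) ε, X ξ t₀ = x t₀ ∧ X ξ t₁ = x t₁ + ξ • e ∧
        ∀ s ∈ Icc t₀ t₁, HasDerivWithinAt (X ξ) (ψ (s, X ξ s, W ξ s)) (Icc t₀ t₁) s := by
  have hxs : ContDiffOn ℝ ∞ x (Icc t₀ t₁) := by
    refine ODE.contDiffOn_enat_Icc_of_hasDerivWithinAt (n := ⊤) (u := univ)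
      (f := fun s y => ψ (s, y, z s)) ?_ hx (mapsTo_univ _ _)
    exact hψ.comp_contDiffOn (contDiffOn_fst.prodMk (contDiffOn_snd.prodMk
      (hz.comp contDiffOn_fst fun p hp => hp.1)))
  -- the linearization along the reference solution
  let A : ℝ → Q →L[ℝ] Q := fun s => fderiv ℝ ψ (s, x s, z s) ∘L
    ContinuousLinearMap.inr ℝ ℝ (Q × Z) ∘L ContinuousLinearMap.inl ℝ Q Z
  let B : ℝ → Z →L[ℝ] Q := fun s => fderiv ℝ ψ (s, x s, z s) ∘L
    ContinuousLinearMap.inr ℝ ℝ (Q × Z) ∘L ContinuousLinearMap.inr ℝ Q Z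
  have hDc : ContinuousOn (fun s => fderiv ℝ ψ (s, x s, z s)) (Icc t₀ t₁) :=
    (hψ.continuous_fderiv (by simp)).comp_continuousOn
      (continuousOn_id.prodMk (hxs.continuousOn.prodMk hz.continuousOn))
  have hAc : ContinuousOn A (Icc t₀ t₁) := hDc.clm_comp continuousOn_const
  have hBc : ContinuousOn B (Icc t₀ t₁) := hDc.clm_comp continuousOn_const
  -- `w ∘ R` solves the adjoint equation with final value `w`
  obtain ⟨R, hR1, hR⟩ := exists_adjoint_transition ht hAc
  have hRc : ContinuousOn R (Icc t₀ t₁) := fun s hs => (hR s hs).continuousWithinAt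
  obtain ⟨ζ, hζ, hζc, hζs, hζi⟩ := exists_control_right_inverse ht (C := fun s => R s ∘L B s)
    (hRc.clm_comp hBc) fun w hw => by
      have := hnd (fun s => w ∘L R s) (fun s hs => by
        have h1 := ((ContinuousLinearMap.compL ℝ Q Q ℝ w).hasFDerivAt).comp_hasDerivWithinAt s
          (hR s hs)
        refine h1.congr_deriv ?_
        ext v
        simp [A]) (fun s hs => hw s hs)
      simpa [hR1] using this
  -- the control variation lives in `(a', b')`, strictly inside `[a, b]`, which is strictly inside
  -- `[t₀, t₁]`
  obtain ⟨a', b', hta', hab', hbt', hsub⟩ := hζc.exists_subset_Ioo ht hζs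
  obtain ⟨a, hta, haa'⟩ := exists_between hta'
  obtain ⟨b, hbb', hbt⟩ := exists_between hbt'
  have hab : a < b := by linarith
  have hζ0 : ∀ s, s ∉ Ioo a' b' → ζ s = 0 := fun s hs =>
    image_eq_zero_of_notMem_tsupport fun h => hs (hsub h)
  have hIab : Icc a b ⊆ Icc t₀ t₁ := Icc_subset_Icc hta.le hbt.le
  -- near `[a, b]` the reference control is replaced by one that is smooth on the whole line
  obtain ⟨χ, hχ, hχs, hχ1⟩ := exists_smooth_cutoff hta hab hbt
  have hz' : ContDiff ℝ ∞ fun s => χ s • z s := contDiff_smul_of_tsupport_subset hχ hχs hz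
  have hz'eq : ∀ s ∈ Icc a b, χ s • z s = z s := fun s hs => by rw [hχ1 s hs, one_smul]
  have hxab : ∀ τ ∈ Icc a b,
      HasDerivWithinAt x (ψ (τ, x τ, χ τ • z τ + ζ τ 0)) (Icc a b) τ := fun τ hτ => by
    rw [hz'eq τ hτ, map_zero, add_zero]
    exact (hx τ (hIab hτ)).mono hIab
  let x₀ : C(Icc (0 : ℝ) 1, Q) := ⟨fun r => x (a + r * (b - a)),
    hxs.continuousOn.comp_continuous (by fun_prop) fun r =>
      hIab (add_mul_sub_mem_Icc hab.le r.2)⟩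
  have hx₀ : odeResidual (Q := Q) (P := Q × ℝ) (rescaledCM hψ hz' hζ a) (x a) ((0, b), x₀) = 0 :=
    odeResidual_rescaledCM_eq_zero hψ hz' hζ hxab (right_mem_Icc.2 hab.le) fun r => rfl
  have hx₀u : ∀ τ ∈ Icc a b, unscale a b x₀ τ = x τ := fun τ hτ => by
    have hne : b - a ≠ 0 := (sub_pos.2 hab).ne'
    have h3 : a + (τ - a) / (b - a) * (b - a) = τ := by field_simp; ring
    rw [unscale_of_mem hab hτ]
    simp only [x₀, ContinuousMap.coe_mk, h3]
  obtain ⟨F, hF0, hF⟩ := exists_family_of_odeResidual_eq_zero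
    (contDiff_rescaledRHS hψ hz' hζ) hx₀
  have hcont : ContinuousAt (fun u : Q => (u, b)) 0 := by fun_prop
  obtain ⟨U, hU, hUo, h0U⟩ := eventually_nhds_iff.1 (hcont.eventually hF)
  have hFs : ContDiffOn ℝ ∞ (fun u : Q => F (u, b)) U := fun u hu =>
    ((hU u hu).1.comp u (contDiffAt_id.prodMk contDiffAt_const)).contDiffWithinAt
  -- the endpoint map has an invertible derivative
  have hev : ContDiff ℝ ∞ fun y : C(Icc (0 : ℝ) 1, Q) => unscale a b y b := by
    simp only [unscale_right hab]
    exact (ContinuousMap.evalCLM ℝ (⟨1, right_mem_Icc.2 zero_le_one⟩ : Icc (0 : ℝ) 1) :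
      C(Icc (0 : ℝ) 1, Q) →L[ℝ] Q).contDiff
  have hFd : HasFDerivAt F (fderiv ℝ F (0, b)) (0, b) :=
    (hF.self_of_nhds.1.differentiableAt (by simp)).hasFDerivAt
  let D : Q →L[ℝ] Q :=
    (ContinuousMap.evalCLM ℝ (⟨1, right_mem_Icc.2 zero_le_one⟩ : Icc (0 : ℝ) 1) :
      C(Icc (0 : ℝ) 1, Q) →L[ℝ] Q) ∘L fderiv ℝ F (0, b) ∘L ContinuousLinearMap.inl ℝ Q ℝ
  have hD : HasFDerivAt (fun u : Q => unscale a b (F (u, b)) b) D 0 := by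
    simp only [unscale_right hab]
    have h1 : HasFDerivAt (fun u : Q => (u, b)) (ContinuousLinearMap.inl ℝ Q ℝ) 0 :=
      hasFDerivAt_prodMk_left 0 b
    exact (ContinuousMap.evalCLM ℝ (⟨1, right_mem_Icc.2 zero_le_one⟩ : Icc (0 : ℝ) 1) :
      C(Icc (0 : ℝ) 1, Q) →L[ℝ] Q).hasFDerivAt.comp (0 : Q) (hFd.comp (0 : Q) h1)
  -- variation of constants: `R τ (V τ)` is a primitive of `R τ (B τ (ζ τ v))`, which has
  -- integral `v`
  have hRD : ∀ v, R b (D v) = v := fun v => by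
    obtain ⟨hV0, hV⟩ := hasDerivWithinAt_unscale_variation hψ hz' hζ hab hFd
      (hF.mono fun _ h => h.2) v
    set V := unscale a b (fderiv ℝ F (0, b) (v, 0)) with hVdef
    have hder : ∀ τ ∈ Icc a b, HasDerivWithinAt (fun τ => R τ (V τ)) ((R τ ∘L B τ) (ζ τ v))
        (Icc a b) τ := by
      intro τ hτ
      have h1 := ((hR τ (hIab hτ)).mono hIab).clm_apply (hV τ hτ)
      refine h1.congr_deriv ?_
      rw [hF0, hx₀u τ hτ, hz'eq τ hτ]
      have h2 : ((0 : ℝ), V τ, ζ τ v) = ((0 : ℝ), V τ, (0 : Z)) + ((0 : ℝ), (0 : Q), ζ τ v) := by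
        simp
      rw [h2, map_add, map_add]
      simp [A, B]
    have hc : ContinuousOn (fun τ => (R τ ∘L B τ) (ζ τ v)) (Icc a b) :=
      ((hRc.clm_comp hBc).mono hIab).clm_apply
        ((hζ.continuous.clm_apply continuous_const).continuousOn)
    have h3 := integral_eq_sub_of_hasDerivWithinAt_Icc hab.le hder hc
    have hsupp : Function.support (fun τ => (R τ ∘L B τ) (ζ τ v)) ⊆ Ioo a' b' := fun τ hτ => by
      by_contra hτ'
      exact hτ (by simp [hζ0 τ hτ'])
    have h4 := hζi v
    rw [intervalIntegral.integral_eq_integral_of_support_subset (hsupp.trans fun τ hτ =>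
      ⟨by linarith [hτ.1], by linarith [hτ.2]⟩)] at h4
    rw [intervalIntegral.integral_eq_integral_of_support_subset (hsupp.trans fun τ hτ =>
      ⟨by linarith [hτ.1], by linarith [hτ.2]⟩), h4, hV0, map_zero, sub_zero] at h3
    have h5 : V b = D v := by
      rw [hVdef, unscale_right hab]
      rfl
    rw [← h5]
    exact h3.symm
  have hDinj : Function.Injective D := fun v w hvw => by
    rw [← hRD v, ← hRD w, hvw]
  let De : Q ≃L[ℝ] Q :=
    (LinearEquiv.ofInjectiveEndo (D : Q →ₗ[ℝ] Q) hDinj).toContinuousLinearEquiv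
  have hDe : (De : Q →L[ℝ] Q) = D := by
    ext v
    rfl
  obtain ⟨φ, h0φ, hφU, hφ, hφs⟩ := exists_openPartialHomeomorph_of_hasFDerivAt hUo
    (hev.comp_contDiffOn hFs) h0U De (by rw [hDe]; exact hD)
  have hφ0 : φ 0 = x b := by
    rw [hφ]
    change unscale a b (F (0, b)) b = x b
    rw [hF0, hx₀u b (right_mem_Icc.2 hab.le)]
  -- the parameter `u ξ` is chosen so that the solution arrives at `x b + ξ e`
  have hline : Continuous fun ξ : ℝ => x b + ξ • e := by fun_prop
  have hnhds : (fun ξ : ℝ => x b + ξ • e) ⁻¹' φ.target ∈ 𝓝 (0 : ℝ) := by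
    refine (φ.open_target.preimage hline).mem_nhds ?_
    change x b + (0 : ℝ) • e ∈ φ.target
    rw [zero_smul, add_zero, ← hφ0]
    exact φ.map_source h0φ
  obtain ⟨ε, hε, hball⟩ := Metric.mem_nhds_iff.1 hnhds
  have hIoo : Metric.ball (0 : ℝ) ε = Ioo (-ε) ε := by rw [Real.ball_eq_Ioo]; simp
  rw [hIoo] at hball
  let u : ℝ → Q := fun ξ => φ.symm (x b + ξ • e)
  have hu : ContDiffOn ℝ ∞ u (Ioo (-ε) ε) :=
    hφs.comp (contDiff_const.add (contDiff_id.smul contDiff_const)).contDiffOn hball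
  have hu0 : u 0 = 0 := by
    change φ.symm (x b + (0 : ℝ) • e) = 0
    rw [zero_smul, add_zero, ← hφ0, φ.left_inv h0φ]
  have huU : ∀ ξ ∈ Ioo (-ε) ε, u ξ ∈ U := fun ξ hξ => hφU (φ.map_target (hball hξ))
  have huE : ∀ ξ ∈ Ioo (-ε) ε, unscale a b (F (u ξ, b)) b = x b + ξ • e := fun ξ hξ => by
    have h1 := φ.right_inv (hball hξ)
    rw [hφ] at h1
    exact h1
  let sol : ℝ → ℝ → Q := fun ξ => unscale a b (F (u ξ, b))
  have hsol : ∀ ξ ∈ Ioo (-ε) ε, sol ξ a = x a ∧ ∀ τ ∈ Icc a b, HasDerivWithinAt (sol ξ)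
      (ψ (τ, sol ξ τ, z τ + ζ τ (u ξ))) (Icc a b) τ := fun ξ hξ => by
    obtain ⟨h1, h2⟩ := unscale_solution hψ hz' hζ hab (hU _ (huU ξ hξ)).2
    refine ⟨h1, fun τ hτ => ?_⟩
    have h3 := h2 τ hτ
    simp only [hz'eq τ hτ] at h3
    exact h3
  have hsolc : ∀ ξ ∈ Ioo (-ε) ε, ContinuousOn (sol ξ) (Icc a b) := fun ξ hξ τ hτ =>
    ((hsol ξ hξ).2 τ hτ).continuousWithinAt
  -- outside the support of the control variation, solutions agree by uniqueness
  have hleft : ∀ ξ ∈ Ioo (-ε) ε, ∀ τ ∈ Icc a a', sol ξ τ = x τ := fun ξ hξ => by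
    have hs : Icc a a' ⊆ Icc a b := Icc_subset_Icc_right (by linarith)
    refine ODE_solution_unique (v := fun t y => ψ (t, y, z t)) (fun t => hK t (z t))
      ((hsolc ξ hξ).mono hs) (fun t ht' => ?_) (hxs.continuousOn.mono (hs.trans hIab))
      (fun t ht' => ?_) (hsol ξ hξ).1
    · have h1 := (hsol ξ hξ).2 t (hs (Ico_subset_Icc_self ht'))
      rw [hζ0 t (fun h => absurd ht'.2 (not_lt.2 h.1.le)),
        zero_apply, add_zero] at h1
      exact h1.mono_of_mem_nhdsWithin
        (Icc_mem_nhdsGE_of_mem ⟨ht'.1, ht'.2.trans (by linarith)⟩)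
    · exact (hx t (hIab (hs (Ico_subset_Icc_self ht')))).mono_of_mem_nhdsWithin
        (Icc_mem_nhdsGE_of_mem ⟨hta.le.trans ht'.1, ht'.2.trans (by linarith)⟩)
  have hright : ∀ ξ ∈ Ioo (-ε) ε, ∀ τ ∈ Icc b' b, sol ξ τ = x τ + ξ • e := fun ξ hξ => by
    have hs : Icc b' b ⊆ Icc a b := Icc_subset_Icc_left (by linarith)
    refine ODE_solution_unique_of_mem_Icc_left (s := fun _ => univ)
      (v := fun t y => ψ (t, y, z t)) (fun t _ => (hK t (z t)).lipschitzOnWith)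
      ((hsolc ξ hξ).mono hs) (fun t ht' => ?_) (fun _ _ => mem_univ _)
      ((hxs.continuousOn.mono (hs.trans hIab)).add continuousOn_const)
      (fun t ht' => ?_) (fun _ _ => mem_univ _) (huE ξ hξ)
    · have h1 := (hsol ξ hξ).2 t (hs (Ioc_subset_Icc_self ht'))
      rw [hζ0 t (fun h => absurd ht'.1 (not_lt.2 h.2.le)), zero_apply, add_zero] at h1
      exact h1.mono_of_mem_nhdsWithin
        (Icc_mem_nhdsLE_of_mem ⟨lt_trans (by linarith) ht'.1, ht'.2⟩)
    · rw [he]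
      exact ((hx t (hIab (hs (Ioc_subset_Icc_self ht')))).add_const _).mono_of_mem_nhdsWithin
        (Icc_mem_nhdsLE_of_mem ⟨lt_trans (by linarith) ht'.1, ht'.2.trans hbt.le⟩)
  -- past the control variation, the translate of the reference solution along `e` is a solution
  let X : ℝ → ℝ → Q := fun ξ s => if s ≤ a then x s else if s < b then sol ξ s else x s + ξ • e
  have hX1 : ∀ ξ ∈ Ioo (-ε) ε, ∀ s, s ≤ a' → X ξ s = x s := fun ξ hξ s hs => by
    by_cases h : s ≤ a
    · simp only [X, if_pos h]
    · simp only [X, if_neg h, if_pos (show s < b by linarith)]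
      exact hleft ξ hξ s ⟨(not_le.1 h).le, hs⟩
  have hX2 : ∀ ξ ∈ Ioo (-ε) ε, ∀ s ∈ Ioo a b, X ξ s = sol ξ s := fun ξ hξ s hs => by
    simp only [X, if_neg (not_le.2 hs.1), if_pos hs.2]
  have hX3 : ∀ ξ ∈ Ioo (-ε) ε, ∀ s, b' ≤ s → X ξ s = x s + ξ • e := fun ξ hξ s hs => by
    by_cases h : s < b
    · simp only [X, if_neg (show ¬ s ≤ a by linarith), if_pos h]
      exact hright ξ hξ s ⟨hs, h.le⟩
    · simp only [X, if_neg (show ¬ s ≤ a by linarith), if_neg h]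
  have hcover : ∀ s, s < a' ∨ s ∈ Ioo a b ∨ b' < s := fun s => by
    rcases lt_or_ge s a' with h | h
    · exact Or.inl h
    · rcases lt_or_ge b' s with h' | h'
      · exact Or.inr (Or.inr h')
      · exact Or.inr (Or.inl ⟨by linarith, by linarith⟩)
  have h0ε : (0 : ℝ) ∈ Ioo (-ε) ε := ⟨by linarith, hε⟩
  refine ⟨ε, hε, X, fun ξ s => z s + ζ s (u ξ), ?_, ?_, fun s hs => ⟨?_, ?_⟩, fun ξ hξ =>
    ⟨hX1 ξ hξ t₀ (by linarith), hX3 ξ hξ t₁ (by linarith), fun s hs => ?_⟩⟩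
  · refine contDiffOn_of_locally_contDiffOn fun p hp => ?_
    rcases hcover p.2 with h | h | h
    · refine ⟨{p | p.2 < a'}, isOpen_lt continuous_snd continuous_const, h, ?_⟩
      exact (hxs.comp contDiffOn_snd fun p hp => hp.1.2).congr fun p hp =>
        hX1 p.1 hp.1.1 p.2 (le_of_lt hp.2)
    · refine ⟨{p | p.2 ∈ Ioo a b}, isOpen_Ioo.preimage continuous_snd, h, ?_⟩
      refine ((contDiffOn_unscale hψ hz' hζ hab hFs.continuousOn fun v hv => (hU v hv).2).comp
        (f := fun p : ℝ × ℝ => (u p.1, p.2)) ((hu.comp contDiffOn_fst fun p hp => hp.1.1).prodMk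
          contDiffOn_snd) fun p hp => ⟨huU _ hp.1.1, Ioo_subset_Icc_self hp.2⟩).congr fun p hp => ?_
      exact hX2 p.1 hp.1.1 p.2 hp.2
    · refine ⟨{p | b' < p.2}, isOpen_lt continuous_const continuous_snd, h, ?_⟩
      exact ((hxs.comp contDiffOn_snd fun p hp => hp.1.2).add
        (contDiffOn_fst.smul contDiffOn_const)).congr fun p hp =>
          hX3 p.1 hp.1.1 p.2 (le_of_lt hp.2)
  · exact (hz.comp contDiffOn_snd fun p hp => hp.2).add
      ((hζ.comp_contDiffOn contDiffOn_snd).clm_apply (hu.comp contDiffOn_fst fun p hp => hp.1))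
  · rcases hcover s with h | h | h
    · exact hX1 0 h0ε s h.le
    · rw [hX2 0 h0ε s h]
      simp only [sol, hu0, hF0]
      exact hx₀u s (Ioo_subset_Icc_self h)
    · rw [hX3 0 h0ε s h.le, zero_smul, add_zero]
  · change z s + ζ s (u 0) = z s
    rw [hu0, map_zero, add_zero]
  · rcases hcover s with h | h | h
    · change HasDerivWithinAt (X ξ) (ψ (s, X ξ s, z s + ζ s (u ξ))) (Icc t₀ t₁) s
      rw [hX1 ξ hξ s h.le, hζ0 s (fun h' => absurd h (not_lt.2 h'.1.le)), zero_apply,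
        add_zero]
      refine (hx s hs).congr_of_eventuallyEq ?_ (hX1 ξ hξ s h.le)
      filter_upwards [mem_nhdsWithin_of_mem_nhds (Iio_mem_nhds h)] with τ hτ
      exact hX1 ξ hξ τ (le_of_lt hτ)
    · change HasDerivWithinAt (X ξ) (ψ (s, X ξ s, z s + ζ s (u ξ))) (Icc t₀ t₁) s
      rw [hX2 ξ hξ s h]
      have h1 := ((hsol ξ hξ).2 s (Ioo_subset_Icc_self h)).hasDerivAt (Icc_mem_nhds h.1 h.2)
      refine h1.hasDerivWithinAt.congr_of_eventuallyEq ?_ (hX2 ξ hξ s h)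
      filter_upwards [mem_nhdsWithin_of_mem_nhds (Ioo_mem_nhds h.1 h.2)] with τ hτ
      exact hX2 ξ hξ τ hτ
    · change HasDerivWithinAt (X ξ) (ψ (s, X ξ s, z s + ζ s (u ξ))) (Icc t₀ t₁) s
      rw [hX3 ξ hξ s h.le, hζ0 s (fun h' => absurd h (not_lt.2 h'.2.le)), zero_apply,
        add_zero, he]
      refine ((hx s hs).add_const (ξ • e)).congr_of_eventuallyEq ?_ (hX3 ξ hξ s h.le)
      filter_upwards [mem_nhdsWithin_of_mem_nhds (Ioi_mem_nhds h)] with τ hτ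
      exact hX3 ξ hξ τ (le_of_lt hτ)

end Endpoint

/-! ### Functions on a manifold that are coordinates along a curve -/

section VecDeriv

variable {F : Type*} [NormedAddCommGroup F] [NormedSpace ℝ F]
  {M : Type*} [TopologicalSpace M] [ChartedSpace F M] [IsManifold 𝓘(ℝ, F) ∞ M]
  {B C : Type*} [NormedAddCommGroup B] [NormedSpace ℝ B] [NormedAddCommGroup C] [NormedSpace ℝ C]

variable (F) in
/-- The derivative of a vector-valued function on a manifold, with the tangent spaces unfolded to
the model spaces. -/
def vecDeriv (f : M → B) (x : M) : F →L[ℝ] B := mfderiv 𝓘(ℝ, F) 𝓘(ℝ, B) f x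

theorem ContMDiff.hasMFDerivAt_vecDeriv {f : M → B} (hf : ContMDiff 𝓘(ℝ, F) 𝓘(ℝ, B) ∞ f) (x : M) :
    HasMFDerivAt 𝓘(ℝ, F) 𝓘(ℝ, B) f x (vecDeriv F (B := B) f x) :=
  (hf.mdifferentiableAt (by simp)).hasMFDerivAt

theorem vecDeriv_comp {f : M → B} (hf : ContMDiff 𝓘(ℝ, F) 𝓘(ℝ, B) ∞ f) {h : B → C}
    (hh : ContDiff ℝ ∞ h) (x : M) :
    vecDeriv F (fun y => h (f y)) x = fderiv ℝ h (f x) ∘L vecDeriv F f x :=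
  ((hh.differentiable (by simp) (f x)).hasFDerivAt.hasMFDerivAt.comp x
    (hf.hasMFDerivAt_vecDeriv x)).mfderiv

theorem vecDeriv_prodMk {f : M → B} (hf : ContMDiff 𝓘(ℝ, F) 𝓘(ℝ, B) ∞ f) {g : M → C}
    (hg : ContMDiff 𝓘(ℝ, F) 𝓘(ℝ, C) ∞ g) (x : M) :
    vecDeriv F (fun y => (f y, g y)) x = (vecDeriv F f x).prod (vecDeriv F g x) := by
  have h1 := vecDeriv_comp (hf.prodMk_space hg) (contDiff_fst (𝕜 := ℝ) (n := ∞)) x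
  have h2 := vecDeriv_comp (hf.prodMk_space hg) (contDiff_snd (𝕜 := ℝ) (n := ∞)) x
  rw [fderiv_fst] at h1
  rw [fderiv_snd] at h2
  ext v
  · exact (DFunLike.congr_fun h1 v).symm
  · exact (DFunLike.congr_fun h2 v).symm

theorem contDiffOn_comp_chartAt_symm {f : M → B} (hf : ContMDiff 𝓘(ℝ, F) 𝓘(ℝ, B) ∞ f) (x₀ : M) :
    ContDiffOn ℝ ∞ (f ∘ (chartAt F x₀).symm) (chartAt F x₀).target := by
  rw [← contMDiffOn_iff_contDiffOn]
  exact hf.comp_contMDiffOn (contMDiffOn_chart_symm (I := 𝓘(ℝ, F)))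

theorem vecDeriv_eq_fderiv_comp {f : M → B} (hf : ContMDiff 𝓘(ℝ, F) 𝓘(ℝ, B) ∞ f) (x₀ : M) {x : M}
    (hx : x ∈ (chartAt F x₀).source) :
    vecDeriv F f x = fderiv ℝ (f ∘ (chartAt F x₀).symm) (chartAt F x₀ x) ∘L
      vecDeriv F (chartAt F x₀) x := by
  have h1 : HasFDerivAt (f ∘ (chartAt F x₀).symm)
      (fderiv ℝ (f ∘ (chartAt F x₀).symm) (chartAt F x₀ x)) (chartAt F x₀ x) :=
    (((contDiffOn_comp_chartAt_symm hf x₀).contDiffAt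
      ((chartAt F x₀).open_target.mem_nhds ((chartAt F x₀).map_source hx))).differentiableAt
        (by simp)).hasFDerivAt
  have h2 : HasMFDerivAt 𝓘(ℝ, F) 𝓘(ℝ, F) (chartAt F x₀) x (vecDeriv F (B := F) (chartAt F x₀) x) :=
    (((contMDiffOn_chart (I := 𝓘(ℝ, F)) (n := ∞)).contMDiffAt
      ((chartAt F x₀).open_source.mem_nhds hx)).mdifferentiableAt (by simp)).hasMFDerivAt
  refine ((h1.hasMFDerivAt.comp x h2).congr_of_eventuallyEq ?_).mfderiv
  filter_upwards [(chartAt F x₀).open_source.mem_nhds hx] with y hy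
  simp [(chartAt F x₀).left_inv hy]

theorem bijective_vecDeriv_chartAt (x₀ : M) {x : M} (hx : x ∈ (chartAt F x₀).source) :
    Function.Bijective (vecDeriv F (B := F) (chartAt F x₀) x) :=
  (mdifferentiable_chart (I := 𝓘(ℝ, F)) x₀).mfderiv_bijective hx

theorem continuousAt_fderiv_comp_chartAt {f : M → B} (hf : ContMDiff 𝓘(ℝ, F) 𝓘(ℝ, B) ∞ f)
    (x₀ : M) :
    ContinuousAt (fun y => fderiv ℝ (f ∘ (chartAt F x₀).symm) (chartAt F x₀ y)) x₀ := by
  have hx₀ : x₀ ∈ (chartAt F x₀).source := mem_chart_source F x₀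
  have h1 : ContinuousAt (fderiv ℝ (f ∘ (chartAt F x₀).symm)) (chartAt F x₀ x₀) :=
    ((contDiffOn_comp_chartAt_symm hf x₀).continuousOn_fderiv_of_isOpen (chartAt F x₀).open_target
      (by simp)).continuousAt ((chartAt F x₀).open_target.mem_nhds ((chartAt F x₀).map_source hx₀))
  exact ContinuousAt.comp (f := chartAt F x₀) h1 ((chartAt F x₀).continuousAt hx₀)

variable [FiniteDimensional ℝ F]

/-- Injectivity of a segment of derivatives on the kernel of another derivative is an open
condition. -/
theorem eventually_forall_segment_injective {Q : Type*} [NormedAddCommGroup Q] [NormedSpace ℝ Q]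
    {f : M → B} {q q' : M → Q} (hf : ContMDiff 𝓘(ℝ, F) 𝓘(ℝ, B) ∞ f)
    (hq : ContMDiff 𝓘(ℝ, F) 𝓘(ℝ, Q) ∞ q) (hq' : ContMDiff 𝓘(ℝ, F) 𝓘(ℝ, Q) ∞ q') {x₀ : M}
    (h : ∀ θ ∈ Icc (0 : ℝ) 1, ∀ v, vecDeriv F f x₀ v = 0 →
      vecDeriv F q x₀ v + θ • (vecDeriv F q' x₀ v - vecDeriv F q x₀ v) = 0 → v = 0) :
    ∀ᶠ x in 𝓝 x₀, ∀ θ ∈ Icc (0 : ℝ) 1, ∀ v, vecDeriv F f x v = 0 →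
      vecDeriv F q x v + θ • (vecDeriv F q' x v - vecDeriv F q x v) = 0 → v = 0 := by
  refine isCompact_Icc.eventually_forall_of_forall_eventually fun θ₀ hθ₀ => ?_
  let φ := chartAt F x₀
  have hx₀ : x₀ ∈ φ.source := mem_chart_source F x₀
  let T : M × ℝ → F →L[ℝ] B × Q := fun y =>
    (fderiv ℝ (f ∘ φ.symm) (φ y.1)).prod (fderiv ℝ (q ∘ φ.symm) (φ y.1) +
      y.2 • (fderiv ℝ (q' ∘ φ.symm) (φ y.1) - fderiv ℝ (q ∘ φ.symm) (φ y.1)))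
  have key : ∀ x ∈ φ.source, ∀ θ : ℝ, Function.Injective (T (x, θ)) ↔
      ∀ v, vecDeriv F f x v = 0 →
        vecDeriv F q x v + θ • (vecDeriv F q' x v - vecDeriv F q x v) = 0 → v = 0 := by
    intro x hx θ
    rw [vecDeriv_eq_fderiv_comp hf x₀ hx, vecDeriv_eq_fderiv_comp hq x₀ hx,
      vecDeriv_eq_fderiv_comp hq' x₀ hx, injective_iff_map_eq_zero]
    have hb := bijective_vecDeriv_chartAt (F := F) x₀ hx
    constructor
    · intro hT v h1 h2
      refine (injective_iff_map_eq_zero _).1 hb.1 v (hT _ ?_)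
      exact Prod.ext h1 h2
    · intro hT w hw
      obtain ⟨v, rfl⟩ := hb.2 w
      rw [hT v (congrArg Prod.fst hw) (congrArg Prod.snd hw), map_zero]
  have hc : ∀ {g : M → Q}, ContMDiff 𝓘(ℝ, F) 𝓘(ℝ, Q) ∞ g →
      ContinuousAt (fun y : M × ℝ => fderiv ℝ (g ∘ φ.symm) (φ y.1)) (x₀, θ₀) := fun {g} hg =>
    ContinuousAt.comp (f := Prod.fst) (x := (x₀, θ₀)) (continuousAt_fderiv_comp_chartAt hg x₀)
      continuousAt_fst
  have hcf : ContinuousAt (fun y : M × ℝ => fderiv ℝ (f ∘ φ.symm) (φ y.1)) (x₀, θ₀) :=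
    ContinuousAt.comp (f := Prod.fst) (x := (x₀, θ₀)) (continuousAt_fderiv_comp_chartAt hf x₀)
      continuousAt_fst
  have hT : ContinuousAt T (x₀, θ₀) :=
    ((ContinuousLinearMap.prodₗᵢ (R := ℝ) (𝕜 := ℝ) (E := F) (F := B) (G := Q)).continuous.tendsto
      _).comp (hcf.prodMk ((hc hq).add (continuousAt_snd.smul ((hc hq').sub (hc hq)))))
  have h4 : ∀ᶠ y in 𝓝 (x₀, θ₀), Function.Injective (T y) :=
    hT.eventually (ContinuousLinearMap.isOpen_injective.mem_nhds
      ((key x₀ hx₀ θ₀).2 (h θ₀ hθ₀)))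
  filter_upwards [h4, continuousAt_fst.eventually (φ.open_source.mem_nhds hx₀)] with y hy1 hy2
  exact (key y.1 hy2 y.2).1 hy1

variable [T2Space M]

/-- A submersion can be complemented, at any given point, by globally defined functions. -/
theorem exists_complement_at {f : M → B} [FiniteDimensional ℝ B] {x₀ : M}
    (hs : Function.Surjective (vecDeriv F f x₀)) {n : ℕ}
    (hn : Module.finrank ℝ F = Module.finrank ℝ B + n) :
    ∃ q : M → Fin n → ℝ, ContMDiff 𝓘(ℝ, F) 𝓘(ℝ, Fin n → ℝ) ∞ q ∧
      ∀ v, vecDeriv F f x₀ v = 0 → vecDeriv F q x₀ v = 0 → v = 0 := by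
  let T : F →ₗ[ℝ] B := vecDeriv F f x₀
  have hker : Module.finrank ℝ (LinearMap.ker T) = n := by
    have h1 := T.finrank_range_add_finrank_ker
    rw [LinearMap.range_eq_top.2 hs, finrank_top] at h1
    omega
  let κ : LinearMap.ker T ≃ₗ[ℝ] (Fin n → ℝ) :=
    LinearEquiv.ofFinrankEq _ _ (by rw [hker, Module.finrank_fin_fun])
  let D : F →ₗ[ℝ] F := vecDeriv F (chartAt F x₀) x₀
  have hD := bijective_vecDeriv_chartAt (F := F) x₀ (mem_chart_source F x₀)
  obtain ⟨g, hg⟩ := LinearMap.exists_leftInverse_of_injective (D ∘ₗ (LinearMap.ker T).subtype)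
    (LinearMap.ker_eq_bot.2 (hD.1.comp Subtype.val_injective))
  let lam : F →L[ℝ] (Fin n → ℝ) := LinearMap.toContinuousLinearMap (κ.toLinearMap ∘ₗ g)
  let β : SmoothBumpFunction 𝓘(ℝ, F) x₀ := Classical.choice inferInstance
  have hsm : ContMDiffOn 𝓘(ℝ, F) 𝓘(ℝ, Fin n → ℝ) ∞ (fun x => lam (chartAt F x₀ x))
      (chartAt F x₀).source :=
    lam.contMDiff.comp_contMDiffOn (contMDiffOn_chart (I := 𝓘(ℝ, F)) (n := ∞))
  refine ⟨fun x => β x • lam (chartAt F x₀ x), β.contMDiff_smul hsm, fun v h1 h2 => ?_⟩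
  have h3 : HasMFDerivAt 𝓘(ℝ, F) 𝓘(ℝ, Fin n → ℝ) (fun x => lam (chartAt F x₀ x)) x₀
      (lam ∘L vecDeriv F (chartAt F x₀) x₀) := by
    have h2 : HasMFDerivAt 𝓘(ℝ, F) 𝓘(ℝ, F) (chartAt F x₀) x₀
        (vecDeriv F (B := F) (chartAt F x₀) x₀) :=
      (((contMDiffOn_chart (I := 𝓘(ℝ, F)) (n := ∞)).contMDiffAt
        ((chartAt F x₀).open_source.mem_nhds (mem_chart_source F x₀))).mdifferentiableAt
          (by simp)).hasMFDerivAt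
    exact lam.hasFDerivAt.hasMFDerivAt.comp x₀ h2
  have h4 : vecDeriv F (fun x => β x • lam (chartAt F x₀ x)) x₀ =
      lam ∘L vecDeriv F (chartAt F x₀) x₀ := by
    refine (h3.congr_of_eventuallyEq ?_).mfderiv
    filter_upwards [β.eventuallyEq_one] with x hx
    simp [hx]
  rw [h4] at h2
  have h5 : κ (g (D v)) = 0 := h2
  have h6 : g (D v) = ⟨v, h1⟩ := LinearMap.congr_fun hg (⟨v, h1⟩ : LinearMap.ker T)
  rw [LinearEquiv.map_eq_zero_iff, h6] at h5
  exact congrArg Subtype.val h5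

/-- Gluing two functions by a cutoff `χ ∘ f` creates no extra term in the derivative on the kernel
of the derivative of `f`. -/
theorem vecDeriv_glue {Q : Type*} [NormedAddCommGroup Q] [NormedSpace ℝ Q] {f : M → B}
    {q q' : M → Q} (hf : ContMDiff 𝓘(ℝ, F) 𝓘(ℝ, B) ∞ f) (hq : ContMDiff 𝓘(ℝ, F) 𝓘(ℝ, Q) ∞ q)
    (hq' : ContMDiff 𝓘(ℝ, F) 𝓘(ℝ, Q) ∞ q') {χ : B → ℝ} (hχ : ContDiff ℝ ∞ χ) {x : M} {v : F}
    (hv : vecDeriv F f x v = 0) :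
    vecDeriv F (fun y => q y + χ (f y) • (q' y - q y)) x v =
      vecDeriv F q x v + χ (f x) • (vecDeriv F q' x v - vecDeriv F q x v) := by
  let h : B × Q × Q → Q := fun y => y.2.1 + χ y.1 • (y.2.2 - y.2.1)
  have hh : ContDiff ℝ ∞ h := contDiff_snd.fst.add
    ((hχ.comp contDiff_fst).smul (contDiff_snd.snd.sub contDiff_snd.fst))
  have h1 := vecDeriv_comp (hf.prodMk_space (hq.prodMk_space hq')) hh x
  rw [vecDeriv_prodMk hf (hq.prodMk_space hq'), vecDeriv_prodMk hq hq'] at h1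
  refine (DFunLike.congr_fun h1 v).trans ?_
  set u := vecDeriv F q x v
  set w := vecDeriv F q' x v
  change fderiv ℝ h (f x, q x, q' x) (vecDeriv F f x v, u, w) = _
  rw [hv]
  have h2 : HasDerivAt (fun τ : ℝ => ((f x, q x + τ • u, q' x + τ • w) : B × Q × Q)) (0, u, w) 0 :=
    (hasDerivAt_const _ _).prodMk (HasDerivAt.prodMk
      (by simpa using ((hasDerivAt_id (0 : ℝ)).smul_const u).const_add (q x))
      (by simpa using ((hasDerivAt_id (0 : ℝ)).smul_const w).const_add (q' x)))
  have h3 : HasFDerivAt h (fderiv ℝ h (f x, q x, q' x))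
      ((f x, q x + (0 : ℝ) • u, q' x + (0 : ℝ) • w) : B × Q × Q) := by
    rw [zero_smul, zero_smul, add_zero, add_zero]
    exact (hh.differentiable (by simp) _).hasFDerivAt
  have h4 : HasDerivAt (fun τ : ℝ => (q x + τ • u) +
      χ (f x) • ((q' x + τ • w) - (q x + τ • u))) (u + χ (f x) • (w - u)) 0 := by
    have hu : HasDerivAt (fun τ : ℝ => q x + τ • u) u 0 := by
      simpa using ((hasDerivAt_id (0 : ℝ)).smul_const u).const_add (q x)
    have hw : HasDerivAt (fun τ : ℝ => q' x + τ • w) w 0 := by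
      simpa using ((hasDerivAt_id (0 : ℝ)).smul_const w).const_add (q' x)
    exact hu.add ((hw.sub hu).const_smul (χ (f x)))
  have h5 := HasFDerivAt.comp_hasDerivAt (l := h) (0 : ℝ) h3 h2
  exact h5.unique h4

/-- If one complement of a submersion `f` works along `c` up to time `σ` and another from `σ` to
`σ'`, some complement works on both intervals. A linear change of the second one makes it agree with
the first to first order at `c σ`, in the directions of the kernel; then all convex combinations are
complements near `c σ`, which leaves room for a cutoff. -/
theorem exists_complement_extend [FiniteDimensional ℝ B] {f : M → B}
    (hf : ContMDiff 𝓘(ℝ, F) 𝓘(ℝ, B) ∞ f) {c : ℝ → M} {t₀ t₁ : ℝ}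
    (hc : ContinuousOn c (Icc t₀ t₁)) {l : B →L[ℝ] ℝ} (hl : ∀ s ∈ Icc t₀ t₁, l (f (c s)) = s)
    {n : ℕ} (hn : Module.finrank ℝ F = Module.finrank ℝ B + n) {σ σ' : ℝ}
    (hσ : σ ∈ Icc t₀ t₁) (hσ' : σ' ∈ Icc t₀ t₁) (hσσ' : σ ≤ σ')
    (hs : Function.Surjective (vecDeriv F f (c σ))) {q q' : M → Fin n → ℝ}
    (hq : ContMDiff 𝓘(ℝ, F) 𝓘(ℝ, Fin n → ℝ) ∞ q) (hq' : ContMDiff 𝓘(ℝ, F) 𝓘(ℝ, Fin n → ℝ) ∞ q')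
    (h : ∀ s ∈ Icc t₀ σ, ∀ v, vecDeriv F f (c s) v = 0 → vecDeriv F q (c s) v = 0 → v = 0)
    (h' : ∀ s ∈ Icc σ σ', ∀ v, vecDeriv F f (c s) v = 0 → vecDeriv F q' (c s) v = 0 → v = 0) :
    ∃ r : M → Fin n → ℝ, ContMDiff 𝓘(ℝ, F) 𝓘(ℝ, Fin n → ℝ) ∞ r ∧
      ∀ s ∈ Icc t₀ σ', ∀ v, vecDeriv F f (c s) v = 0 → vecDeriv F r (c s) v = 0 → v = 0 := by
  -- a linear change of `q'` makes it agree with `q` to first order on the kernel at `c σ`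
  let T : F →ₗ[ℝ] B := vecDeriv F f (c σ)
  have hker : Module.finrank ℝ (LinearMap.ker T) = Module.finrank ℝ (Fin n → ℝ) := by
    have h1 := T.finrank_range_add_finrank_ker
    rw [LinearMap.range_eq_top.2 hs, finrank_top] at h1
    rw [Module.finrank_fin_fun]
    omega
  let κ : LinearMap.ker T →ₗ[ℝ] (Fin n → ℝ) :=
    (vecDeriv F q (c σ) : F →ₗ[ℝ] (Fin n → ℝ)) ∘ₗ (LinearMap.ker T).subtype
  let κ' : LinearMap.ker T →ₗ[ℝ] (Fin n → ℝ) :=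
    (vecDeriv F q' (c σ) : F →ₗ[ℝ] (Fin n → ℝ)) ∘ₗ (LinearMap.ker T).subtype
  have hκ : Function.Injective κ := (injective_iff_map_eq_zero _).2 fun v hv =>
    Subtype.ext (h σ (right_mem_Icc.2 hσ.1) v v.2 hv)
  have hκ' : Function.Injective κ' := (injective_iff_map_eq_zero _).2 fun v hv =>
    Subtype.ext (h' σ (left_mem_Icc.2 hσσ') v v.2 hv)
  let C : (Fin n → ℝ) ≃L[ℝ] (Fin n → ℝ) :=
    ((κ'.linearEquivOfInjective hκ' hker).symm.trans
      (κ.linearEquivOfInjective hκ hker)).toContinuousLinearEquiv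
  have hC : ∀ v, vecDeriv F f (c σ) v = 0 → C (vecDeriv F q' (c σ) v) = vecDeriv F q (c σ) v := by
    intro v hv
    have h1 : vecDeriv F q' (c σ) v = κ'.linearEquivOfInjective hκ' hker ⟨v, hv⟩ := rfl
    change κ.linearEquivOfInjective hκ hker
      ((κ'.linearEquivOfInjective hκ' hker).symm (vecDeriv F q' (c σ) v)) = _
    rw [h1, LinearEquiv.symm_apply_apply]
    rfl
  have hCs : ContMDiff 𝓘(ℝ, F) 𝓘(ℝ, Fin n → ℝ) ∞ fun x => C (q' x) := C.contDiff.contMDiff.comp hq'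
  have hCd : ∀ x v, vecDeriv F (fun x => C (q' x)) x v = C (vecDeriv F q' x v) := fun x v => by
    rw [vecDeriv_comp hq' C.contDiff, ContinuousLinearEquiv.fderiv]
    rfl
  have hev := eventually_forall_segment_injective hf hq hCs (x₀ := c σ) fun θ _ v h1 h2 => by
    rw [hCd, hC v h1, sub_self, smul_zero, add_zero] at h2
    exact h σ (right_mem_Icc.2 hσ.1) v h1 h2
  obtain ⟨δ, hδ, hball⟩ := Metric.mem_nhdsWithin_iff.1 ((hc σ hσ).eventually hev)
  -- along `c`, where `l ∘ f` is the time, the cutoff passes from `0` to `1` on `[σ, σ + δ]`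
  let χ : B → ℝ := fun b => Real.smoothTransition ((l b - σ) / δ)
  have hχ : ContDiff ℝ ∞ χ :=
    Real.smoothTransition.contDiff.comp ((l.contDiff.sub contDiff_const).div_const δ)
  refine ⟨fun y => q y + χ (f y) • (C (q' y) - q y), hq.add
    ((hχ.contMDiff.comp hf).smul (hCs.sub hq)), fun s hs' v h1 h2 => ?_⟩
  rw [vecDeriv_glue hf hq hCs hχ h1, hCd] at h2
  have hsI : s ∈ Icc t₀ t₁ := ⟨hs'.1, hs'.2.trans hσ'.2⟩
  have hχs : χ (f (c s)) = Real.smoothTransition ((s - σ) / δ) := by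
    simp only [χ, hl s hsI]
  rcases le_total s σ with hsσ | hsσ
  · rw [hχs, Real.smoothTransition.zero_of_nonpos
      (div_nonpos_of_nonpos_of_nonneg (by linarith) hδ.le), zero_smul, add_zero] at h2
    exact h s ⟨hs'.1, hsσ⟩ v h1 h2
  · rcases lt_or_ge s (σ + δ) with hsδ | hsδ
    · refine hball ⟨?_, hsI⟩ (χ (f (c s))) ⟨Real.smoothTransition.nonneg _,
        Real.smoothTransition.le_one _⟩ v h1 (by rw [hCd]; exact h2)
      rw [Metric.mem_ball, Real.dist_eq, abs_lt]
      constructor <;> linarith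
    · rw [hχs, Real.smoothTransition.one_of_one_le ((one_le_div hδ).2 (by linarith)), one_smul,
        add_sub_cancel] at h2
      exact h' s ⟨hsσ, hs'.2⟩ v h1 (C.map_eq_zero_iff.1 h2)

/-- Along a curve that is a section of a linear function of a submersion `f`, the submersion can be
complemented by globally defined functions. A complement is extended past a given time by means of a
cutoff that is a function of `f`, so that its derivative vanishes on the kernel of that of `f`. -/
theorem exists_complement_along [FiniteDimensional ℝ B] {f : M → B}
    (hf : ContMDiff 𝓘(ℝ, F) 𝓘(ℝ, B) ∞ f) {c : ℝ → M} {t₀ t₁ : ℝ} (ht : t₀ ≤ t₁)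
    (hc : ContinuousOn c (Icc t₀ t₁)) {l : B →L[ℝ] ℝ} (hl : ∀ s ∈ Icc t₀ t₁, l (f (c s)) = s)
    (hs : ∀ s ∈ Icc t₀ t₁, Function.Surjective (vecDeriv F f (c s))) {n : ℕ}
    (hn : Module.finrank ℝ F = Module.finrank ℝ B + n) :
    ∃ q : M → Fin n → ℝ, ContMDiff 𝓘(ℝ, F) 𝓘(ℝ, Fin n → ℝ) ∞ q ∧
      ∀ s ∈ Icc t₀ t₁, ∀ v, vecDeriv F f (c s) v = 0 → vecDeriv F q (c s) v = 0 → v = 0 := by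
  let P : ℝ → Prop := fun σ => ∃ q : M → Fin n → ℝ, ContMDiff 𝓘(ℝ, F) 𝓘(ℝ, Fin n → ℝ) ∞ q ∧
      ∀ s ∈ Icc t₀ σ, ∀ v, vecDeriv F f (c s) v = 0 → vecDeriv F q (c s) v = 0 → v = 0
  have hmono : ∀ σ σ', σ ≤ σ' → P σ' → P σ := fun σ σ' h ⟨q, hq, h'⟩ =>
    ⟨q, hq, fun s hs => h' s ⟨hs.1, hs.2.trans h⟩⟩
  have h0 : P t₀ := by
    obtain ⟨q, hq, h⟩ := exists_complement_at (hs t₀ (left_mem_Icc.2 ht)) hn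
    refine ⟨q, hq, fun s hs => ?_⟩
    rw [le_antisymm hs.2 hs.1]
    exact h
  have hloc : ∀ x ∈ Icc t₀ t₁, ∀ᶠ y in 𝓝[Icc t₀ t₁] x, (P x ↔ P y) := by
    intro x hx
    obtain ⟨q', hq', h'⟩ := exists_complement_at (hs x hx) hn
    have hev := eventually_forall_segment_injective hf hq' hq' (x₀ := c x) fun θ _ v h1 h2 => by
      rw [sub_self, smul_zero, add_zero] at h2
      exact h' v h1 h2
    obtain ⟨δ, hδ, hball⟩ := Metric.mem_nhdsWithin_iff.1 ((hc x hx).eventually hev)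
    have hgood : ∀ s ∈ Metric.ball x δ ∩ Icc t₀ t₁, ∀ v, vecDeriv F f (c s) v = 0 →
        vecDeriv F q' (c s) v = 0 → v = 0 := fun s hs v h1 h2 =>
      hball hs 0 (left_mem_Icc.2 zero_le_one) v h1 (by rw [zero_smul, add_zero]; exact h2)
    have hstep : ∀ σ ∈ Metric.ball x δ ∩ Icc t₀ t₁, ∀ σ' ∈ Metric.ball x δ ∩ Icc t₀ t₁,
        σ ≤ σ' → P σ → P σ' := by
      rintro σ ⟨hσ, hσI⟩ σ' ⟨hσ', hσI'⟩ hle ⟨q, hq, h⟩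
      refine exists_complement_extend hf hc hl hn hσI hσI' hle (hs σ hσI) hq hq' h fun s hs' => ?_
      rw [Real.ball_eq_Ioo] at hσ hσ' hgood
      exact hgood s ⟨⟨hσ.1.trans_le hs'.1, hs'.2.trans_lt hσ'.2⟩, hσI.1.trans hs'.1,
        hs'.2.trans hσI'.2⟩
    filter_upwards [Filter.inter_mem (mem_nhdsWithin_of_mem_nhds (Metric.ball_mem_nhds x hδ))
      self_mem_nhdsWithin] with y hy
    have hx' : x ∈ Metric.ball x δ ∩ Icc t₀ t₁ := ⟨Metric.mem_ball_self hδ, hx⟩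
    rcases le_total x y with hxy | hxy
    · exact ⟨hstep x hx' y hy hxy, hmono x y hxy⟩
    · exact ⟨hmono y x hxy, hstep y hy x hx' hxy⟩
  obtain ⟨q, hq, h⟩ := (isPreconnected_Icc.induction₂ (fun x y => P x ↔ P y) hloc
    (fun _ _ _ _ _ _ h1 h2 => h1.trans h2) (fun _ _ _ _ h => h.symm) (left_mem_Icc.2 ht)
      (right_mem_Icc.2 ht)).1 h0
  exact ⟨q, hq, h⟩

/-- The inverse function theorem along a compact set on which the map is injective. -/
theorem exists_openPartialHomeomorph_of_isCompact [FiniteDimensional ℝ B] {g : M → B}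
    (hg : ContMDiff 𝓘(ℝ, F) 𝓘(ℝ, B) ∞ g) {K : Set M} (hK : IsCompact K) (hne : K.Nonempty)
    (hinj : InjOn g K) (hb : ∀ x ∈ K, Function.Bijective (vecDeriv F g x)) :
    ∃ e : OpenPartialHomeomorph M B, K ⊆ e.source ∧ (∀ x, e x = g x) ∧
      ContMDiffOn 𝓘(ℝ, B) 𝓘(ℝ, F) ∞ e.symm e.target := by
  have hloc : ∀ x ∈ K, ∃ e : OpenPartialHomeomorph M B, x ∈ e.source ∧ EqOn e g e.source ∧
      ContMDiffOn 𝓘(ℝ, B) 𝓘(ℝ, F) ∞ e.symm e.target := by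
    intro x hx
    have hxs := mem_chart_source F x
    have hb' : Function.Bijective
        (fderiv ℝ (g ∘ (chartAt F x).symm) (chartAt F x x)) := by
      have h1 := hb x hx
      rw [vecDeriv_eq_fderiv_comp hg x hxs, ContinuousLinearMap.coe_comp] at h1
      exact (Function.Bijective.of_comp_iff _ (bijective_vecDeriv_chartAt (F := F) x hxs)).1 h1
    let L := (LinearEquiv.ofBijective
      (fderiv ℝ (g ∘ (chartAt F x).symm) (chartAt F x x) : F →ₗ[ℝ] B) hb').toContinuousLinearEquiv
    have hsm := contDiffOn_comp_chartAt_symm hg x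
    have hd : HasFDerivAt (g ∘ (chartAt F x).symm) (L : F →L[ℝ] B) (chartAt F x x) :=
      ((hsm.contDiffAt ((chartAt F x).open_target.mem_nhds
        ((chartAt F x).map_source hxs))).differentiableAt (by simp)).hasFDerivAt
    obtain ⟨φ, hφx, -, hφ, hφs⟩ := exists_openPartialHomeomorph_of_hasFDerivAt
      (chartAt F x).open_target hsm ((chartAt F x).map_source hxs) L hd
    refine ⟨(chartAt F x).trans φ, ?_, fun y hy => ?_, ?_⟩
    · rw [OpenPartialHomeomorph.trans_source]
      exact ⟨hxs, hφx⟩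
    · rw [OpenPartialHomeomorph.trans_source] at hy
      rw [OpenPartialHomeomorph.coe_trans, Function.comp_apply, hφ, Function.comp_apply,
        (chartAt F x).left_inv hy.1]
    · rw [OpenPartialHomeomorph.trans_symm_eq_symm_trans_symm, OpenPartialHomeomorph.coe_trans]
      refine (contMDiffOn_chart_symm (I := 𝓘(ℝ, F)) (n := ∞)).comp
        (hφs.contMDiffOn.mono fun y hy => ?_) fun y hy => ?_
      · rw [OpenPartialHomeomorph.trans_target] at hy
        exact hy.1
      · rw [OpenPartialHomeomorph.trans_target] at hy
        exact hy.2
  have hne' : Nonempty (OpenPartialHomeomorph M B) := hne.elim fun x hx => ⟨(hloc x hx).choose⟩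
  choose! e hxe heg hes using hloc
  obtain ⟨U, hUo, hKU, hUi⟩ := hinj.exists_isOpen_superset hK
    (fun x _ => hg.continuous.continuousAt) fun x hx => ⟨(e x).source,
      (e x).open_source.mem_nhds (hxe x hx),
      (heg x hx).injOn_iff.1 (e x).injOn⟩
  -- `g` is injective near `K`, and a local homeomorphism there
  let O : Set M := U ∩ ⋃ x ∈ K, (e x).source
  have hO : IsOpen O := hUo.inter (isOpen_biUnion fun x _ => (e x).open_source)
  have hOi : InjOn g O := hUi.mono inter_subset_left
  have himg : ∀ W : Set M, IsOpen W → W ⊆ O → IsOpen (g '' W) := by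
    intro W hW hWO
    have h1 : g '' W = ⋃ x ∈ K, e x '' ((e x).source ∩ W) := by
      ext y
      simp only [mem_image, mem_iUnion, mem_inter_iff]
      constructor
      · rintro ⟨w, hw, rfl⟩
        obtain ⟨x, hx, hwx⟩ := mem_iUnion₂.1 (hWO hw).2
        exact ⟨x, hx, w, ⟨hwx, hw⟩, heg x hx hwx⟩
      · rintro ⟨x, hx, w, ⟨hwx, hw⟩, rfl⟩
        exact ⟨w, hw, (heg x hx hwx).symm⟩
    rw [h1]
    exact isOpen_biUnion fun x _ => (e x).isOpen_image_source_inter hW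
  have hM : Nonempty M := hne.to_type
  let E : PartialEquiv M B := hOi.bijOn_image.toPartialEquiv g O (g '' O)
  let φ : OpenPartialHomeomorph M B := OpenPartialHomeomorph.ofContinuousOpenRestrict E
    hg.continuous.continuousOn (fun W hW => by
      obtain ⟨W', hW', rfl⟩ := isOpen_induced_iff.1 hW
      have h1 : O.domRestrict g '' (Subtype.val ⁻¹' W') = g '' (O ∩ W') := by
        ext y
        simp [Set.domRestrict, and_comm]
      exact h1 ▸ himg _ (hO.inter hW') inter_subset_left) hO
  have hφ : ∀ x, φ x = g x := fun x => rfl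
  have hKO : K ⊆ O := fun x hx => ⟨hKU hx, mem_iUnion₂.2 ⟨x, hx, hxe x hx⟩⟩
  refine ⟨φ, hKO, hφ, fun y hy => ?_⟩
  obtain ⟨w, hw, rfl⟩ : ∃ w ∈ O, g w = y := hy
  obtain ⟨x, hx, hwx⟩ := mem_iUnion₂.1 hw.2
  have hgw : e x w = g w := heg x hx hwx
  have hsm : ContMDiffAt 𝓘(ℝ, B) 𝓘(ℝ, F) ∞ (e x).symm (g w) :=
    (hes x hx).contMDiffAt ((e x).open_target.mem_nhds (hgw ▸ (e x).map_source hwx))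
  refine (hsm.congr_of_eventuallyEq ?_).contMDiffWithinAt
  have hW : IsOpen (O ∩ (e x).source) := hO.inter (e x).open_source
  filter_upwards [(himg _ hW inter_subset_left).mem_nhds ⟨w, ⟨hw, hwx⟩, rfl⟩] with y hy
  obtain ⟨w', ⟨hw', hwx'⟩, rfl⟩ := hy
  rw [← hφ, φ.left_inv hw', hφ, ← heg x hx hwx', (e x).left_inv hwx']

end VecDeriv

/-! ### Adapted coordinates -/

theorem bijective_of_injective_of_finrank_eq {G H : Type*} [NormedAddCommGroup G] [NormedSpace ℝ G]
    [FiniteDimensional ℝ G] [NormedAddCommGroup H] [NormedSpace ℝ H] [FiniteDimensional ℝ H]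
    {T : G →L[ℝ] H} (hT : Function.Injective T)
    (h : Module.finrank ℝ G = Module.finrank ℝ H) : Function.Bijective T :=
  ⟨hT, (LinearMap.injective_iff_surjective_of_finrank_eq_finrank (f := (T : G →ₗ[ℝ] H)) h).1 hT⟩

theorem exists_cutoff_of_isCompact {Y : Type*} [NormedAddCommGroup Y] [NormedSpace ℝ Y]
    [FiniteDimensional ℝ Y] {K U : Set Y} (hK : IsCompact K) (hU : IsOpen U) (hKU : K ⊆ U) :
    ∃ χ : Y → ℝ, ContDiff ℝ ∞ χ ∧ HasCompactSupport χ ∧ tsupport χ ⊆ U ∧ ∀ᶠ y in 𝓝ˢ K, χ y = 1 := by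
  obtain ⟨N, hN, hKN, hNU⟩ := exists_compact_between hK hU hKU
  obtain ⟨χ, hχ1, hχ0, -⟩ := exists_contMDiffMap_one_nhds_of_subset_interior 𝓘(ℝ, Y) (n := ⊤)
    hK.isClosed hKN
  have hs : tsupport χ ⊆ N := closure_minimal (fun y hy => by
    by_contra h
    exact hy (hχ0 y h)) hN.isClosed
  exact ⟨χ, χ.contMDiff.contDiff, hN.of_isClosed_subset (isClosed_tsupport _) hs, hs.trans hNU, hχ1⟩

namespace ConstrainedSystem

variable {E F : Type*} [NormedAddCommGroup E] [NormedSpace ℝ E]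
  [NormedAddCommGroup F] [NormedSpace ℝ F]
  {V : Type*} [TopologicalSpace V] [ChartedSpace E V] [IsManifold 𝓘(ℝ, E) ∞ V]
  {A : Type*} [TopologicalSpace A] [ChartedSpace F A] [IsManifold 𝓘(ℝ, F) ∞ A]
  (S : ConstrainedSystem E F V A)

theorem contMDiff_proj : ContMDiff 𝓘(ℝ, F) 𝓘(ℝ, E) ∞ S.proj :=
  (Bundle.contMDiff_proj (TangentSpace 𝓘(ℝ, E) : V → Type _)).comp S.contMDiff_incl

theorem vecDeriv_time_incl (b : A) : vecDeriv E S.time (S.proj b) (S.incl b).2 = 1 := S.time_incl b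

/-- The derivative of a function on `V` along the vector `i(b)`, as a function of `b`. -/
theorem contMDiff_vecDeriv_incl {B : Type*} [NormedAddCommGroup B] [NormedSpace ℝ B] {f : V → B}
    (hf : ContMDiff 𝓘(ℝ, E) 𝓘(ℝ, B) ∞ f) :
    ContMDiff 𝓘(ℝ, F) 𝓘(ℝ, B) ∞ fun b => vecDeriv E f (S.proj b) (S.incl b).2 := by
  have h1 : ContMDiff 𝓘(ℝ, E).tangent 𝓘(ℝ, B).tangent ∞ (tangentMap 𝓘(ℝ, E) 𝓘(ℝ, B) f) :=
    hf.contMDiff_tangentMap (by simp)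
  exact contMDiff_snd_tangentBundle_modelSpace B 𝓘(ℝ, B) |>.comp (h1.comp S.contMDiff_incl)

theorem vecDeriv_comp_proj {B : Type*} [NormedAddCommGroup B] [NormedSpace ℝ B] {f : V → B}
    (hf : ContMDiff 𝓘(ℝ, E) 𝓘(ℝ, B) ∞ f) (b : A) :
    vecDeriv F (fun b => f (S.proj b)) b =
      vecDeriv E f (S.proj b) ∘L mfderiv 𝓘(ℝ, F) 𝓘(ℝ, E) S.proj b :=
  ((hf.hasMFDerivAt_vecDeriv (S.proj b)).comp b
    ((S.contMDiff_proj.mdifferentiableAt (by simp)).hasMFDerivAt)).mfderiv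

/-- Fibred coordinates of `V` and of `A` in which the constraint reads `q' = ψ (t, q, z)`. The
coordinate functions are defined on all of `V` and `A`, and `ψ` on the whole model space; the maps
`eV` and `eA` are coordinates on open sets. -/
structure AdaptedChart (Q Z : Type) [NormedAddCommGroup Q] [NormedSpace ℝ Q]
    [NormedAddCommGroup Z] [NormedSpace ℝ Z] where
  /-- the coordinates on the fibres of `V` over the time axis -/
  q : V → Q
  /-- the coordinates on the fibres of `A` over `V` -/
  z : A → Z
  contMDiff_q : ContMDiff 𝓘(ℝ, E) 𝓘(ℝ, Q) ∞ q
  contMDiff_z : ContMDiff 𝓘(ℝ, F) 𝓘(ℝ, Z) ∞ z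
  /-- the coordinates `(t, q)` -/
  eV : OpenPartialHomeomorph V (ℝ × Q)
  eV_apply : ∀ x, eV x = (S.time x, q x)
  contMDiffOn_eV_symm : ContMDiffOn 𝓘(ℝ, ℝ × Q) 𝓘(ℝ, E) ∞ eV.symm eV.target
  /-- the coordinates `(t, q, z)` -/
  eA : OpenPartialHomeomorph A (ℝ × Q × Z)
  eA_apply : ∀ b, eA b = (S.time (S.proj b), q (S.proj b), z b)
  contMDiffOn_eA_symm : ContMDiffOn 𝓘(ℝ, ℝ × Q × Z) 𝓘(ℝ, F) ∞ eA.symm eA.target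
  /-- the components of the constraint -/
  ψ : ℝ × Q × Z → Q
  contDiff_ψ : ContDiff ℝ ∞ ψ
  hasCompactSupport_ψ : HasCompactSupport ψ
  ψ_eA : ∀ b ∈ eA.source, ψ (eA b) = vecDeriv E q (S.proj b) (S.incl b).2

/-- Adapted coordinates exist around any given section of `A`. The coordinate expressions of the
constraint and of the Lagrangian are multiplied by a cutoff to be defined everywhere. -/
theorem exists_adaptedChart [FiniteDimensional ℝ E] [FiniteDimensional ℝ F] [T2Space V] [T2Space A]
    {L : A → ℝ} (hL : ContMDiff 𝓘(ℝ, F) 𝓘(ℝ, ℝ) ∞ L) {t₀ t₁ : ℝ} (ht : t₀ ≤ t₁) {a : ℝ → A}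
    (ha : ContinuousOn a (Icc t₀ t₁)) (hat : ∀ s ∈ Icc t₀ t₁, S.time (S.proj (a s)) = s) :
    ∃ (n m : ℕ) (C : S.AdaptedChart (Fin n → ℝ) (Fin m → ℝ))
      (l : ℝ × (Fin n → ℝ) × (Fin m → ℝ) → ℝ), ContDiff ℝ ∞ l ∧ HasCompactSupport l ∧
        (∀ b ∈ C.eA.source, l (C.eA b) = L b) ∧
        (∀ s ∈ Icc t₀ t₁, S.proj (a s) ∈ C.eV.source) ∧ ∀ s ∈ Icc t₀ t₁, a s ∈ C.eA.source := by
  have hne : (Icc t₀ t₁).Nonempty := nonempty_Icc.2 ht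
  have hγc : ContinuousOn (fun s => S.proj (a s)) (Icc t₀ t₁) :=
    S.contMDiff_proj.continuous.comp_continuousOn ha
  have hts : ∀ x, Function.Surjective (vecDeriv E S.time x) := S.submersion_time
  -- coordinates on `V`
  have hE : Module.finrank ℝ E = Module.finrank ℝ ℝ + (Module.finrank ℝ E - 1) := by
    have h1 := LinearMap.finrank_le_finrank_of_surjective
      (f := (vecDeriv E S.time (S.proj (a t₀)) : E →ₗ[ℝ] ℝ)) (hts _)
    rw [Module.finrank_self] at h1 ⊢
    omega
  set n := Module.finrank ℝ E - 1
  obtain ⟨q, hq, hqi⟩ := exists_complement_along S.contMDiff_time ht hγc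
    (l := ContinuousLinearMap.id ℝ ℝ) hat (fun s _ => hts _) hE
  have hgs := S.contMDiff_time.prodMk_space hq
  have hgb : ∀ x, (∀ v, vecDeriv E S.time x v = 0 → vecDeriv E q x v = 0 → v = 0) →
      Function.Bijective (vecDeriv E (fun x => (S.time x, q x)) x) := fun x h => by
    refine bijective_of_injective_of_finrank_eq ((injective_iff_map_eq_zero _).2 fun v hv => ?_)
      (by rw [Module.finrank_prod, Module.finrank_fin_fun, hE])
    rw [vecDeriv_prodMk S.contMDiff_time hq] at hv
    exact h v (congrArg Prod.fst hv) (congrArg Prod.snd hv)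
  obtain ⟨eV, heVs, heV, heVsymm⟩ := exists_openPartialHomeomorph_of_isCompact hgs
    (isCompact_Icc.image_of_continuousOn hγc) (hne.image _) (by
      rintro _ ⟨s, hs, rfl⟩ _ ⟨s', hs', rfl⟩ h
      have h1 : S.time (S.proj (a s)) = S.time (S.proj (a s')) := congrArg Prod.fst h
      rw [hat s hs, hat s' hs'] at h1
      rw [h1]) (by
      rintro _ ⟨s, hs, rfl⟩
      exact hgb _ (hqi s hs))
  -- coordinates on `A`
  have hfs := hgs.comp S.contMDiff_proj
  have hfsurj : ∀ s ∈ Icc t₀ t₁, Function.Surjective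
      (vecDeriv F (fun b => (S.time (S.proj b), q (S.proj b))) (a s)) := fun s hs => by
    rw [S.vecDeriv_comp_proj hgs]
    exact (hgb _ (hqi s hs)).2.comp (S.submersion_proj (a s))
  have hF : Module.finrank ℝ F = Module.finrank ℝ (ℝ × (Fin n → ℝ)) +
      (Module.finrank ℝ F - Module.finrank ℝ (ℝ × (Fin n → ℝ))) := by
    have h1 := LinearMap.finrank_le_finrank_of_surjective
      (f := (vecDeriv F (fun b => (S.time (S.proj b), q (S.proj b))) (a t₀) :
        F →ₗ[ℝ] ℝ × (Fin n → ℝ))) (hfsurj t₀ (left_mem_Icc.2 ht))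
    omega
  set m := Module.finrank ℝ F - Module.finrank ℝ (ℝ × (Fin n → ℝ))
  obtain ⟨z, hz, hzi⟩ := exists_complement_along hfs ht ha (l := ContinuousLinearMap.fst ℝ ℝ _) hat
    hfsurj hF
  have htime : ContMDiff 𝓘(ℝ, F) 𝓘(ℝ, ℝ) ∞ fun b => S.time (S.proj b) :=
    S.contMDiff_time.comp S.contMDiff_proj
  have hqπ : ContMDiff 𝓘(ℝ, F) 𝓘(ℝ, Fin n → ℝ) ∞ fun b => q (S.proj b) := hq.comp S.contMDiff_proj
  have hhs : ContMDiff 𝓘(ℝ, F) 𝓘(ℝ, ℝ × (Fin n → ℝ) × (Fin m → ℝ)) ∞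
    fun b => (S.time (S.proj b), q (S.proj b), z b) := htime.prodMk_space (hqπ.prodMk_space hz)
  obtain ⟨e, hes, he, hesymm⟩ := exists_openPartialHomeomorph_of_isCompact hhs
    (isCompact_Icc.image_of_continuousOn ha) (hne.image _) (by
      rintro _ ⟨s, hs, rfl⟩ _ ⟨s', hs', rfl⟩ h
      have h1 : S.time (S.proj (a s)) = S.time (S.proj (a s')) := congrArg Prod.fst h
      rw [hat s hs, hat s' hs'] at h1
      rw [h1]) (by
      rintro _ ⟨s, hs, rfl⟩
      refine bijective_of_injective_of_finrank_eq ((injective_iff_map_eq_zero _).2 fun v hv => ?_)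
        (by
          rw [hF]
          simp only [Module.finrank_prod, Module.finrank_fin_fun, add_assoc])
      rw [vecDeriv_prodMk htime (hqπ.prodMk_space hz), vecDeriv_prodMk hqπ hz] at hv
      refine hzi s hs v ?_ (congrArg (fun w => w.2.2) hv)
      refine (DFunLike.congr_fun (vecDeriv_prodMk htime hqπ (a s)) v).trans ?_
      have h1 := congrArg Prod.fst hv
      have h2 := congrArg (fun w => w.2.1) hv
      exact Prod.ext h1 h2)
  -- a cutoff near the curve extends functions of the coordinates to the whole model space
  have hK : IsCompact (e '' (a '' Icc t₀ t₁)) :=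
    (isCompact_Icc.image_of_continuousOn ha).image_of_continuousOn (e.continuousOn.mono hes)
  obtain ⟨χ, hχ, hχc, hχs, hχ1⟩ := exists_cutoff_of_isCompact hK e.open_target (by
    rintro _ ⟨b, hb, rfl⟩
    exact e.map_source (hes hb))
  obtain ⟨O, hO, hKO, hO1⟩ := mem_nhdsSet_iff_exists.1 hχ1
  have hcut : ∀ {G : Type} [NormedAddCommGroup G] [NormedSpace ℝ G] {g : A → G},
      ContMDiff 𝓘(ℝ, F) 𝓘(ℝ, G) ∞ g → ContDiff ℝ ∞ (fun y => χ y • g (e.symm y)) ∧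
        HasCompactSupport (fun y => χ y • g (e.symm y)) ∧
          ∀ b ∈ e.source, e b ∈ O → χ (e b) • g (e.symm (e b)) = g b := by
    intro G _ _ g hg
    have h1 : ContDiffOn ℝ ∞ (fun y => g (e.symm y)) e.target :=
      (hg.comp_contMDiffOn hesymm).contDiffOn
    refine ⟨contDiff_iff_contDiffAt.2 fun y => ?_, hχc.smul_right, fun b hb hbO => ?_⟩
    · by_cases hy : y ∈ tsupport χ
      · exact hχ.contDiffAt.smul (h1.contDiffAt (e.open_target.mem_nhds (hχs hy)))
      · refine (contDiffAt_const (c := (0 : G))).congr_of_eventuallyEq ?_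
        filter_upwards [(isClosed_tsupport χ).isOpen_compl.mem_nhds hy] with w hw
        rw [image_eq_zero_of_notMem_tsupport hw, zero_smul]
    · have h2 : χ (e b) = 1 := hO1 hbO
      rw [h2, one_smul, e.left_inv hb]
  obtain ⟨hψ1, hψ2, hψ3⟩ := hcut (S.contMDiff_vecDeriv_incl hq)
  obtain ⟨hl1, hl2, hl3⟩ := hcut hL
  have hOe : IsOpen (e.source ∩ e ⁻¹' O) := e.isOpen_inter_preimage hO
  let eA := e.restrOpen (e.source ∩ e ⁻¹' O) hOe
  have hsub : eA.target ⊆ e.target := fun y hy => by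
    have h1 := eA.right_inv hy
    rw [← h1]
    exact e.map_source (eA.map_target hy).1
  have hsrc : ∀ b ∈ eA.source, b ∈ e.source ∧ e b ∈ O := fun b hb => hb.2
  let C : S.AdaptedChart (Fin n → ℝ) (Fin m → ℝ) :=
    { q := q
      z := z
      contMDiff_q := hq
      contMDiff_z := hz
      eV := eV
      eV_apply := heV
      contMDiffOn_eV_symm := heVsymm
      eA := eA
      eA_apply := he
      contMDiffOn_eA_symm := hesymm.mono hsub
      ψ := _
      contDiff_ψ := hψ1
      hasCompactSupport_ψ := hψ2
      ψ_eA := fun b hb => hψ3 b (hsrc b hb).1 (hsrc b hb).2 }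
  refine ⟨n, m, C, _, hl1, hl2, fun b hb => hl3 b (hsrc b hb).1 (hsrc b hb).2, fun s hs =>
    heVs ⟨s, hs, rfl⟩, fun s hs => ?_⟩
  have h1 : a s ∈ e.source := hes ⟨s, hs, rfl⟩
  exact ⟨h1, h1, hKO ⟨a s, ⟨s, hs, rfl⟩, rfl⟩⟩

end ConstrainedSystem

/-! ### Contact forms in adapted coordinates -/

section Trivialize

variable {E : Type*} [NormedAddCommGroup E] [NormedSpace ℝ E]
  {V : Type*} [TopologicalSpace V] [ChartedSpace E V] [IsManifold 𝓘(ℝ, E) ∞ V]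
  {B : Type*} [NormedAddCommGroup B] [NormedSpace ℝ B]

variable (E) in
/-- The identification of the model space with the tangent space at `x` given by the trivialization
of the tangent bundle at `x₀`. -/
def trivSymm (x₀ x : V) : E →L[ℝ] E :=
  (trivializationAt E (TangentSpace 𝓘(ℝ, E)) x₀).symmL ℝ x

theorem isInvertible_trivSymm {x₀ x : V} (hx : x ∈ (chartAt E x₀).source) :
    (trivSymm E x₀ x).IsInvertible := by
  have hx' : x ∈ (trivializationAt E (TangentSpace 𝓘(ℝ, E)) x₀).baseSet := hx
  exact ⟨((trivializationAt E (TangentSpace 𝓘(ℝ, E)) x₀).continuousLinearEquivAt ℝ x hx').symm,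
    Trivialization.symm_continuousLinearEquivAt_eq' _ hx'⟩

/-- The derivative of a function on `V`, read in the trivialization of the tangent bundle at `x₀`,
is smooth at `x₀`. -/
theorem contMDiffAt_vecDeriv_comp_trivSymm {f : V → B} (hf : ContMDiff 𝓘(ℝ, E) 𝓘(ℝ, B) ∞ f)
    (x₀ : V) :
    ContMDiffAt 𝓘(ℝ, E) 𝓘(ℝ, E →L[ℝ] B) ∞ (fun x => vecDeriv E f x ∘L trivSymm E x₀ x) x₀ := by
  have h1 := (hf.contMDiffAt (x := x₀)).mfderiv_const (m := ∞) (by simp)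
  refine h1.congr_of_eventuallyEq (Filter.Eventually.of_forall fun x => ?_)
  simp only [inTangentCoordinates, ContinuousLinearMap.inCoordinates,
    TangentBundle.continuousLinearMapAt_model_space]
  rfl

/-- Smoothness of a map into the cotangent bundle, in terms of the trivializations of the tangent
bundle. -/
theorem contMDiffWithinAt_cotangent_iff {N : Type*} [NormedAddCommGroup N] [NormedSpace ℝ N]
    {x : N → V} {φ : N → E →L[ℝ] ℝ} {s : Set N} {y : N} :
    ContMDiffWithinAt 𝓘(ℝ, N) (𝓘(ℝ, E).prod 𝓘(ℝ, E →L[ℝ] ℝ)) ∞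
        (fun y => (⟨x y, φ y⟩ : CotangentBundle E V)) s y ↔
      ContMDiffWithinAt 𝓘(ℝ, N) 𝓘(ℝ, E) ∞ x s y ∧
        ContMDiffWithinAt 𝓘(ℝ, N) 𝓘(ℝ, E →L[ℝ] ℝ) ∞
          (fun y' => φ y' ∘L trivSymm E (x y) (x y')) s y := by
  rw [contMDiffWithinAt_hom_bundle]
  refine and_congr Iff.rfl ?_
  have h1 : (fun y' => ContinuousLinearMap.inCoordinates E (TangentSpace 𝓘(ℝ, E)) ℝ (Trivial V ℝ)
      (x y) (x y') (x y) (x y') (φ y')) = fun y' => φ y' ∘L trivSymm E (x y) (x y') := by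
    funext y'
    have h2 : (trivializationAt ℝ (Trivial V ℝ) (x y)).continuousLinearMapAt ℝ (x y') =
        ContinuousLinearMap.id ℝ ℝ := Trivial.continuousLinearMapAt_trivialization ℝ V ℝ (x y')
    refine (congrArg (fun T : ℝ →L[ℝ] ℝ => T ∘L (φ y' ∘L trivSymm E (x y) (x y'))) h2).trans ?_
    ext v
    rfl
  exact Eq.to_iff (congrArg (fun g => ContMDiffWithinAt 𝓘(ℝ, N) 𝓘(ℝ, E →L[ℝ] ℝ) ∞ g s y) h1)

end Trivialize

section Velocity

variable {E : Type*} [NormedAddCommGroup E] [NormedSpace ℝ E]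
  {V : Type*} [TopologicalSpace V] [ChartedSpace E V] [IsManifold 𝓘(ℝ, E) ∞ V]
  {B : Type*} [NormedAddCommGroup B] [NormedSpace ℝ B]

theorem hasDerivWithinAt_comp_velocity {f : V → B} (hf : ContMDiff 𝓘(ℝ, E) 𝓘(ℝ, B) ∞ f)
    {t₀ t₁ : ℝ} {c : ℝ → V} (hc : ContMDiffOn 𝓘(ℝ, ℝ) 𝓘(ℝ, E) ∞ c (Icc t₀ t₁)) {s : ℝ}
    (hs : s ∈ Icc t₀ t₁) :
    HasDerivWithinAt (fun s => f (c s))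
      (vecDeriv E f (c s) (ConstrainedSystem.velocity E t₀ t₁ c s)) (Icc t₀ t₁) s := by
  have h1 := ((hc s hs).mdifferentiableWithinAt (by simp)).hasMFDerivWithinAt
  have h2 := (hf.hasMFDerivAt_vecDeriv (c s)).comp_hasMFDerivWithinAt s h1
  have h3 : HasFDerivWithinAt (fun s => f (c s)) (vecDeriv E f (c s) ∘L
      (mfderivWithin 𝓘(ℝ, ℝ) 𝓘(ℝ, E) c (Icc t₀ t₁) s : ℝ →L[ℝ] E)) (Icc t₀ t₁) s :=
    hasMFDerivWithinAt_iff_hasFDerivWithinAt.1 h2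
  exact h3.hasDerivWithinAt

end Velocity

/-- A form that kills a vector `i` with first coordinate `1` is determined by its values on the
vectors with first coordinate `0`. -/
theorem apply_eq_of_apply_eq_zero {E Q : Type*} [NormedAddCommGroup E] [NormedSpace ℝ E]
    [NormedAddCommGroup Q] [NormedSpace ℝ Q] (e : E ≃L[ℝ] ℝ × Q) {f : E →L[ℝ] ℝ} {i : E} {c : Q}
    (hi : e i = (1, c)) (hf : f i = 0) (v : E) :
    f v = f (e.symm (0, (e v).2)) - f (e.symm (0, c)) * (e v).1 := by
  -- `v` minus `(e v).1 • i` has first coordinate `0`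
  have h5 : v = e.symm (0, (e v).2) - (e v).1 • e.symm (0, c) + (e v).1 • i := by
    apply e.injective
    simp only [map_add, map_sub, map_smul, ContinuousLinearEquiv.apply_symm_apply]
    rw [hi]
    ext <;> simp
  conv_lhs => rw [h5]
  rw [map_add, map_sub, map_smul, map_smul, hf, smul_zero, add_zero, smul_eq_mul, mul_comm]

namespace ConstrainedSystem.AdaptedChart

variable {E F : Type*} [NormedAddCommGroup E] [NormedSpace ℝ E] [FiniteDimensional ℝ E]
  [NormedAddCommGroup F] [NormedSpace ℝ F]
  {V : Type*} [TopologicalSpace V] [ChartedSpace E V] [IsManifold 𝓘(ℝ, E) ∞ V]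
  {A : Type*} [TopologicalSpace A] [ChartedSpace F A] [IsManifold 𝓘(ℝ, F) ∞ A]
  {S : ConstrainedSystem E F V A}
  {Q Z : Type} [NormedAddCommGroup Q] [NormedSpace ℝ Q] [FiniteDimensional ℝ Q]
  [NormedAddCommGroup Z] [NormedSpace ℝ Z] [FiniteDimensional ℝ Z]
  (C : S.AdaptedChart Q Z)

/-- The coframe `(dt, dq)`. -/
def frame (x : V) : E →L[ℝ] ℝ × Q := (vecDeriv E S.time x).prod (vecDeriv E C.q x)

theorem isInvertible_frame {x : V} (hx : x ∈ C.eV.source) : (C.frame x).IsInvertible := by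
  have hs := S.contMDiff_time.prodMk_space C.contMDiff_q
  have he : ⇑C.eV = fun x => (S.time x, C.q x) := funext C.eV_apply
  have h1 : C.eV.MDifferentiable 𝓘(ℝ, E) 𝓘(ℝ, ℝ × Q) :=
    ⟨by rw [he]; exact (hs.mdifferentiable (by simp)).mdifferentiableOn,
      C.contMDiffOn_eV_symm.mdifferentiableOn (by simp)⟩
  have h2 : Function.Bijective (vecDeriv E C.eV x) := h1.mfderiv_bijective hx
  rw [he, vecDeriv_prodMk S.contMDiff_time C.contMDiff_q] at h2
  exact ⟨(LinearEquiv.ofBijective (C.frame x : E →ₗ[ℝ] ℝ × Q) h2).toContinuousLinearEquiv,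
    by ext v <;> rfl⟩

theorem injective_frame {x : V} (hx : x ∈ C.eV.source) : Function.Injective (C.frame x) := by
  obtain ⟨e, he⟩ := C.isInvertible_frame hx
  rw [← he]
  exact e.injective

/-- The components `ψⁱ` of the constraint, as a function on `A`. -/
def slope (b : A) : Q := vecDeriv E C.q (S.proj b) (S.incl b).2

theorem contMDiff_slope : ContMDiff 𝓘(ℝ, F) 𝓘(ℝ, Q) ∞ C.slope :=
  S.contMDiff_vecDeriv_incl C.contMDiff_q

theorem frame_incl (b : A) : C.frame (S.proj b) (S.incl b).2 = (1, C.slope b) :=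
  Prod.ext (S.vecDeriv_time_incl b) rfl

/-- The covector `p ∘ (dq - ψ dt)` at `π(b)`. -/
def contactForm (b : A) (p : Q →L[ℝ] ℝ) : E →L[ℝ] ℝ :=
  p ∘L vecDeriv E C.q (S.proj b) - p (C.slope b) • vecDeriv E S.time (S.proj b)

theorem contactForm_apply (b : A) (p : Q →L[ℝ] ℝ) (v : E) :
    C.contactForm b p v =
      p (vecDeriv E C.q (S.proj b) v) - p (C.slope b) * vecDeriv E S.time (S.proj b) v := rfl

/-- The point of `𝒞(A)` over `b` with momentum `p`. -/
def contactPoint (b : A) (p : Q →L[ℝ] ℝ) : S.ContactBundle where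
  pt := b
  form := C.contactForm b p
  form_incl := by
    refine (C.contactForm_apply b p _).trans ?_
    rw [S.vecDeriv_time_incl, mul_one]
    exact sub_self _

/-- The momentum `p` of a contact form `p ∘ (dq - ψ dt)`. -/
def momentum (w : S.ContactBundle) : Q →L[ℝ] ℝ :=
  (w.form : E →L[ℝ] ℝ) ∘L (C.frame w.base).inverse ∘L ContinuousLinearMap.inr ℝ ℝ Q

theorem contactPoint_momentum {w : S.ContactBundle} (hw : w.base ∈ C.eV.source) :
    C.contactPoint w.pt (C.momentum w) = w := by
  obtain ⟨b, φ, hφ⟩ := w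
  obtain ⟨e, he⟩ := C.isInvertible_frame hw
  have h0 : (C.frame (S.proj b)).inverse = (e.symm : ℝ × Q →L[ℝ] E) := by
    have he' : C.frame (S.proj b) = e := he.symm
    rw [he', ContinuousLinearMap.inverse_equiv]
  have h1 : C.contactForm b (C.momentum ⟨b, φ, hφ⟩) = φ := by
    ext v
    have h2 : ∀ u : Q, C.momentum ⟨b, φ, hφ⟩ u = (φ : E →L[ℝ] ℝ) (e.symm (0, u)) := fun u => by
      change (φ : E →L[ℝ] ℝ) ((C.frame (S.proj b)).inverse (0, u)) = _
      rw [h0]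
      rfl
    have h3 : e v = (vecDeriv E S.time (S.proj b) v, vecDeriv E C.q (S.proj b) v) :=
      DFunLike.congr_fun he v
    obtain ⟨i, hi⟩ : ∃ i : E, i = (S.incl b).2 := ⟨_, rfl⟩
    have h4 : e i = (1, C.slope b) :=
      hi ▸ (DFunLike.congr_fun he (S.incl b).2).trans (C.frame_incl b)
    have h6 := apply_eq_of_apply_eq_zero e (f := φ) h4 (hi ▸ hφ) v
    rw [h3] at h6
    rw [contactForm_apply, h2, h2]
    exact h6.symm
  have h2 : ∀ φ' : E →L[ℝ] ℝ, φ' = φ → ∀ h' : φ' (S.incl b).2 = 0,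
      (⟨b, φ', h'⟩ : S.ContactBundle) = ⟨b, φ, hφ⟩ := by
    rintro _ rfl _
    rfl
  exact h2 _ h1 _

theorem momentum_contactPoint {b : A} (hb : S.proj b ∈ C.eV.source) (p : Q →L[ℝ] ℝ) :
    C.momentum (C.contactPoint b p) = p := by
  obtain ⟨e, he⟩ := C.isInvertible_frame hb
  ext u
  change C.contactForm b p ((C.frame (S.proj b)).inverse (0, u)) = p u
  have h3 : e (e.symm (0, u)) = (vecDeriv E S.time (S.proj b) (e.symm (0, u)),
    vecDeriv E C.q (S.proj b) (e.symm (0, u))) := DFunLike.congr_fun he (e.symm (0, u))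
  rw [e.apply_symm_apply] at h3
  rw [← he, ContinuousLinearMap.inverse_equiv, contactForm_apply]
  change p (vecDeriv E C.q (S.proj b) (e.symm (0, u))) -
    p (C.slope b) * vecDeriv E S.time (S.proj b) (e.symm (0, u)) = p u
  have h4 : vecDeriv E S.time (S.proj b) (e.symm (0, u)) = 0 := (congrArg Prod.fst h3).symm
  have h5 : vecDeriv E C.q (S.proj b) (e.symm (0, u)) = u := (congrArg Prod.snd h3).symm
  rw [h4, h5, mul_zero, sub_zero]

/-- The velocity of a section has components `(1, q')`. -/
theorem frame_velocity {t₀ t₁ : ℝ} {c : ℝ → V}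
    (hc : ContMDiffOn 𝓘(ℝ, ℝ) 𝓘(ℝ, E) ∞ c (Icc t₀ t₁)) (ht : t₀ < t₁)
    (hct : ∀ s ∈ Icc t₀ t₁, S.time (c s) = s) {s : ℝ} (hs : s ∈ Icc t₀ t₁) :
    C.frame (c s) (velocity E t₀ t₁ c s) =
      (1, derivWithin (fun s => C.q (c s)) (Icc t₀ t₁) s) := by
  have hu := uniqueDiffOn_Icc ht s hs
  refine Prod.ext ?_ ?_
  · have h1 := hasDerivWithinAt_comp_velocity S.contMDiff_time hc hs
    exact hu.eq_deriv _ h1 ((hasDerivWithinAt_id s _).congr hct (hct s hs))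
  · exact ((hasDerivWithinAt_comp_velocity C.contMDiff_q hc hs).derivWithin hu).symm

variable {N : Type*} [NormedAddCommGroup N] [NormedSpace ℝ N]

theorem smoothOn_contactPoint {b : N → A} {p : N → Q →L[ℝ] ℝ} {s : Set N}
    (hb : ContMDiffOn 𝓘(ℝ, N) 𝓘(ℝ, F) ∞ b s) (hp : ContDiffOn ℝ ∞ p s) :
    SmoothOn (fun y => C.contactPoint (b y) (p y)) s := by
  refine ⟨hb, fun y hy => ?_⟩
  have hπ : ContMDiffWithinAt 𝓘(ℝ, N) 𝓘(ℝ, E) ∞ (fun y => S.proj (b y)) s y :=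
    S.contMDiff_proj.contMDiffAt.comp_contMDiffWithinAt y (hb y hy)
  refine contMDiffWithinAt_cotangent_iff.2 ⟨hπ, ?_⟩
  have h1 := (contMDiffAt_vecDeriv_comp_trivSymm C.contMDiff_q
    (S.proj (b y))).comp_contMDiffWithinAt y hπ
  have h2 := (contMDiffAt_vecDeriv_comp_trivSymm S.contMDiff_time
    (S.proj (b y))).comp_contMDiffWithinAt y hπ
  have h3 : ContMDiffWithinAt 𝓘(ℝ, N) 𝓘(ℝ, Q) ∞ (fun y => C.slope (b y)) s y :=
    C.contMDiff_slope.contMDiffAt.comp_contMDiffWithinAt y (hb y hy)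
  have hp' : ContMDiffWithinAt 𝓘(ℝ, N) 𝓘(ℝ, Q →L[ℝ] ℝ) ∞ p s y := (hp y hy).contMDiffWithinAt
  exact (hp'.clm_comp h1).sub ((hp'.clm_apply h3).smul h2)

theorem contDiffOn_momentum {w : N → S.ContactBundle} {s : Set N} (hw : SmoothOn w s)
    (hs : ∀ y ∈ s, (w y).base ∈ C.eV.source) : ContDiffOn ℝ ∞ (fun y => C.momentum (w y)) s := by
  intro y hy
  obtain ⟨hπ, h1⟩ := contMDiffWithinAt_cotangent_iff.1 (hw.2 y hy)
  set x₀ := (w y).base with hx₀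
  let T : V → E →L[ℝ] ℝ × Q := fun x => C.frame x ∘L trivSymm E x₀ x
  have hT : ContMDiffAt 𝓘(ℝ, E) 𝓘(ℝ, E →L[ℝ] ℝ × Q) ∞ T x₀ := by
    have := contMDiffAt_vecDeriv_comp_trivSymm (S.contMDiff_time.prodMk_space C.contMDiff_q) x₀
    simp only [vecDeriv_prodMk S.contMDiff_time C.contMDiff_q] at this
    exact this
  -- `T` is the frame read in the trivialization at `x₀`, where smoothness can be expressed
  have hTi : ∀ x ∈ C.eV.source ∩ (chartAt E x₀).source, (T x).IsInvertible := fun x hx =>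
    (C.isInvertible_frame hx.1).comp (isInvertible_trivSymm hx.2)
  have hx₀m : x₀ ∈ C.eV.source ∩ (chartAt E x₀).source := ⟨hs y hy, mem_chart_source E x₀⟩
  have hinv : ContMDiffAt 𝓘(ℝ, E) 𝓘(ℝ, ℝ × Q →L[ℝ] E) ∞ (fun x => (T x).inverse) x₀ := by
    obtain ⟨e, he⟩ := hTi x₀ hx₀m
    have h2 : ContDiffAt ℝ ∞ ContinuousLinearMap.inverse (T x₀) := by
      rw [← he]
      exact contDiffAt_map_inverse e
    exact h2.contMDiffAt.comp x₀ hT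
  have h2 := hinv.comp_contMDiffWithinAt y hπ
  have h3 : ContMDiffWithinAt 𝓘(ℝ, N) 𝓘(ℝ, Q →L[ℝ] ℝ) ∞ (fun y' =>
      (((w y').form : E →L[ℝ] ℝ) ∘L trivSymm E x₀ (w y').base) ∘L ((T (w y').base).inverse ∘L
        ContinuousLinearMap.inr ℝ ℝ Q)) s y :=
    h1.clm_comp (h2.clm_comp contMDiffWithinAt_const)
  have hmom : ∀ y', (w y').base ∈ C.eV.source ∩ (chartAt E x₀).source →
      C.momentum (w y') = (((w y').form : E →L[ℝ] ℝ) ∘L trivSymm E x₀ (w y').base) ∘L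
        ((T (w y').base).inverse ∘L ContinuousLinearMap.inr ℝ ℝ Q) := by
    intro y' hy'
    obtain ⟨e, he⟩ := C.isInvertible_frame hy'.1
    obtain ⟨e', he'⟩ := isInvertible_trivSymm hy'.2
    have h4 : T (w y').base = ((e'.trans e : E ≃L[ℝ] ℝ × Q) : E →L[ℝ] ℝ × Q) := by
      simp only [T]
      rw [← he, ← he']
      rfl
    have h5 : C.momentum (w y') = (w y').form ∘L (C.frame (w y').base).inverse ∘L
      ContinuousLinearMap.inr ℝ ℝ Q := rfl
    rw [h5, h4, ← he, ← he', ContinuousLinearMap.inverse_equiv, ContinuousLinearMap.inverse_equiv]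
    ext u
    change _ = (w y').form (e' (e'.symm (e.symm (0, u))))
    rw [e'.apply_symm_apply]
    rfl
  refine (h3.contDiffWithinAt).congr_of_eventuallyEq ?_ (hmom y hx₀m)
  filter_upwards [hπ.continuousWithinAt.eventually ((chartAt E x₀).open_source.mem_nhds
    (mem_chart_source E x₀)), self_mem_nhdsWithin] with y' h4 h5
  exact hmom y' ⟨hs y' h5, h4⟩

end ConstrainedSystem.AdaptedChart

/-! ### The first variation in coordinates -/

section FirstVariation

/-- A deformation of a curve that lies in an open set stays in the set for small parameters. -/
theorem ContinuousOn.eventually_forall_Icc_mem {Y : Type*} [TopologicalSpace Y] {f : ℝ × ℝ → Y}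
    {ε t₀ t₁ : ℝ} (hε : 0 < ε) (hf : ContinuousOn f (Ioo (-ε) ε ×ˢ Icc t₀ t₁)) {U : Set Y}
    (hU : IsOpen U) (h : ∀ s ∈ Icc t₀ t₁, f (0, s) ∈ U) :
    ∃ δ > 0, δ ≤ ε ∧ ∀ ξ ∈ Ioo (-δ) δ, ∀ s ∈ Icc t₀ t₁, f (ξ, s) ∈ U := by
  have h0 : (0 : ℝ) ∈ Ioo (-ε) ε := ⟨by linarith, hε⟩
  have h1 : ∀ᶠ ξ in 𝓝 (0 : ℝ), ∀ s ∈ Icc t₀ t₁,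
      ((ξ, s) : ℝ × ℝ) ∈ Ioo (-ε) ε ×ˢ Icc t₀ t₁ → f (ξ, s) ∈ U :=
    isCompact_Icc.eventually_forall_of_forall_eventually
      (P := fun ξ s => ((ξ, s) : ℝ × ℝ) ∈ Ioo (-ε) ε ×ˢ Icc t₀ t₁ → f (ξ, s) ∈ U) fun s hs =>
        eventually_nhdsWithin_iff.1 ((hf (0, s) ⟨h0, hs⟩).eventually (hU.mem_nhds (h s hs)))
  obtain ⟨δ, hδ, hball⟩ := Metric.eventually_nhds_iff_ball.1 h1
  refine ⟨min δ ε, lt_min hδ hε, min_le_right _ _, fun ξ hξ s hs => hball ξ ?_ s hs ⟨?_, hs⟩⟩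
  · rw [Real.ball_eq_Ioo, zero_sub, zero_add]
    exact ⟨by linarith [hξ.1, min_le_left δ ε], hξ.2.trans_le (min_le_left _ _)⟩
  · exact ⟨by linarith [hξ.1, min_le_right δ ε], hξ.2.trans_le (min_le_right _ _)⟩

theorem uniqueDiffOn_Ioo_prod_Icc {ε t₀ t₁ : ℝ} (ht : t₀ < t₁) :
    UniqueDiffOn ℝ (Ioo (-ε) ε ×ˢ Icc t₀ t₁) :=
  isOpen_Ioo.uniqueDiffOn.prod (uniqueDiffOn_Icc ht)

theorem ContDiffOn.hasDerivAt_fst {G : Type*} [NormedAddCommGroup G] [NormedSpace ℝ G]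
    {f : ℝ × ℝ → G} {ε t₀ t₁ : ℝ} (hf : ContDiffOn ℝ ∞ f (Ioo (-ε) ε ×ˢ Icc t₀ t₁)) {ξ s : ℝ}
    (hξ : ξ ∈ Ioo (-ε) ε) (hs : s ∈ Icc t₀ t₁) :
    HasDerivAt (fun ξ => f (ξ, s))
      (fderivWithin ℝ f (Ioo (-ε) ε ×ˢ Icc t₀ t₁) (ξ, s) (1, 0)) ξ := by
  have h1 := ((hf (ξ, s) ⟨hξ, hs⟩).differentiableWithinAt (by simp)).hasFDerivWithinAt
  have h2 : HasDerivWithinAt (fun ξ : ℝ => (ξ, s)) ((1 : ℝ), (0 : ℝ)) (Ioo (-ε) ε) ξ :=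
    ((hasDerivAt_id ξ).prodMk (hasDerivAt_const ξ s)).hasDerivWithinAt
  have h3 : MapsTo (fun ξ : ℝ => (ξ, s)) (Ioo (-ε) ε) (Ioo (-ε) ε ×ˢ Icc t₀ t₁) :=
    fun ξ' hξ' => ⟨hξ', hs⟩
  exact (h1.comp_hasDerivWithinAt ξ h2 h3).hasDerivAt (Ioo_mem_nhds hξ.1 hξ.2)

theorem ContDiffOn.hasDerivWithinAt_snd {G : Type*} [NormedAddCommGroup G] [NormedSpace ℝ G]
    {f : ℝ × ℝ → G} {ε t₀ t₁ : ℝ} (hf : ContDiffOn ℝ ∞ f (Ioo (-ε) ε ×ˢ Icc t₀ t₁)) {ξ s : ℝ}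
    (hξ : ξ ∈ Ioo (-ε) ε) (hs : s ∈ Icc t₀ t₁) :
    HasDerivWithinAt (fun s => f (ξ, s))
      (fderivWithin ℝ f (Ioo (-ε) ε ×ˢ Icc t₀ t₁) (ξ, s) (0, 1)) (Icc t₀ t₁) s := by
  have h1 := ((hf (ξ, s) ⟨hξ, hs⟩).differentiableWithinAt (by simp)).hasFDerivWithinAt
  have h2 : HasDerivWithinAt (fun s : ℝ => (ξ, s)) ((0 : ℝ), (1 : ℝ)) (Icc t₀ t₁) s :=
    ((hasDerivAt_const s ξ).prodMk (hasDerivAt_id s)).hasDerivWithinAt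
  have h3 : MapsTo (fun s : ℝ => (ξ, s)) (Icc t₀ t₁) (Ioo (-ε) ε ×ˢ Icc t₀ t₁) :=
    fun s' hs' => ⟨hξ, hs'⟩
  exact h1.comp_hasDerivWithinAt s h2 h3

/-- Differentiation under the integral sign over a compact interval. -/
theorem hasDerivAt_integral_of_contDiffOn {Φ : ℝ × ℝ → ℝ} {ε t₀ t₁ : ℝ} (hε : 0 < ε)
    (ht : t₀ < t₁) (hΦ : ContDiffOn ℝ ∞ Φ (Ioo (-ε) ε ×ˢ Icc t₀ t₁)) {D : ℝ → ℝ}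
    (hD : ∀ s ∈ Icc t₀ t₁, HasDerivAt (fun ξ => Φ (ξ, s)) (D s) 0) :
    HasDerivAt (fun ξ => ∫ s in t₀..t₁, Φ (ξ, s)) (∫ s in t₀..t₁, D s) 0 := by
  set S := Ioo (-ε) ε ×ˢ Icc t₀ t₁ with hS
  have h0 : (0 : ℝ) ∈ Ioo (-ε) ε := ⟨by linarith, hε⟩
  have hI : uIoc t₀ t₁ ⊆ Icc t₀ t₁ := by
    rw [uIoc_of_le ht.le]
    exact Ioc_subset_Icc_self
  have hc : ContinuousOn (fun y => fderivWithin ℝ Φ S y (1, 0)) S :=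
    (hΦ.continuousOn_fderivWithin (uniqueDiffOn_Ioo_prod_Icc ht) (by simp)).clm_apply
      continuousOn_const
  have hsec : ∀ {g : ℝ × ℝ → ℝ}, ContinuousOn g S → ∀ ξ ∈ Ioo (-ε) ε,
      ContinuousOn (fun s => g (ξ, s)) (Icc t₀ t₁) := fun hg ξ hξ =>
    hg.comp (by fun_prop) fun s hs => ⟨hξ, hs⟩
  have hint : ∀ {g : ℝ → ℝ}, ContinuousOn g (Icc t₀ t₁) → IntervalIntegrable g volume t₀ t₁ :=
    fun hg => ContinuousOn.intervalIntegrable (by rwa [uIcc_of_le ht.le])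
  have hK : IsCompact (Icc (-(ε / 2)) (ε / 2) ×ˢ Icc t₀ t₁) := isCompact_Icc.prod isCompact_Icc
  have hKS : Icc (-(ε / 2)) (ε / 2) ×ˢ Icc t₀ t₁ ⊆ S :=
    prod_mono (Icc_subset_Ioo (by linarith) (by linarith)) Subset.rfl
  obtain ⟨M, hM⟩ := hK.exists_bound_of_continuousOn (hc.mono hKS)
  have key := (intervalIntegral.hasDerivAt_integral_of_dominated_loc_of_deriv_le
    (μ := volume) (a := t₀) (b := t₁) (F := fun ξ s => Φ (ξ, s))
    (F' := fun ξ s => fderivWithin ℝ Φ S (ξ, s) (1, 0)) (x₀ := (0 : ℝ))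
    (s := Ioo (-(ε / 2)) (ε / 2)) (bound := fun _ => M)
    (Ioo_mem_nhds (by linarith) (by linarith)) ?_ (hint (hsec hΦ.continuousOn 0 h0))
    (hint (hsec hc 0 h0)).aestronglyMeasurable_restrict_uIoc ?_ intervalIntegrable_const ?_).2
  · have h1 : ∫ s in t₀..t₁, D s = ∫ s in t₀..t₁, fderivWithin ℝ Φ S (0, s) (1, 0) := by
      refine intervalIntegral.integral_congr fun s hs => ?_
      rw [uIcc_of_le ht.le] at hs
      exact (hD s hs).unique (hΦ.hasDerivAt_fst h0 hs)
    rw [h1]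
    exact key
  · filter_upwards [Ioo_mem_nhds (show -ε < 0 by linarith) hε] with ξ hξ
    exact (hint (hsec hΦ.continuousOn ξ hξ)).aestronglyMeasurable_restrict_uIoc
  · exact Filter.Eventually.of_forall fun s hs ξ hξ => hM (ξ, s) ⟨Ioo_subset_Icc_self hξ, hI hs⟩
  · refine Filter.Eventually.of_forall fun s hs ξ hξ => hΦ.hasDerivAt_fst ?_ (hI hs)
    exact ⟨by linarith [hξ.1], by linarith [hξ.2]⟩

variable {Q Z : Type*} [NormedAddCommGroup Q] [NormedSpace ℝ Q]
  [NormedAddCommGroup Z] [NormedSpace ℝ Z] {G : Type*} [NormedAddCommGroup G] [NormedSpace ℝ G]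

/-- The partial derivative `∂g/∂q`. -/
def partialQ (g : ℝ × Q × Z → G) (y : ℝ × Q × Z) : Q →L[ℝ] G :=
  fderiv ℝ g y ∘L ContinuousLinearMap.inr ℝ ℝ (Q × Z) ∘L ContinuousLinearMap.inl ℝ Q Z

/-- The partial derivative `∂g/∂z`. -/
def partialZ (g : ℝ × Q × Z → G) (y : ℝ × Q × Z) : Z →L[ℝ] G :=
  fderiv ℝ g y ∘L ContinuousLinearMap.inr ℝ ℝ (Q × Z) ∘L ContinuousLinearMap.inr ℝ Q Z

theorem hasDerivAt_comp_variation {g : ℝ × Q × Z → G} (hg : ContDiff ℝ ∞ g) {s : ℝ} {X : ℝ → Q}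
    {W : ℝ → Z} {u : Q} {v : Z} (hX : HasDerivAt X u 0) (hW : HasDerivAt W v 0) :
    HasDerivAt (fun ξ => g (s, X ξ, W ξ))
      (partialQ g (s, X 0, W 0) u + partialZ g (s, X 0, W 0) v) 0 := by
  have h1 : HasDerivAt (fun ξ => (s, X ξ, W ξ)) ((0 : ℝ), u, v) 0 :=
    (hasDerivAt_const _ _).prodMk (hX.prodMk hW)
  have h2 := HasFDerivAt.comp_hasDerivAt (l := g) (0 : ℝ)
    (hg.differentiable (by simp) (s, X 0, W 0)).hasFDerivAt h1
  refine h2.congr_deriv ?_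
  have h3 : ((0 : ℝ), u, v) = ((0 : ℝ), u, (0 : Z)) + ((0 : ℝ), (0 : Q), v) := by simp
  rw [h3, map_add]
  rfl

/-- The first variation of `∫ (l + p (q' - ψ))` at a curve satisfying `q' = ψ`, under deformations
keeping the end-points of `q` fixed. The term `p q'` is integrated by parts before being
differentiated, except for the part `(p - p₀) q'`, whose derivative at `0` does not involve that of
`q'`. -/
theorem hasDerivAt_integral_lagrangian {l : ℝ × Q × Z → ℝ} {ψ : ℝ × Q × Z → Q}
    (hl : ContDiff ℝ ∞ l) (hψ : ContDiff ℝ ∞ ψ) {ε t₀ t₁ : ℝ} (hε : 0 < ε) (ht : t₀ < t₁)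
    {X : ℝ → ℝ → Q} {W : ℝ → ℝ → Z} {p : ℝ → ℝ → Q →L[ℝ] ℝ}
    (hX : ContDiffOn ℝ ∞ (fun y : ℝ × ℝ => X y.1 y.2) (Ioo (-ε) ε ×ˢ Icc t₀ t₁))
    (hW : ContDiffOn ℝ ∞ (fun y : ℝ × ℝ => W y.1 y.2) (Ioo (-ε) ε ×ˢ Icc t₀ t₁))
    (hp : ContDiffOn ℝ ∞ (fun y : ℝ × ℝ => p y.1 y.2) (Ioo (-ε) ε ×ˢ Icc t₀ t₁))
    (hl₀ : ∀ ξ ∈ Ioo (-ε) ε, X ξ t₀ = X 0 t₀) (hl₁ : ∀ ξ ∈ Ioo (-ε) ε, X ξ t₁ = X 0 t₁)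
    (hsol : ∀ s ∈ Icc t₀ t₁, derivWithin (X 0) (Icc t₀ t₁) s = ψ (s, X 0 s, W 0 s))
    {u : ℝ → Q} {v : ℝ → Z} (hu : ∀ s ∈ Icc t₀ t₁, HasDerivAt (fun ξ => X ξ s) (u s) 0)
    (hv : ∀ s ∈ Icc t₀ t₁, HasDerivAt (fun ξ => W ξ s) (v s) 0) :
    HasDerivAt (fun ξ => ∫ s in t₀..t₁, (l (s, X ξ s, W ξ s) +
        p ξ s (derivWithin (X ξ) (Icc t₀ t₁) s - ψ (s, X ξ s, W ξ s))))
      (∫ s in t₀..t₁, ((partialQ l (s, X 0 s, W 0 s) - p 0 s ∘L partialQ ψ (s, X 0 s, W 0 s) -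
          derivWithin (p 0) (Icc t₀ t₁) s) (u s) +
        (partialZ l (s, X 0 s, W 0 s) - p 0 s ∘L partialZ ψ (s, X 0 s, W 0 s)) (v s))) 0 := by
  set S := Ioo (-ε) ε ×ˢ Icc t₀ t₁ with hS
  have h0 : (0 : ℝ) ∈ Ioo (-ε) ε := ⟨by linarith, hε⟩
  have hud : UniqueDiffOn ℝ S := uniqueDiffOn_Ioo_prod_Icc ht
  have hsnd : ContDiffOn ℝ ∞ (fun y : ℝ × ℝ => y.2) S := contDiffOn_snd
  have hm0 : MapsTo (fun y : ℝ × ℝ => ((0 : ℝ), y.2)) S S := fun y hy => ⟨h0, hy.2⟩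
  -- the derivatives along the curves are jointly smooth
  have hdX : ∀ ξ ∈ Ioo (-ε) ε, ∀ s ∈ Icc t₀ t₁, HasDerivWithinAt (X ξ)
      (fderivWithin ℝ (fun y : ℝ × ℝ => X y.1 y.2) S (ξ, s) (0, 1)) (Icc t₀ t₁) s :=
    fun ξ hξ s hs => hX.hasDerivWithinAt_snd hξ hs
  have hdp : ∀ s ∈ Icc t₀ t₁, HasDerivWithinAt (p 0)
      (fderivWithin ℝ (fun y : ℝ × ℝ => p y.1 y.2) S (0, s) (0, 1)) (Icc t₀ t₁) s :=
    fun s hs => hp.hasDerivWithinAt_snd h0 hs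
  have hX' : ContDiffOn ℝ ∞ (fun y : ℝ × ℝ => derivWithin (X y.1) (Icc t₀ t₁) y.2) S := by
    have h1 : ContDiffOn ℝ ∞ (fun y => fderivWithin ℝ (fun y : ℝ × ℝ => X y.1 y.2) S y (0, 1)) S :=
      (hX.fderivWithin hud (by simp)).clm_apply contDiffOn_const
    exact h1.congr fun y hy => (hdX y.1 hy.1 y.2 hy.2).derivWithin (uniqueDiffOn_Icc ht y.2 hy.2)
  have hp' : ContDiffOn ℝ ∞ (fun y : ℝ × ℝ => derivWithin (p 0) (Icc t₀ t₁) y.2) S := by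
    have h1 : ContDiffOn ℝ ∞ (fun y => fderivWithin ℝ (fun y : ℝ × ℝ => p y.1 y.2) S y (0, 1)) S :=
      (hp.fderivWithin hud (by simp)).clm_apply contDiffOn_const
    exact (h1.comp (contDiffOn_const.prodMk hsnd) hm0).congr fun y hy =>
      (hdp y.2 hy.2).derivWithin (uniqueDiffOn_Icc ht y.2 hy.2)
  have hp0 : ContDiffOn ℝ ∞ (fun y : ℝ × ℝ => p 0 y.2) S :=
    hp.comp (contDiffOn_const.prodMk hsnd) hm0
  have hlS : ContDiffOn ℝ ∞ (fun y : ℝ × ℝ => l (y.2, X y.1 y.2, W y.1 y.2)) S :=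
    hl.comp_contDiffOn (hsnd.prodMk (hX.prodMk hW))
  have hψS : ContDiffOn ℝ ∞ (fun y : ℝ × ℝ => ψ (y.2, X y.1 y.2, W y.1 y.2)) S :=
    hψ.comp_contDiffOn (hsnd.prodMk (hX.prodMk hW))
  -- the integrand after integration by parts of `p₀ q'`
  let Φ : ℝ × ℝ → ℝ := fun y => l (y.2, X y.1 y.2, W y.1 y.2) -
    p y.1 y.2 (ψ (y.2, X y.1 y.2, W y.1 y.2)) - derivWithin (p 0) (Icc t₀ t₁) y.2 (X y.1 y.2) +
    (p y.1 y.2 - p 0 y.2) (derivWithin (X y.1) (Icc t₀ t₁) y.2)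
  have hΦ : ContDiffOn ℝ ∞ Φ S :=
    ((hlS.sub (hp.clm_apply hψS)).sub (hp'.clm_apply hX)).add ((hp.sub hp0).clm_apply hX')
  have hsec : ∀ {g : ℝ × ℝ → ℝ}, ContDiffOn ℝ ∞ g S → ∀ ξ ∈ Ioo (-ε) ε,
      IntervalIntegrable (fun s => g (ξ, s)) volume t₀ t₁ := fun {g} hg ξ hξ =>
    ContinuousOn.intervalIntegrable (by
      rw [uIcc_of_le ht.le]
      exact hg.continuousOn.comp (by fun_prop) fun s hs => ⟨hξ, hs⟩)
  have hJ : ∀ ξ ∈ Ioo (-ε) ε, ∫ s in t₀..t₁, (l (s, X ξ s, W ξ s) +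
      p ξ s (derivWithin (X ξ) (Icc t₀ t₁) s - ψ (s, X ξ s, W ξ s))) =
      (∫ s in t₀..t₁, Φ (ξ, s)) + (p 0 t₁ (X 0 t₁) - p 0 t₀ (X 0 t₀)) := by
    intro ξ hξ
    have hB : ContDiffOn ℝ ∞ (fun y : ℝ × ℝ => derivWithin (p 0) (Icc t₀ t₁) y.2 (X y.1 y.2) +
        p 0 y.2 (derivWithin (X y.1) (Icc t₀ t₁) y.2)) S :=
      (hp'.clm_apply hX).add (hp0.clm_apply hX')
    have h1 : ∫ s in t₀..t₁, (derivWithin (p 0) (Icc t₀ t₁) s (X ξ s) +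
        p 0 s (derivWithin (X ξ) (Icc t₀ t₁) s)) = p 0 t₁ (X ξ t₁) - p 0 t₀ (X ξ t₀) := by
      refine integral_eq_sub_of_hasDerivWithinAt_Icc (f := fun s => p 0 s (X ξ s)) ht.le
        (fun s hs => ?_) (hB.continuousOn.comp (f := fun s => (ξ, s)) (by fun_prop)
          fun s hs => ⟨hξ, hs⟩)
      exact ((hdp s hs).differentiableWithinAt.hasDerivWithinAt).clm_apply
        (hdX ξ hξ s hs).differentiableWithinAt.hasDerivWithinAt
    rw [← hl₀ ξ hξ, ← hl₁ ξ hξ, ← h1, ← intervalIntegral.integral_add (hsec hΦ ξ hξ)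
      (hsec hB ξ hξ)]
    refine intervalIntegral.integral_congr fun s _ => ?_
    simp only [Φ, map_sub, sub_apply]
    ring
  refine HasDerivAt.congr_of_eventuallyEq (f := fun ξ => (∫ s in t₀..t₁, Φ (ξ, s)) +
    (p 0 t₁ (X 0 t₁) - p 0 t₀ (X 0 t₀))) ?_ ?_
  · refine (hasDerivAt_integral_of_contDiffOn hε ht hΦ fun s hs => ?_).add_const _
    have h1 := hasDerivAt_comp_variation hl (s := s) (hu s hs) (hv s hs)
    have h2 := hasDerivAt_comp_variation hψ (s := s) (hu s hs) (hv s hs)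
    have h3 : HasDerivAt (fun ξ => p ξ s) _ 0 := hp.hasDerivAt_fst h0 hs
    have h4 : HasDerivAt (fun ξ => derivWithin (X ξ) (Icc t₀ t₁) s) _ 0 := hX'.hasDerivAt_fst h0 hs
    have h5 := ((h1.sub (h3.clm_apply h2)).sub
      ((hasDerivAt_const (0 : ℝ) (derivWithin (p 0) (Icc t₀ t₁) s)).clm_apply (hu s hs))).add
        ((h3.sub_const (p 0 s)).clm_apply h4)
    refine h5.congr_deriv ?_
    rw [hsol s hs]
    simp only [sub_self, zero_apply, add_zero, zero_add, sub_apply, map_add,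
      ContinuousLinearMap.comp_apply]
    ring
  · filter_upwards [Ioo_mem_nhds (show -ε < 0 by linarith) hε] with ξ hξ
    exact hJ ξ hξ

/-- The equations `p' = ∂l/∂q - p ∂ψ/∂q`, `∂l/∂z = p ∂ψ/∂z` for the momentum along `(x, z)`. -/
def IsMultiplier (l : ℝ × Q × Z → ℝ) (ψ : ℝ × Q × Z → Q) (t₀ t₁ : ℝ) (x : ℝ → Q) (z : ℝ → Z)
    (p : ℝ → Q →L[ℝ] ℝ) : Prop :=
  ∀ s ∈ Icc t₀ t₁, HasDerivWithinAt p
      (partialQ l (s, x s, z s) - p s ∘L partialQ ψ (s, x s, z s)) (Icc t₀ t₁) s ∧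
    partialZ l (s, x s, z s) - p s ∘L partialZ ψ (s, x s, z s) = 0

end FirstVariation

/-! ### Extremals of the free functional -/

namespace ConstrainedSystem.AdaptedChart

variable {E F : Type*} [NormedAddCommGroup E] [NormedSpace ℝ E] [FiniteDimensional ℝ E]
  [NormedAddCommGroup F] [NormedSpace ℝ F]
  {V : Type*} [TopologicalSpace V] [ChartedSpace E V] [IsManifold 𝓘(ℝ, E) ∞ V]
  {A : Type*} [TopologicalSpace A] [ChartedSpace F A] [IsManifold 𝓘(ℝ, F) ∞ A]
  {S : ConstrainedSystem E F V A}
  {Q Z : Type} [NormedAddCommGroup Q] [NormedSpace ℝ Q] [FiniteDimensional ℝ Q]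
  [NormedAddCommGroup Z] [NormedSpace ℝ Z] [FiniteDimensional ℝ Z]
  (C : S.AdaptedChart Q Z) {t₀ t₁ : ℝ}

theorem form_apply_of_frame {w : S.ContactBundle} {p : Q →L[ℝ] ℝ} (hw : w = C.contactPoint w.pt p)
    {v : E} {r : Q} (hv : C.frame w.base v = (1, r)) :
    (w.form : E →L[ℝ] ℝ) v = p (r - C.slope w.pt) := by
  obtain ⟨b, φ, hφ⟩ := w
  have h1 : φ = C.contactForm b p := by
    injection hw with _ h
  have h2 : vecDeriv E S.time (S.proj b) v = 1 := congrArg Prod.fst hv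
  have h3 : vecDeriv E C.q (S.proj b) v = r := congrArg Prod.snd hv
  subst h1
  refine (C.contactForm_apply b p v).trans ?_
  rw [h2, h3, mul_one, map_sub]

/-- A point of `A` is determined by its projection and its slope, as `i` is injective. -/
theorem eq_of_slope_eq {b b' : A} (hb : S.proj b ∈ C.eV.source) (h : S.proj b = S.proj b')
    (hs : C.slope b = C.slope b') : b = b' := by
  have h1 : C.frame (S.proj b) (S.incl b).2 = C.frame (S.proj b) (S.incl b').2 := by
    rw [C.frame_incl]
    conv_rhs => rw [h]
    rw [C.frame_incl, hs]
  have h2 := C.injective_frame hb h1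
  have h3 : ∀ w w' : TangentBundle 𝓘(ℝ, E) V, w.proj = w'.proj →
      (w.2 : E) = (w'.2 : E) → w = w' := by
    rintro ⟨x, v⟩ ⟨x', v'⟩ hx hv
    obtain rfl : x = x' := hx
    obtain rfl : v = v' := hv
    rfl
  exact S.isEmbedding_incl.injective (h3 _ _ h h2)

theorem _root_.ConstrainedSystem.IsFreeSection.contMDiffOn_base {c : ℝ → S.ContactBundle}
    (hc : S.IsFreeSection t₀ t₁ c) :
    ContMDiffOn 𝓘(ℝ, ℝ) 𝓘(ℝ, E) ∞ (fun s => (c s).base) (Icc t₀ t₁) :=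
  S.contMDiff_proj.comp_contMDiffOn hc.smoothOn.1

theorem derivWithin_q_eq_slope (ht : t₀ < t₁) {a : ℝ → A} (ha : S.IsAdmissible t₀ t₁ a) {s : ℝ}
    (hs : s ∈ Icc t₀ t₁) :
    derivWithin (fun s => C.q (S.proj (a s))) (Icc t₀ t₁) s = C.slope (a s) := by
  have h1 := C.frame_velocity ha.isSection.contMDiffOn ht ha.isSection.time_eq hs
  rw [ha.jet_eq s hs] at h1
  exact (congrArg Prod.snd ((C.frame_incl (a s)).symm.trans h1)).symm

/-- In coordinates, a section of `A` is admissible if and only if `q' = ψ`; this is the converse of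
`derivWithin_q_eq_slope`. -/
theorem isAdmissible_of_slope (ht : t₀ < t₁) {a : ℝ → A}
    (ha : ContMDiffOn 𝓘(ℝ, ℝ) 𝓘(ℝ, F) ∞ a (Icc t₀ t₁))
    (hat : ∀ s ∈ Icc t₀ t₁, S.time (S.proj (a s)) = s)
    (hV : ∀ s ∈ Icc t₀ t₁, S.proj (a s) ∈ C.eV.source)
    (h : ∀ s ∈ Icc t₀ t₁,
      derivWithin (fun s => C.q (S.proj (a s))) (Icc t₀ t₁) s = C.slope (a s)) :
    S.IsAdmissible t₀ t₁ a := by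
  have hπ := S.contMDiff_proj.comp_contMDiffOn ha
  refine ⟨ha, ⟨hπ, hat⟩, fun s hs => C.injective_frame (hV s hs) ?_⟩
  have h1 := C.frame_velocity hπ ht hat hs
  refine h1.trans (Eq.trans ?_ (C.frame_incl (a s)).symm)
  exact Prod.ext rfl (h s hs)

/-- The free action of a section is `∫ (L + p (q' - ψ))`. -/
theorem freeAction_eq (ht : t₀ < t₁) (L : A → ℝ) {c : ℝ → S.ContactBundle}
    (hc : S.IsFreeSection t₀ t₁ c) {p : ℝ → Q →L[ℝ] ℝ}
    (hp : ∀ s ∈ Icc t₀ t₁, c s = C.contactPoint (c s).pt (p s)) :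
    freeAction L t₀ t₁ c = ∫ s in t₀..t₁, (L (c s).pt +
      p s (derivWithin (fun s => C.q (c s).base) (Icc t₀ t₁) s - C.slope (c s).pt)) := by
  refine intervalIntegral.integral_congr fun s hs => ?_
  rw [uIcc_of_le ht.le] at hs
  have h1 := C.frame_velocity hc.contMDiffOn_base ht hc.time_eq hs
  exact congrArg (L (c s).pt + ·) (C.form_apply_of_frame (hp s hs) h1)

theorem eA_pt {c : ℝ → S.ContactBundle} (hc : S.IsFreeSection t₀ t₁ c) {s : ℝ}
    (hs : s ∈ Icc t₀ t₁) : C.eA (c s).pt = (s, C.q (c s).base, C.z (c s).pt) := by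
  rw [C.eA_apply]
  exact Prod.ext (hc.time_eq s hs) rfl

theorem slope_eq {c : ℝ → S.ContactBundle} (hc : S.IsFreeSection t₀ t₁ c) {s : ℝ}
    (hs : s ∈ Icc t₀ t₁) (hA : (c s).pt ∈ C.eA.source) :
    C.slope (c s).pt = C.ψ (s, C.q (c s).base, C.z (c s).pt) := by
  rw [← C.eA_pt hc hs]
  exact (C.ψ_eA _ hA).symm

/-- `freeAction_eq` with `L` and the constraint replaced by their coordinate expressions. -/
theorem freeAction_eq_coord (ht : t₀ < t₁) {L : A → ℝ} {l : ℝ × Q × Z → ℝ}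
    (hlL : ∀ b ∈ C.eA.source, l (C.eA b) = L b) {c : ℝ → S.ContactBundle}
    (hc : S.IsFreeSection t₀ t₁ c) {p : ℝ → Q →L[ℝ] ℝ}
    (hp : ∀ s ∈ Icc t₀ t₁, c s = C.contactPoint (c s).pt (p s))
    (hA : ∀ s ∈ Icc t₀ t₁, (c s).pt ∈ C.eA.source) :
    freeAction L t₀ t₁ c = ∫ s in t₀..t₁, (l (s, C.q (c s).base, C.z (c s).pt) +
      p s (derivWithin (fun s => C.q (c s).base) (Icc t₀ t₁) s -
        C.ψ (s, C.q (c s).base, C.z (c s).pt))) := by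
  rw [C.freeAction_eq ht L hc hp]
  refine intervalIntegral.integral_congr fun s hs => ?_
  rw [uIcc_of_le ht.le] at hs
  have h1 := hlL _ (hA s hs)
  rw [C.eA_pt hc hs] at h1
  simp only [C.slope_eq hc hs (hA s hs), h1]

/-- The first variation vanishes along a section satisfying `q' = ψ` whose momentum is a multiplier.
A deformation stays in the domain of the coordinates for small values of its parameter. -/
theorem isFreeExtremal_of_isMultiplier (ht : t₀ < t₁) {L : A → ℝ} {l : ℝ × Q × Z → ℝ}
    (hl : ContDiff ℝ ∞ l) (hlL : ∀ b ∈ C.eA.source, l (C.eA b) = L b) {c : ℝ → S.ContactBundle}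
    (hc : S.IsFreeSection t₀ t₁ c) (hV : ∀ s ∈ Icc t₀ t₁, (c s).base ∈ C.eV.source)
    (hA : ∀ s ∈ Icc t₀ t₁, (c s).pt ∈ C.eA.source)
    (hsol : ∀ s ∈ Icc t₀ t₁,
      derivWithin (fun s => C.q (c s).base) (Icc t₀ t₁) s = C.slope (c s).pt)
    (hm : IsMultiplier l C.ψ t₀ t₁ (fun s => C.q (c s).base) (fun s => C.z (c s).pt)
      fun s => C.momentum (c s)) : S.IsFreeExtremal L t₀ t₁ c := by
  refine ⟨hc, fun ε G hε hG => ?_⟩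
  have hbase : ContMDiffOn 𝓘(ℝ, ℝ × ℝ) 𝓘(ℝ, E) ∞ (fun y : ℝ × ℝ => (G y.1 y.2).base)
      (Ioo (-ε) ε ×ˢ Icc t₀ t₁) := S.contMDiff_proj.comp_contMDiffOn hG.smoothOn.1
  obtain ⟨δ₁, hδ₁, hδ₁ε, h1⟩ := hbase.continuousOn.eventually_forall_Icc_mem hε C.eV.open_source
    fun s hs => by
      change (G 0 s).base ∈ _
      rw [hG.zero_eq s hs]
      exact hV s hs
  obtain ⟨δ₂, hδ₂, hδ₂ε, h2⟩ := hG.smoothOn.1.continuousOn.eventually_forall_Icc_mem hε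
    C.eA.open_source fun s hs => by
      change (G 0 s).pt ∈ _
      rw [hG.zero_eq s hs]
      exact hA s hs
  set δ := min δ₁ δ₂ with hδdef
  have hδ : 0 < δ := lt_min hδ₁ hδ₂
  have hs₁ : Ioo (-δ) δ ⊆ Ioo (-δ₁) δ₁ :=
    Ioo_subset_Ioo (neg_le_neg (min_le_left _ _)) (min_le_left _ _)
  have hs₂ : Ioo (-δ) δ ⊆ Ioo (-δ₂) δ₂ :=
    Ioo_subset_Ioo (neg_le_neg (min_le_right _ _)) (min_le_right _ _)
  have hsε : Ioo (-δ) δ ⊆ Ioo (-ε) ε := hs₁.trans (Ioo_subset_Ioo (neg_le_neg hδ₁ε) hδ₁ε)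
  have hsub : Ioo (-δ) δ ×ˢ Icc t₀ t₁ ⊆ Ioo (-ε) ε ×ˢ Icc t₀ t₁ := prod_mono hsε Subset.rfl
  have h0 : (0 : ℝ) ∈ Ioo (-ε) ε := ⟨by linarith, hε⟩
  have h0δ : (0 : ℝ) ∈ Ioo (-δ) δ := ⟨by linarith, hδ⟩
  have hX : ContDiffOn ℝ ∞ (fun y : ℝ × ℝ => C.q (G y.1 y.2).base) (Ioo (-δ) δ ×ˢ Icc t₀ t₁) :=
    (C.contMDiff_q.comp_contMDiffOn (hbase.mono hsub)).contDiffOn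
  have hW : ContDiffOn ℝ ∞ (fun y : ℝ × ℝ => C.z (G y.1 y.2).pt) (Ioo (-δ) δ ×ˢ Icc t₀ t₁) :=
    (C.contMDiff_z.comp_contMDiffOn (hG.smoothOn.1.mono hsub)).contDiffOn
  have hp : ContDiffOn ℝ ∞ (fun y : ℝ × ℝ => C.momentum (G y.1 y.2)) (Ioo (-δ) δ ×ˢ Icc t₀ t₁) :=
    C.contDiffOn_momentum ⟨hG.smoothOn.1.mono hsub, hG.smoothOn.2.mono hsub⟩
      fun y hy => h1 y.1 (hs₁ hy.1) y.2 hy.2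
  have h00 : ∀ {B : Type} [NormedAddCommGroup B] [NormedSpace ℝ B] (f : S.ContactBundle → B),
      ∀ s ∈ Icc t₀ t₁, derivWithin (fun s => f (G 0 s)) (Icc t₀ t₁) s =
        derivWithin (fun s => f (c s)) (Icc t₀ t₁) s := fun f s hs =>
    derivWithin_congr (fun s hs => by rw [hG.zero_eq s hs]) (by rw [hG.zero_eq s hs])
  have key := hasDerivAt_integral_lagrangian hl C.contDiff_ψ hδ ht
    (X := fun ξ s => C.q (G ξ s).base) (W := fun ξ s => C.z (G ξ s).pt)
    (p := fun ξ s => C.momentum (G ξ s)) hX hW hp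
    (fun ξ hξ => by rw [hG.left_eq ξ (hsε hξ), hG.left_eq 0 h0])
    (fun ξ hξ => by rw [hG.right_eq ξ (hsε hξ), hG.right_eq 0 h0])
    (fun s hs => by
      rw [h00 (fun w => C.q w.base) s hs, hG.zero_eq s hs, hsol s hs, C.slope_eq hc hs (hA s hs)])
    (fun s hs => hX.hasDerivAt_fst h0δ hs) (fun s hs => hW.hasDerivAt_fst h0δ hs)
  have hzero : ∀ (u : ℝ → Q) (v : ℝ → Z), ∫ s in t₀..t₁,
      ((partialQ l (s, C.q (G 0 s).base, C.z (G 0 s).pt) - C.momentum (G 0 s) ∘L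
          partialQ C.ψ (s, C.q (G 0 s).base, C.z (G 0 s).pt) -
          derivWithin (fun s => C.momentum (G 0 s)) (Icc t₀ t₁) s) (u s) +
        (partialZ l (s, C.q (G 0 s).base, C.z (G 0 s).pt) - C.momentum (G 0 s) ∘L
          partialZ C.ψ (s, C.q (G 0 s).base, C.z (G 0 s).pt)) (v s)) = 0 := by
    intro u v
    refine intervalIntegral.integral_zero_ae (Filter.Eventually.of_forall fun s hs => ?_)
    rw [uIoc_of_le ht.le] at hs
    have hs' := Ioc_subset_Icc_self hs
    obtain ⟨e1, e2⟩ := hm s hs'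
    rw [h00 C.momentum s hs', hG.zero_eq s hs', e1.derivWithin (uniqueDiffOn_Icc ht s hs'), e2,
      sub_self, zero_apply, zero_apply, add_zero]
  refine (key.congr_deriv (hzero _ _)).congr_of_eventuallyEq ?_
  filter_upwards [Ioo_mem_nhds (show -δ < 0 by linarith) hδ] with ξ hξ
  exact C.freeAction_eq_coord ht hlL (hG.isFreeSection ξ (hsε hξ))
    (fun s hs => (C.contactPoint_momentum (h1 ξ (hs₁ hξ) s hs)).symm)
    fun s hs => h2 ξ (hs₂ hξ) s hs

/-- Extremals of the free functional are admissible: the action is affine in the momentum, which can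
be varied freely, with `q' - ψ` as its coefficient. -/
theorem derivWithin_q_eq_slope_of_isFreeExtremal (ht : t₀ < t₁) {L : A → ℝ}
    (hL : ContMDiff 𝓘(ℝ, F) 𝓘(ℝ, ℝ) ∞ L) {c : ℝ → S.ContactBundle}
    (hc : S.IsFreeExtremal L t₀ t₁ c) (hV : ∀ s ∈ Icc t₀ t₁, (c s).base ∈ C.eV.source) :
    ∀ s ∈ Icc t₀ t₁,
      derivWithin (fun s => C.q (c s).base) (Icc t₀ t₁) s = C.slope (c s).pt := by
  obtain ⟨hcs, hext⟩ := hc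
  have hp : ContDiffOn ℝ ∞ (fun s => C.momentum (c s)) (Icc t₀ t₁) :=
    C.contDiffOn_momentum hcs.smoothOn hV
  have hq : ContDiffOn ℝ ∞ (fun s => C.q (c s).base) (Icc t₀ t₁) :=
    (C.contMDiff_q.comp_contMDiffOn hcs.contMDiffOn_base).contDiffOn
  let U : ℝ → Q := fun s =>
    derivWithin (fun s => C.q (c s).base) (Icc t₀ t₁) s - C.slope (c s).pt
  have hU : ContinuousOn U (Icc t₀ t₁) :=
    (hq.continuousOn_derivWithin (uniqueDiffOn_Icc ht) (by simp)).sub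
      (C.contMDiff_slope.comp_contMDiffOn hcs.smoothOn.1).continuousOn
  have hLc : ContinuousOn (fun s => L (c s).pt) (Icc t₀ t₁) :=
    (hL.comp_contMDiffOn hcs.smoothOn.1).continuousOn
  have hint : ∀ {g : ℝ → ℝ}, ContinuousOn g (Icc t₀ t₁) → IntervalIntegrable g volume t₀ t₁ :=
    fun hg => ContinuousOn.intervalIntegrable (by rwa [uIcc_of_le ht.le])
  have key : ∀ lam : Q →L[ℝ] ℝ, ∀ s ∈ Icc t₀ t₁, lam (U s) = 0 := by
    intro lam
    refine eqOn_zero_of_forall_integral_smul_eq_zero ht (lam.continuous.comp_continuousOn hU)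
      fun χ hχ _ _ => ?_
    -- only the momentum is varied, by `ξ χ lam`
    let G : ℝ → ℝ → S.ContactBundle := fun ξ s =>
      C.contactPoint (c s).pt (C.momentum (c s) + (ξ * χ s) • lam)
    have hGs : ∀ ξ, S.IsFreeSection t₀ t₁ (G ξ) := fun ξ =>
      ⟨C.smoothOn_contactPoint hcs.smoothOn.1 (hp.add
        ((contDiff_const.mul hχ).contDiffOn.smul contDiffOn_const)), hcs.time_eq⟩
    have hG : S.IsFreeDeformation t₀ t₁ c 1 G := by
      refine ⟨?_, fun ξ _ => hGs ξ, fun s hs => ?_, fun _ _ => rfl, fun _ _ => rfl⟩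
      · have hm : MapsTo (Prod.snd : ℝ × ℝ → ℝ) (Ioo (-1) 1 ×ˢ Icc t₀ t₁) (Icc t₀ t₁) :=
          fun y hy => hy.2
        refine C.smoothOn_contactPoint (hcs.smoothOn.1.comp contDiffOn_snd.contMDiffOn hm)
          ((hp.comp contDiffOn_snd hm).add ?_)
        exact ((contDiff_fst.mul (hχ.comp contDiff_snd)).smul contDiff_const).contDiffOn
      · simp only [G, zero_mul, zero_smul, add_zero]
        exact C.contactPoint_momentum (hV s hs)
    have hact : ∀ ξ, freeAction L t₀ t₁ (G ξ) =
        (∫ s in t₀..t₁, (L (c s).pt + C.momentum (c s) (U s))) +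
          ξ * ∫ s in t₀..t₁, χ s * lam (U s) := fun ξ => by
      rw [C.freeAction_eq ht L (hGs ξ) (p := fun s => C.momentum (c s) + (ξ * χ s) • lam)
        fun s _ => rfl, ← intervalIntegral.integral_const_mul, ← intervalIntegral.integral_add]
      · refine intervalIntegral.integral_congr fun s _ => ?_
        change L (c s).pt + (C.momentum (c s) + (ξ * χ s) • lam) (U s) = _
        simp only [add_apply, smul_apply, smul_eq_mul]
        ring
      · exact hint (hLc.add (hp.continuousOn.clm_apply hU))
      · exact hint (continuousOn_const.mul
          (hχ.continuous.continuousOn.mul (lam.continuous.comp_continuousOn hU)))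
    have h1 := hext 1 G one_pos hG
    simp only [hact] at h1
    have h2 := ((hasDerivAt_id (0 : ℝ)).mul_const (∫ s in t₀..t₁, χ s * lam (U s))).const_add
      (∫ s in t₀..t₁, (L (c s).pt + C.momentum (c s) (U s)))
    have h3 := h2.unique h1
    rwa [one_mul] at h3
  intro s hs
  exact sub_eq_zero.1
    (SeparatingDual.eq_zero_of_forall_dual_eq_zero (R := ℝ) fun lam => key lam s hs)

/-- The component in `A` of a free extremal over an admissible curve is the lift of that curve. -/
theorem pt_eq_of_isFreeExtremal (ht : t₀ < t₁) {L : A → ℝ}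
    (hL : ContMDiff 𝓘(ℝ, F) 𝓘(ℝ, ℝ) ∞ L) {c : ℝ → S.ContactBundle}
    (hc : S.IsFreeExtremal L t₀ t₁ c) {a : ℝ → A} (ha : S.IsAdmissible t₀ t₁ a)
    (hV : ∀ s ∈ Icc t₀ t₁, S.proj (a s) ∈ C.eV.source)
    (hca : ∀ s ∈ Icc t₀ t₁, (c s).base = S.proj (a s)) : ∀ s ∈ Icc t₀ t₁, (c s).pt = a s := by
  intro s hs
  refine C.eq_of_slope_eq (by have := hV s hs; rwa [← hca s hs] at this) (hca s hs) ?_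
  rw [← C.derivWithin_q_eq_slope_of_isFreeExtremal ht hL hc
    (fun s hs => by rw [hca s hs]; exact hV s hs) s hs, ← C.derivWithin_q_eq_slope ht ha hs]
  exact derivWithin_congr (fun s hs => by rw [hca s hs]) (by rw [hca s hs])

/-- Varying `q` and `z` with the momentum held fixed shows that the momentum of a free extremal is a
multiplier. -/
theorem isMultiplier_of_isFreeExtremal (ht : t₀ < t₁) {L : A → ℝ}
    (hL : ContMDiff 𝓘(ℝ, F) 𝓘(ℝ, ℝ) ∞ L) {l : ℝ × Q × Z → ℝ}
    (hl : ContDiff ℝ ∞ l) (hlL : ∀ b ∈ C.eA.source, l (C.eA b) = L b) {c : ℝ → S.ContactBundle}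
    (hc : S.IsFreeExtremal L t₀ t₁ c) (hV : ∀ s ∈ Icc t₀ t₁, (c s).base ∈ C.eV.source)
    (hA : ∀ s ∈ Icc t₀ t₁, (c s).pt ∈ C.eA.source) :
    IsMultiplier l C.ψ t₀ t₁ (fun s => C.q (c s).base) (fun s => C.z (c s).pt)
      fun s => C.momentum (c s) := by
  have hsol := C.derivWithin_q_eq_slope_of_isFreeExtremal ht hL hc hV
  obtain ⟨hcs, hext⟩ := hc
  have hp : ContDiffOn ℝ ∞ (fun s => C.momentum (c s)) (Icc t₀ t₁) :=
    C.contDiffOn_momentum hcs.smoothOn hV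
  have hq : ContDiffOn ℝ ∞ (fun s => C.q (c s).base) (Icc t₀ t₁) :=
    (C.contMDiff_q.comp_contMDiffOn hcs.contMDiffOn_base).contDiffOn
  have hz : ContDiffOn ℝ ∞ (fun s => C.z (c s).pt) (Icc t₀ t₁) :=
    (C.contMDiff_z.comp_contMDiffOn hcs.smoothOn.1).contDiffOn
  set x : ℝ → Q := fun s => C.q (c s).base with hx
  set z : ℝ → Z := fun s => C.z (c s).pt with hzdef
  set p : ℝ → Q →L[ℝ] ℝ := fun s => C.momentum (c s) with hpdef
  let P : ℝ → Q →L[ℝ] ℝ := fun s => partialQ l (s, x s, z s) - p s ∘L partialQ C.ψ (s, x s, z s) -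
    derivWithin p (Icc t₀ t₁) s
  let R : ℝ → Z →L[ℝ] ℝ := fun s => partialZ l (s, x s, z s) - p s ∘L partialZ C.ψ (s, x s, z s)
  have hcurve : ContinuousOn (fun s => (s, x s, z s)) (Icc t₀ t₁) :=
    continuousOn_id.prodMk (hq.continuousOn.prodMk hz.continuousOn)
  have hDl := (hl.continuous_fderiv (by simp)).comp_continuousOn hcurve
  have hDψ := (C.contDiff_ψ.continuous_fderiv (by simp)).comp_continuousOn hcurve
  have hP : ContinuousOn P (Icc t₀ t₁) :=
    ((hDl.clm_comp continuousOn_const).sub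
      (hp.continuousOn.clm_comp (hDψ.clm_comp continuousOn_const))).sub
        (hp.continuousOn_derivWithin (uniqueDiffOn_Icc ht) (by simp))
  have hR : ContinuousOn R (Icc t₀ t₁) :=
    (hDl.clm_comp continuousOn_const).sub
      (hp.continuousOn.clm_comp (hDψ.clm_comp continuousOn_const))
  have key : ∀ (u : Q) (v : Z), ∀ s ∈ Icc t₀ t₁, P s u + R s v = 0 := by
    intro u v
    refine eqOn_zero_of_forall_integral_smul_eq_zero ht
      ((hP.clm_apply continuousOn_const).add (hR.clm_apply continuousOn_const))
        fun χ hχ _ hχs => ?_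
    have hχ₀ : χ t₀ = 0 := image_eq_zero_of_notMem_tsupport fun h => lt_irrefl _ (hχs h).1
    have hχ₁ : χ t₁ = 0 := image_eq_zero_of_notMem_tsupport fun h => lt_irrefl _ (hχs h).2
    -- `q` and `z` are varied, and the momentum is kept
    let X : ℝ → ℝ → Q := fun ξ s => x s + (ξ * χ s) • u
    let W : ℝ → ℝ → Z := fun ξ s => z s + (ξ * χ s) • v
    have hm : ∀ ε : ℝ, MapsTo (Prod.snd : ℝ × ℝ → ℝ) (Ioo (-ε) ε ×ˢ Icc t₀ t₁) (Icc t₀ t₁) :=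
      fun ε y hy => hy.2
    have hξχ : ContDiff ℝ ∞ fun y : ℝ × ℝ => y.1 * χ y.2 :=
      contDiff_fst.mul (hχ.comp contDiff_snd)
    have hX : ∀ ε : ℝ, ContDiffOn ℝ ∞ (fun y : ℝ × ℝ => X y.1 y.2) (Ioo (-ε) ε ×ˢ Icc t₀ t₁) :=
      fun ε => (hq.comp contDiffOn_snd (hm ε)).add (hξχ.smul contDiff_const).contDiffOn
    have hW : ∀ ε : ℝ, ContDiffOn ℝ ∞ (fun y : ℝ × ℝ => W y.1 y.2) (Ioo (-ε) ε ×ˢ Icc t₀ t₁) :=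
      fun ε => (hz.comp contDiffOn_snd (hm ε)).add (hξχ.smul contDiff_const).contDiffOn
    have hX0 : ∀ s, X 0 s = x s := fun s => by simp [X]
    have hW0 : ∀ s, W 0 s = z s := fun s => by simp [W]
    have hY : ∀ ε : ℝ, ContDiffOn ℝ ∞ (fun y : ℝ × ℝ => (y.2, X y.1 y.2, W y.1 y.2))
        (Ioo (-ε) ε ×ˢ Icc t₀ t₁) := fun ε => contDiffOn_snd.prodMk ((hX ε).prodMk (hW ε))
    obtain ⟨ε, hε, -, hmem⟩ := (hY 1).continuousOn.eventually_forall_Icc_mem one_pos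
      C.eA.open_target fun s hs => by
        change (s, X 0 s, W 0 s) ∈ _
        rw [hX0, hW0, ← C.eA_pt hcs hs]
        exact C.eA.map_source (hA s hs)
    let b : ℝ → ℝ → A := fun ξ s => C.eA.symm (s, X ξ s, W ξ s)
    have hb : ∀ ξ ∈ Ioo (-ε) ε, ∀ s ∈ Icc t₀ t₁, b ξ s ∈ C.eA.source ∧
        S.time (S.proj (b ξ s)) = s ∧ C.q (S.proj (b ξ s)) = X ξ s ∧ C.z (b ξ s) = W ξ s := by
      intro ξ hξ s hs
      have h1 := C.eA.right_inv (hmem ξ hξ s hs)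
      rw [C.eA_apply] at h1
      exact ⟨C.eA.map_target (hmem ξ hξ s hs), congrArg Prod.fst h1, congrArg (fun y => y.2.1) h1,
        congrArg (fun y => y.2.2) h1⟩
    have hbend : ∀ ξ s, s ∈ Icc t₀ t₁ → χ s = 0 → b ξ s = (c s).pt := fun ξ s hs h => by
      have h1 : (s, X ξ s, W ξ s) = C.eA (c s).pt := by
        rw [C.eA_pt hcs hs]
        simp [X, W, h, hx, hzdef]
      simp only [b, h1, C.eA.left_inv (hA s hs)]
    have hb0 : ∀ s ∈ Icc t₀ t₁, b 0 s = (c s).pt := fun s hs => by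
      simp only [b, hX0, hW0, hx, hzdef]
      rw [← C.eA_pt hcs hs, C.eA.left_inv (hA s hs)]
    have hbs : ContMDiffOn 𝓘(ℝ, ℝ × ℝ) 𝓘(ℝ, F) ∞ (fun y : ℝ × ℝ => b y.1 y.2)
        (Ioo (-ε) ε ×ˢ Icc t₀ t₁) :=
      C.contMDiffOn_eA_symm.comp (hY ε).contMDiffOn fun y hy => hmem y.1 hy.1 y.2 hy.2
    have hG : S.IsFreeDeformation t₀ t₁ c ε fun ξ s => C.contactPoint (b ξ s) (p s) := by
      refine ⟨C.smoothOn_contactPoint hbs (hp.comp contDiffOn_snd (hm ε)), fun ξ hξ => ⟨?_,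
        fun s hs => (hb ξ hξ s hs).2.1⟩, fun s hs => ?_, fun ξ _ => ?_, fun ξ _ => ?_⟩
      · refine C.smoothOn_contactPoint ?_ hp
        exact hbs.comp (contDiff_const.prodMk contDiff_id).contMDiff.contMDiffOn
          fun s hs => ⟨hξ, hs⟩
      · rw [hb0 s hs]
        exact C.contactPoint_momentum (hV s hs)
      · exact congrArg S.proj (hbend ξ t₀ (left_mem_Icc.2 ht.le) hχ₀)
      · exact congrArg S.proj (hbend ξ t₁ (right_mem_Icc.2 ht.le) hχ₁)
    have hdξ : ∀ (s : ℝ) {B : Type} [NormedAddCommGroup B] [NormedSpace ℝ B] (y w : B),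
        HasDerivAt (fun ξ : ℝ => y + (ξ * χ s) • w) (χ s • w) 0 := fun s _ _ _ y w => by
      simpa using (((hasDerivAt_id (0 : ℝ)).mul_const (χ s)).smul_const w).const_add y
    have hdX : ∀ ξ, ξ = 0 → ∀ s, derivWithin (X ξ) (Icc t₀ t₁) s = derivWithin x (Icc t₀ t₁) s :=
      fun ξ hξ s => by rw [hξ, funext hX0]
    have h1 := hasDerivAt_integral_lagrangian hl C.contDiff_ψ hε ht (X := X) (W := W)
      (p := fun _ => p) (hX ε) (hW ε) (hp.comp contDiffOn_snd (hm ε))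
      (fun ξ _ => by simp only [X, hχ₀, mul_zero, zero_smul])
      (fun ξ _ => by simp only [X, hχ₁, mul_zero, zero_smul])
      (fun s hs => by
        rw [hdX 0 rfl, hX0, hW0, hsol s hs, C.slope_eq hcs hs (hA s hs)])
      (u := fun s => χ s • u) (v := fun s => χ s • v)
      (fun s _ => hdξ s (x s) u) (fun s _ => hdξ s (z s) v)
    have h2 := hext ε _ hε hG
    have h3 : HasDerivAt (fun ξ => ∫ s in t₀..t₁, (l (s, X ξ s, W ξ s) +
        p s (derivWithin (X ξ) (Icc t₀ t₁) s - C.ψ (s, X ξ s, W ξ s)))) 0 0 := by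
      refine h2.congr_of_eventuallyEq ?_
      filter_upwards [Ioo_mem_nhds (show -ε < 0 by linarith) hε] with ξ hξ
      rw [C.freeAction_eq_coord ht hlL (hG.isFreeSection ξ hξ) (p := p) (fun s _ => rfl)
        fun s hs => (hb ξ hξ s hs).1]
      refine intervalIntegral.integral_congr fun s hs => ?_
      rw [uIcc_of_le ht.le] at hs
      have e1 : derivWithin (fun s => C.q (S.proj (b ξ s))) (Icc t₀ t₁) s =
          derivWithin (X ξ) (Icc t₀ t₁) s :=
        derivWithin_congr (fun s hs => (hb ξ hξ s hs).2.2.1) (hb ξ hξ s hs).2.2.1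
      change _ = l (s, C.q (S.proj (b ξ s)), C.z (b ξ s)) +
        p s (derivWithin (fun s => C.q (S.proj (b ξ s))) (Icc t₀ t₁) s -
          C.ψ (s, C.q (S.proj (b ξ s)), C.z (b ξ s)))
      rw [e1, (hb ξ hξ s hs).2.2.1, (hb ξ hξ s hs).2.2.2]
    rw [← h1.unique h3]
    refine intervalIntegral.integral_congr fun s _ => ?_
    simp only [hX0, hW0, map_smul, smul_eq_mul, P, R]
    ring
  intro s hs
  have hPs : P s = 0 := by
    ext u
    simpa using key u 0 s hs
  have hRs : R s = 0 := by
    ext v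
    simpa using key 0 v s hs
  refine ⟨?_, hRs⟩
  rw [show partialQ l (s, x s, z s) - p s ∘L partialQ C.ψ (s, x s, z s) =
    derivWithin p (Icc t₀ t₁) s from sub_eq_zero.1 hPs]
  exact ((hp s hs).differentiableWithinAt (by simp)).hasDerivWithinAt

end ConstrainedSystem.AdaptedChart

/-! ### Multipliers -/

section Multiplier

variable {Q Z : Type} [NormedAddCommGroup Q] [NormedSpace ℝ Q] [FiniteDimensional ℝ Q]
  [NormedAddCommGroup Z] [NormedSpace ℝ Z] [FiniteDimensional ℝ Z]
  {l : ℝ × Q × Z → ℝ} {ψ : ℝ × Q × Z → Q} {t₀ t₁ : ℝ} {x x' : ℝ → Q} {z z' : ℝ → Z}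
  {p p' : ℝ → Q →L[ℝ] ℝ}

theorem partialQ_zero (y : ℝ × Q × Z) : partialQ (fun _ : ℝ × Q × Z => (0 : ℝ)) y = 0 := by
  simp [partialQ]

theorem partialZ_zero (y : ℝ × Q × Z) : partialZ (fun _ : ℝ × Q × Z => (0 : ℝ)) y = 0 := by
  simp [partialZ]

theorem IsMultiplier.congr (h : IsMultiplier l ψ t₀ t₁ x z p) (hx : EqOn x' x (Icc t₀ t₁))
    (hz : EqOn z' z (Icc t₀ t₁)) (hp : EqOn p' p (Icc t₀ t₁)) :
    IsMultiplier l ψ t₀ t₁ x' z' p' := by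
  intro s hs
  rw [hx hs, hz hs, hp hs]
  exact ⟨(h s hs).1.congr hp (hp hs), (h s hs).2⟩

/-- The multiplier equations are affine in the momentum, and the Lagrangian is their inhomogeneous
term. -/
theorem IsMultiplier.sub (h : IsMultiplier l ψ t₀ t₁ x z p) (h' : IsMultiplier l ψ t₀ t₁ x z p') :
    IsMultiplier (fun _ => 0) ψ t₀ t₁ x z (p - p') := by
  intro s hs
  obtain ⟨h1, h2⟩ := h s hs
  obtain ⟨h3, h4⟩ := h' s hs
  refine ⟨(h1.sub h3).congr_deriv ?_, ?_⟩
  · rw [partialQ_zero, Pi.sub_apply, ContinuousLinearMap.sub_comp]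
    abel
  · rw [partialZ_zero, Pi.sub_apply, ContinuousLinearMap.sub_comp, ← sub_eq_zero.1 h2,
      ← sub_eq_zero.1 h4]
    abel

/-- Multipliers along smooth curves are smooth, as solutions of a linear differential equation with
smooth coefficients. -/
theorem IsMultiplier.contDiffOn (h : IsMultiplier l ψ t₀ t₁ x z p) (hl : ContDiff ℝ ∞ l)
    (hψ : ContDiff ℝ ∞ ψ) (hx : ContDiffOn ℝ ∞ x (Icc t₀ t₁)) (hz : ContDiffOn ℝ ∞ z (Icc t₀ t₁)) :
    ContDiffOn ℝ ∞ p (Icc t₀ t₁) := by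
  have hc : ContDiffOn ℝ ∞ (fun y : ℝ × (Q →L[ℝ] ℝ) => (y.1, x y.1, z y.1))
      (Icc t₀ t₁ ×ˢ univ) :=
    contDiffOn_fst.prodMk ((hx.comp contDiffOn_fst fun y hy => hy.1).prodMk
      (hz.comp contDiffOn_fst fun y hy => hy.1))
  have hQ : ∀ {G : Type} [NormedAddCommGroup G] [NormedSpace ℝ G] {g : ℝ × Q × Z → G},
      ContDiff ℝ ∞ g → ContDiff ℝ ∞ (partialQ g) := fun hg =>
    (hg.fderiv_right (m := ∞) (by simp)).clm_comp contDiff_const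
  refine ODE.contDiffOn_enat_Icc_of_hasDerivWithinAt (n := ⊤) (u := univ)
    (f := fun s y => partialQ l (s, x s, z s) - y ∘L partialQ ψ (s, x s, z s)) ?_
    (fun s hs => (h s hs).1) (mapsTo_univ _ _)
  exact ((hQ hl).comp_contDiffOn hc).sub (contDiffOn_snd.clm_comp ((hQ hψ).comp_contDiffOn hc))

/-- The right-hand side of the equations `q' = ψ`, `c' = l`. -/
def augmented (ψ : ℝ × Q × Z → Q) (l : ℝ × Q × Z → ℝ) (y : ℝ × (Q × ℝ) × Z) : Q × ℝ :=
  (ψ (y.1, y.2.1.1, y.2.2), l (y.1, y.2.1.1, y.2.2))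

theorem contDiff_augmented (hψ : ContDiff ℝ ∞ ψ) (hl : ContDiff ℝ ∞ l) :
    ContDiff ℝ ∞ (augmented ψ l) := by
  have h : ContDiff ℝ ∞ fun y : ℝ × (Q × ℝ) × Z => (y.1, y.2.1.1, y.2.2) := by fun_prop
  exact (hψ.comp h).prodMk (hl.comp h)

theorem fderiv_augmented (hψ : ContDiff ℝ ∞ ψ) (hl : ContDiff ℝ ∞ l) (s : ℝ) (x u : Q) (c r : ℝ)
    (z v : Z) : fderiv ℝ (augmented ψ l) (s, (x, c), z) (0, (u, r), v) =
      (partialQ ψ (s, x, z) u + partialZ ψ (s, x, z) v,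
        partialQ l (s, x, z) u + partialZ l (s, x, z) v) := by
  have hu : HasDerivAt (fun τ : ℝ => x + τ • u) u 0 := by
    simpa using ((hasDerivAt_id (0 : ℝ)).smul_const u).const_add x
  have hv : HasDerivAt (fun τ : ℝ => z + τ • v) v 0 := by
    simpa using ((hasDerivAt_id (0 : ℝ)).smul_const v).const_add z
  have hr : HasDerivAt (fun τ : ℝ => c + τ • r) r 0 := by
    simpa using ((hasDerivAt_id (0 : ℝ)).smul_const r).const_add c
  have h1 : HasDerivAt (fun τ : ℝ => ((s, (x + τ • u, c + τ • r), z + τ • v) : ℝ × (Q × ℝ) × Z))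
      (0, (u, r), v) 0 := (hasDerivAt_const _ _).prodMk ((hu.prodMk hr).prodMk hv)
  have h2 : HasFDerivAt (augmented ψ l) (fderiv ℝ (augmented ψ l) (s, (x, c), z))
      ((s, (x + (0 : ℝ) • u, c + (0 : ℝ) • r), z + (0 : ℝ) • v) : ℝ × (Q × ℝ) × Z) := by
    rw [zero_smul, zero_smul, zero_smul, add_zero, add_zero, add_zero]
    exact ((contDiff_augmented hψ hl).differentiable (by simp) _).hasFDerivAt
  have h3 := HasFDerivAt.comp_hasDerivAt (l := augmented ψ l) (0 : ℝ) h2 h1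
  have h4 := (hasDerivAt_comp_variation hψ (s := s) hu hv).prodMk
    (hasDerivAt_comp_variation hl (s := s) hu hv)
  have h5 := h3.unique h4
  simpa only [zero_smul, add_zero] using h5

open scoped NNReal in
theorem exists_lipschitzWith_augmented (hψ : ContDiff ℝ ∞ ψ) (hψc : HasCompactSupport ψ)
    (hl : ContDiff ℝ ∞ l) (hlc : HasCompactSupport l) :
    ∃ K : ℝ≥0, ∀ s z, LipschitzWith K fun x => augmented ψ l (s, x, z) := by
  obtain ⟨K, hK⟩ := ContDiff.lipschitzWith_of_hasCompactSupport hψc hψ (by simp)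
  obtain ⟨K', hK'⟩ := ContDiff.lipschitzWith_of_hasCompactSupport hlc hl (by simp)
  refine ⟨max K K', fun s z => ?_⟩
  have h1 : LipschitzWith 1 fun x : Q × ℝ => (s, x.1, z) := by
    refine LipschitzWith.of_dist_le_mul fun x y => ?_
    simp [Prod.dist_eq]
  have h2 := (hK.comp h1).prodMk (hK'.comp h1)
  rw [mul_one, mul_one] at h2
  exact h2

theorem exists_primitive {t₀ t₁ : ℝ} (ht : t₀ ≤ t₁) {f : ℝ → ℝ} (hf : ContinuousOn f (Icc t₀ t₁)) :
    ∃ c : ℝ → ℝ, ∀ s ∈ Icc t₀ t₁, HasDerivWithinAt c (f s) (Icc t₀ t₁) s := by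
  have hc : Continuous (IccExtend ht ((Icc t₀ t₁).domRestrict f)) :=
    (continuousOn_iff_continuous_domRestrict.1 hf).Icc_extend'
  refine ⟨fun s => ∫ τ in t₀..s, IccExtend ht ((Icc t₀ t₁).domRestrict f) τ, fun s hs => ?_⟩
  have h1 := (hc.integral_hasStrictDerivAt t₀ s).hasDerivAt.hasDerivWithinAt (s := Icc t₀ t₁)
  rwa [IccExtend_of_mem _ _ hs] at h1

/-- If the action cannot be varied to first order under variations with fixed end-points, in the
sense that the conclusion of `exists_endpoint_family` fails, then there is a nonzero pair consisting
of a momentum and a constant `ν` solving the equations of `IsMultiplier` with Lagrangian `-ν l`. -/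
theorem exists_multiplier_pair (hψ : ContDiff ℝ ∞ ψ) (hl : ContDiff ℝ ∞ l)
    {P : ℝ → (Q × ℝ) →L[ℝ] ℝ} {c : ℝ → ℝ}
    (hP : ∀ s ∈ Icc t₀ t₁, HasDerivWithinAt P (-(P s ∘L fderiv ℝ (augmented ψ l)
      (s, (x s, c s), z s) ∘L ContinuousLinearMap.inr ℝ ℝ ((Q × ℝ) × Z) ∘L
        ContinuousLinearMap.inl ℝ (Q × ℝ) Z)) (Icc t₀ t₁) s)
    (hP' : ∀ s ∈ Icc t₀ t₁, P s ∘L fderiv ℝ (augmented ψ l) (s, (x s, c s), z s) ∘L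
      ContinuousLinearMap.inr ℝ ℝ ((Q × ℝ) × Z) ∘L ContinuousLinearMap.inr ℝ (Q × ℝ) Z = 0)
    (hP₁ : P t₁ ≠ 0) :
    ∃ (p : ℝ → Q →L[ℝ] ℝ) (ν : ℝ), (ν ≠ 0 ∨ p t₁ ≠ 0) ∧ ∀ s ∈ Icc t₀ t₁,
      HasDerivWithinAt p (-(p s ∘L partialQ ψ (s, x s, z s) + ν • partialQ l (s, x s, z s)))
        (Icc t₀ t₁) s ∧ p s ∘L partialZ ψ (s, x s, z s) + ν • partialZ l (s, x s, z s) = 0 := by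
  have hsplit : ∀ s (u : Q) (r : ℝ), P s (u, r) = P s (u, 0) + r * P s (0, 1) := fun s u r => by
    have h1 : ((u, r) : Q × ℝ) = (u, 0) + r • (0, 1) := by simp
    rw [h1, map_add, map_smul, smul_eq_mul]
  -- the right-hand side does not involve the accumulated action `c`, whose momentum is constant
  have hν : ∀ s ∈ Icc t₀ t₁, P s (0, 1) = P t₁ (0, 1) := by
    have hd : ∀ s ∈ Icc t₀ t₁, HasDerivWithinAt (fun s => P s (0, 1)) 0 (Icc t₀ t₁) s := by
      intro s hs
      refine ((hP s hs).clm_apply (hasDerivWithinAt_const s _ ((0 : Q), (1 : ℝ)))).congr_deriv ?_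
      have h1 := fderiv_augmented hψ hl s (x s) 0 (c s) 1 (z s) 0
      simp only [map_zero, add_zero] at h1
      change -(P s (fderiv ℝ (augmented ψ l) (s, (x s, c s), z s) (0, (0, 1), 0))) + P s 0 = 0
      rw [h1, map_zero, add_zero, neg_eq_zero]
      exact map_zero (P s)
    intro s hs
    have h1 := integral_eq_sub_of_hasDerivWithinAt_Icc (f' := fun _ => (0 : ℝ)) hs.2
      (fun r hr => (hd r ⟨hs.1.trans hr.1, hr.2⟩).mono (Icc_subset_Icc_left hs.1))
      continuousOn_const
    simp only [intervalIntegral.integral_zero] at h1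
    exact (sub_eq_zero.1 h1.symm).symm
  refine ⟨fun s => P s ∘L ContinuousLinearMap.inl ℝ Q ℝ, P t₁ (0, 1), ?_, fun s hs => ⟨?_, ?_⟩⟩
  · by_contra! h
    refine hP₁ ?_
    ext u
    · exact DFunLike.congr_fun h.2 u
    · exact h.1
  · have h1 := ((ContinuousLinearMap.compL ℝ Q (Q × ℝ) ℝ).flip
      (ContinuousLinearMap.inl ℝ Q ℝ)).hasFDerivAt.comp_hasDerivWithinAt s (hP s hs)
    refine h1.congr_deriv ?_
    ext u
    have h2 := fderiv_augmented hψ hl s (x s) u (c s) 0 (z s) 0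
    simp only [map_zero, add_zero] at h2
    change -(P s (fderiv ℝ (augmented ψ l) (s, (x s, c s), z s) (0, (u, 0), 0))) = _
    rw [h2, hsplit, hν s hs]
    simp [mul_comm]
  · ext v
    have h2 := fderiv_augmented hψ hl s (x s) 0 (c s) 0 (z s) v
    simp only [map_zero, zero_add] at h2
    have h3 : P s (fderiv ℝ (augmented ψ l) (s, (x s, c s), z s) (0, (0, 0), v)) = 0 :=
      DFunLike.congr_fun (hP' s hs) v
    rw [h2, hsplit, hν s hs] at h3
    simp [mul_comm] at h3 ⊢
    exact h3

end Multiplier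

namespace ConstrainedSystem.AdaptedChart

variable {E F : Type*} [NormedAddCommGroup E] [NormedSpace ℝ E] [FiniteDimensional ℝ E]
  [NormedAddCommGroup F] [NormedSpace ℝ F]
  {V : Type*} [TopologicalSpace V] [ChartedSpace E V] [IsManifold 𝓘(ℝ, E) ∞ V]
  {A : Type*} [TopologicalSpace A] [ChartedSpace F A] [IsManifold 𝓘(ℝ, F) ∞ A]
  {S : ConstrainedSystem E F V A}
  {Q Z : Type} [NormedAddCommGroup Q] [NormedSpace ℝ Q] [FiniteDimensional ℝ Q]
  [NormedAddCommGroup Z] [NormedSpace ℝ Z] [FiniteDimensional ℝ Z]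
  (C : S.AdaptedChart Q Z) {t₀ t₁ : ℝ}

theorem contDiffOn_q {a : ℝ → A} (ha : S.IsAdmissible t₀ t₁ a) :
    ContDiffOn ℝ ∞ (fun s => C.q (S.proj (a s))) (Icc t₀ t₁) :=
  (C.contMDiff_q.comp_contMDiffOn ha.isSection.contMDiffOn).contDiffOn

theorem contDiffOn_z {a : ℝ → A} (ha : S.IsAdmissible t₀ t₁ a) :
    ContDiffOn ℝ ∞ (fun s => C.z (a s)) (Icc t₀ t₁) :=
  (C.contMDiff_z.comp_contMDiffOn ha.contMDiffOn).contDiffOn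

/-- A multiplier along an admissible section defines an extremal of the free functional. -/
theorem isFreeExtremal_contactPoint (ht : t₀ < t₁) {L : A → ℝ} {l : ℝ × Q × Z → ℝ}
    (hl : ContDiff ℝ ∞ l) (hlL : ∀ b ∈ C.eA.source, l (C.eA b) = L b) {a : ℝ → A}
    (ha : S.IsAdmissible t₀ t₁ a) (hV : ∀ s ∈ Icc t₀ t₁, S.proj (a s) ∈ C.eV.source)
    (hA : ∀ s ∈ Icc t₀ t₁, a s ∈ C.eA.source) {p : ℝ → Q →L[ℝ] ℝ}
    (hp : IsMultiplier l C.ψ t₀ t₁ (fun s => C.q (S.proj (a s))) (fun s => C.z (a s)) p) :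
    S.IsFreeExtremal L t₀ t₁ fun s => C.contactPoint (a s) (p s) := by
  have hps := hp.contDiffOn hl C.contDiff_ψ (C.contDiffOn_q ha) (C.contDiffOn_z ha)
  exact C.isFreeExtremal_of_isMultiplier ht hl hlL
    ⟨C.smoothOn_contactPoint ha.contMDiffOn hps, ha.isSection.time_eq⟩ hV hA
    (fun s hs => C.derivWithin_q_eq_slope ht ha hs)
    (hp.congr (fun _ _ => rfl) (fun _ _ => rfl) fun s hs => C.momentum_contactPoint (hV s hs) _)

/-- Along a normal curve, the homogeneous multiplier equations have only the zero solution. -/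
theorem eq_zero_of_isMultiplier_of_isNormal (ht : t₀ < t₁) {γ : ℝ → V} {a : ℝ → A}
    (ha : S.IsLift t₀ t₁ γ a) (hγ : S.IsNormal t₀ t₁ γ)
    (hV : ∀ s ∈ Icc t₀ t₁, S.proj (a s) ∈ C.eV.source)
    (hA : ∀ s ∈ Icc t₀ t₁, a s ∈ C.eA.source) {p : ℝ → Q →L[ℝ] ℝ}
    (hp : IsMultiplier (fun _ => 0) C.ψ t₀ t₁ (fun s => C.q (S.proj (a s)))
      (fun s => C.z (a s)) p) :
    ∀ s ∈ Icc t₀ t₁, p s = 0 := by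
  have hex := C.isFreeExtremal_contactPoint (L := fun _ => 0) ht contDiff_const (fun _ _ => rfl)
    ha.isAdmissible hV hA hp
  have h1 : ∀ (w : S.ContactBundle) (x : V), w.base = x →
      ∃ φ : TangentSpace 𝓘(ℝ, E) x →L[ℝ] ℝ, w.toCotangent = ⟨x, φ⟩ := by
    rintro w _ rfl
    exact ⟨w.form, rfl⟩
  choose w hw using fun s : Icc t₀ t₁ =>
    h1 (C.contactPoint (a s) (p s)) (γ s) (ha.proj_eq s s.2)
  have h2 : w ∈ S.abnormalSpace t₀ t₁ γ := Submodule.subset_span ⟨_, hex, hw⟩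
  rw [Submodule.rank_eq_zero.1 hγ.2, Submodule.mem_bot] at h2
  intro s hs
  have h3 := hw ⟨s, hs⟩
  rw [h2] at h3
  have h4 : C.contactForm (a s) (p s) = 0 := congrArg (fun y => (y.2 : E →L[ℝ] ℝ)) h3
  rw [← C.momentum_contactPoint (hV s hs) (p s)]
  change C.contactForm (a s) (p s) ∘L _ = 0
  ext u
  exact DFunLike.congr_fun h4 ((C.frame _).inverse (0, u))

/-- A deformation of `(q, c)` through solutions of `q' = ψ`, `c' = l` that moves only the final
value of `c` is an admissible deformation with fixed end-points along which the action has
derivative `1`. Hence the hypothesis of `exists_endpoint_family` fails along an extremal. -/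
theorem exists_multiplier_pair_of_stationary (ht : t₀ < t₁) {L : A → ℝ} {l : ℝ × Q × Z → ℝ}
    (hl : ContDiff ℝ ∞ l) (hlc : HasCompactSupport l)
    (hlL : ∀ b ∈ C.eA.source, l (C.eA b) = L b) {a : ℝ → A}
    (ha : S.IsAdmissible t₀ t₁ a) (hV : ∀ s ∈ Icc t₀ t₁, S.proj (a s) ∈ C.eV.source)
    (hA : ∀ s ∈ Icc t₀ t₁, a s ∈ C.eA.source)
    (hstat : ∀ (ε : ℝ) (H : ℝ → ℝ → A), 0 < ε → S.IsAdmissibleDeformation t₀ t₁ a ε H →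
      HasDerivAt (fun ξ => action L t₀ t₁ (H ξ)) 0 0) :
    ∃ (p : ℝ → Q →L[ℝ] ℝ) (ν : ℝ), (ν ≠ 0 ∨ p t₁ ≠ 0) ∧ ∀ s ∈ Icc t₀ t₁,
      HasDerivWithinAt p (-(p s ∘L partialQ C.ψ (s, C.q (S.proj (a s)), C.z (a s)) +
        ν • partialQ l (s, C.q (S.proj (a s)), C.z (a s)))) (Icc t₀ t₁) s ∧
      p s ∘L partialZ C.ψ (s, C.q (S.proj (a s)), C.z (a s)) +
        ν • partialZ l (s, C.q (S.proj (a s)), C.z (a s)) = 0 := by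
  set x : ℝ → Q := fun s => C.q (S.proj (a s)) with hxdef
  set z : ℝ → Z := fun s => C.z (a s) with hzdef
  have hx : ContDiffOn ℝ ∞ x (Icc t₀ t₁) := C.contDiffOn_q ha
  have hz : ContDiffOn ℝ ∞ z (Icc t₀ t₁) := C.contDiffOn_z ha
  have hea : ∀ s ∈ Icc t₀ t₁, C.eA (a s) = (s, x s, z s) := fun s hs => by
    rw [C.eA_apply]
    exact Prod.ext (ha.isSection.time_eq s hs) rfl
  have hxd : ∀ s ∈ Icc t₀ t₁, HasDerivWithinAt x (C.ψ (s, x s, z s)) (Icc t₀ t₁) s := by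
    intro s hs
    have h1 := ((hx s hs).differentiableWithinAt (by simp)).hasDerivWithinAt
    rw [C.derivWithin_q_eq_slope ht ha hs] at h1
    rw [← hea s hs, C.ψ_eA _ (hA s hs)]
    exact h1
  -- the action accumulated up to time `s`
  obtain ⟨c, hc⟩ := exists_primitive (f := fun s => l (s, x s, z s)) ht.le
    (hl.continuous.comp_continuousOn
      (continuousOn_id.prodMk (hx.continuousOn.prodMk hz.continuousOn)))
  obtain ⟨K, hK⟩ := exists_lipschitzWith_augmented C.contDiff_ψ C.hasCompactSupport_ψ hl hlc
  by_contra hno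
  obtain ⟨ε, hε, X, W, hX, hW, h0, hfam⟩ := exists_endpoint_family (Q := Q × ℝ) (Z := Z)
    (contDiff_augmented C.contDiff_ψ hl) hK (e := (0, 1)) (fun s y z τ => by simp [augmented]) ht
    (x := fun s => (x s, c s)) hz (fun s hs => (hxd s hs).prodMk (hc s hs)) fun P hP hP' => by
      by_contra hP₁
      exact hno (exists_multiplier_pair C.contDiff_ψ hl hP hP' hP₁)
  have hY : ContDiffOn ℝ ∞ (fun y : ℝ × ℝ => (y.2, (X y.1 y.2).1, W y.1 y.2))
      (Ioo (-ε) ε ×ˢ Icc t₀ t₁) := contDiffOn_snd.prodMk (hX.fst.prodMk hW)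
  have hY0 : ∀ s ∈ Icc t₀ t₁, (s, (X 0 s).1, W 0 s) = C.eA (a s) := fun s hs => by
    rw [hea s hs, (h0 s hs).1, (h0 s hs).2]
  obtain ⟨ε₁, hε₁, hε₁ε, hmem⟩ := hY.continuousOn.eventually_forall_Icc_mem hε C.eA.open_target
    fun s hs => by
      change (s, (X 0 s).1, W 0 s) ∈ _
      rw [hY0 s hs]
      exact C.eA.map_source (hA s hs)
  let H : ℝ → ℝ → A := fun ξ s => C.eA.symm (s, (X ξ s).1, W ξ s)
  have hHs : ContMDiffOn 𝓘(ℝ, ℝ × ℝ) 𝓘(ℝ, F) ∞ (fun y : ℝ × ℝ => H y.1 y.2)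
      (Ioo (-ε₁) ε₁ ×ˢ Icc t₀ t₁) :=
    C.contMDiffOn_eA_symm.comp
      (hY.mono (prod_mono (Ioo_subset_Ioo (neg_le_neg hε₁ε) hε₁ε) Subset.rfl)).contMDiffOn
      fun y hy => hmem y.1 hy.1 y.2 hy.2
  have hH0 : ∀ s ∈ Icc t₀ t₁, H 0 s = a s := fun s hs => by
    simp only [H, hY0 s hs, C.eA.left_inv (hA s hs)]
  obtain ⟨δ, hδ, hδε₁, hmemV⟩ := (S.contMDiff_proj.continuous.comp_continuousOn
    hHs.continuousOn).eventually_forall_Icc_mem hε₁ C.eV.open_source fun s hs => by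
      change S.proj (H 0 s) ∈ _
      rw [hH0 s hs]
      exact hV s hs
  have hs₁ : Ioo (-δ) δ ⊆ Ioo (-ε₁) ε₁ := Ioo_subset_Ioo (neg_le_neg hδε₁) hδε₁
  have hsε : Ioo (-δ) δ ⊆ Ioo (-ε) ε := hs₁.trans (Ioo_subset_Ioo (neg_le_neg hε₁ε) hε₁ε)
  have hH : ∀ ξ ∈ Ioo (-δ) δ, ∀ s ∈ Icc t₀ t₁, C.eA (H ξ s) = (s, (X ξ s).1, W ξ s) ∧
      H ξ s ∈ C.eA.source ∧ S.time (S.proj (H ξ s)) = s ∧ C.q (S.proj (H ξ s)) = (X ξ s).1 := by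
    intro ξ hξ s hs
    have h1 := C.eA.right_inv (hmem ξ (hs₁ hξ) s hs)
    have h2 := h1
    rw [C.eA_apply] at h2
    exact ⟨h1, C.eA.map_target (hmem ξ (hs₁ hξ) s hs), congrArg Prod.fst h2,
      congrArg (fun y => y.2.1) h2⟩
  have hbase : ∀ ξ ∈ Ioo (-δ) δ, ∀ s ∈ Icc t₀ t₁, (X ξ s).1 = x s →
      S.proj (H ξ s) = S.proj (a s) := by
    intro ξ hξ s hs h
    refine C.eV.injOn (hmemV ξ hξ s hs) (hV s hs) ?_
    change C.eV (S.proj (H ξ s)) = C.eV (S.proj (a s))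
    rw [C.eV_apply, C.eV_apply, (hH ξ hξ s hs).2.2.1, (hH ξ hξ s hs).2.2.2, h,
      ha.isSection.time_eq s hs]
  have hdef : S.IsAdmissibleDeformation t₀ t₁ a δ H := by
    refine ⟨hHs.mono (prod_mono hs₁ Subset.rfl), fun ξ hξ => ?_, hH0, fun ξ hξ => ?_,
      fun ξ hξ => ?_⟩
    · refine C.isAdmissible_of_slope ht ?_ (fun s hs => (hH ξ hξ s hs).2.2.1)
        (fun s hs => hmemV ξ hξ s hs) fun s hs => ?_
      · exact hHs.comp (contDiff_const.prodMk contDiff_id).contMDiff.contMDiffOn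
          fun s hs => ⟨hs₁ hξ, hs⟩
      · have h1 : HasDerivWithinAt (fun s => (X ξ s).1) (C.ψ (s, (X ξ s).1, W ξ s))
            (Icc t₀ t₁) s :=
          (ContinuousLinearMap.fst ℝ Q ℝ).hasFDerivAt.comp_hasDerivWithinAt s
            ((hfam ξ (hsε hξ)).2.2 s hs)
        rw [← (hH ξ hξ s hs).1, C.ψ_eA _ (hH ξ hξ s hs).2.1] at h1
        exact (h1.congr (fun s hs => (hH ξ hξ s hs).2.2.2) (hH ξ hξ s hs).2.2.2).derivWithin
          (uniqueDiffOn_Icc ht s hs)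
    · refine hbase ξ hξ t₀ (left_mem_Icc.2 ht.le) ?_
      rw [(hfam ξ (hsε hξ)).1]
    · refine hbase ξ hξ t₁ (right_mem_Icc.2 ht.le) ?_
      rw [(hfam ξ (hsε hξ)).2.1]
      simp
  have hact : ∀ ξ ∈ Ioo (-δ) δ, action L t₀ t₁ (H ξ) = c t₁ - c t₀ + ξ := by
    intro ξ hξ
    have h1 : ∀ s ∈ Icc t₀ t₁, HasDerivWithinAt (fun s => (X ξ s).2) (l (s, (X ξ s).1, W ξ s))
        (Icc t₀ t₁) s := fun s hs =>
      (ContinuousLinearMap.snd ℝ Q ℝ).hasFDerivAt.comp_hasDerivWithinAt s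
        ((hfam ξ (hsε hξ)).2.2 s hs)
    have h2 : ∫ s in t₀..t₁, l (s, (X ξ s).1, W ξ s) = (X ξ t₁).2 - (X ξ t₀).2 :=
      integral_eq_sub_of_hasDerivWithinAt_Icc ht.le h1 (hl.continuous.comp_continuousOn
        (hY.continuousOn.comp (f := fun s => (ξ, s)) (by fun_prop) fun s hs => ⟨hsε hξ, hs⟩))
    have h3 : action L t₀ t₁ (H ξ) = ∫ s in t₀..t₁, l (s, (X ξ s).1, W ξ s) := by
      refine intervalIntegral.integral_congr fun s hs => ?_
      rw [uIcc_of_le ht.le] at hs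
      rw [← (hH ξ hξ s hs).1, hlL _ (hH ξ hξ s hs).2.1]
    rw [h3, h2, (hfam ξ (hsε hξ)).1, (hfam ξ (hsε hξ)).2.1]
    simp
    ring
  have h1 := hstat δ H hδ hdef
  have h2 : HasDerivAt (fun ξ => action L t₀ t₁ (H ξ)) 1 0 := by
    refine ((hasDerivAt_id (0 : ℝ)).const_add (c t₁ - c t₀)).congr_of_eventuallyEq ?_
    filter_upwards [Ioo_mem_nhds (show -δ < 0 by linarith) hδ] with ξ hξ
    exact hact ξ hξ
  exact zero_ne_one (h1.unique h2)

end ConstrainedSystem.AdaptedChart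

end

theorem theorem2p2
    {E F : Type*} [NormedAddCommGroup E] [NormedSpace ℝ E] [FiniteDimensional ℝ E]
    [NormedAddCommGroup F] [NormedSpace ℝ F] [FiniteDimensional ℝ F]
    {V : Type*} [TopologicalSpace V] [T2Space V] [SecondCountableTopology V]
    [ChartedSpace E V] [IsManifold 𝓘(ℝ, E) ∞ V]
    {A : Type*} [TopologicalSpace A] [T2Space A] [SecondCountableTopology A]
    [ChartedSpace F A] [IsManifold 𝓘(ℝ, F) ∞ A]
    (S : ConstrainedSystem E F V A) (L : A → ℝ) (hL : ContMDiff 𝓘(ℝ, F) 𝓘(ℝ, ℝ) ∞ L)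
    (t₀ t₁ : ℝ) (ht : t₀ < t₁) (γ : ℝ → V)
    (hext : S.IsExtremal L t₀ t₁ γ) (hnormal : S.IsNormal t₀ t₁ γ) :
    ∃ c : ℝ → S.ContactBundle,
      (S.IsFreeExtremal L t₀ t₁ c ∧ ∀ s ∈ Icc t₀ t₁, (c s).base = γ s) ∧
      ∀ c' : ℝ → S.ContactBundle,
        (S.IsFreeExtremal L t₀ t₁ c' ∧ ∀ s ∈ Icc t₀ t₁, (c' s).base = γ s) →
        EqOn c' c (Icc t₀ t₁) := by
  obtain ⟨a, ha, hstat⟩ := hext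
  obtain ⟨n, m, C, l, hl, hlc, hlL, hV, hA⟩ := S.exists_adaptedChart hL ht.le
    ha.isAdmissible.contMDiffOn.continuousOn ha.isAdmissible.isSection.time_eq
  have hzero := fun p => C.eq_zero_of_isMultiplier_of_isNormal ht ha hnormal hV hA (p := p)
  obtain ⟨p, ν, hpν, hp⟩ := C.exists_multiplier_pair_of_stationary ht hl hlc hlL ha.isAdmissible
    hV hA hstat
  -- normality excludes `ν = 0`
  have hν : ν ≠ 0 := by
    rintro rfl
    refine (hpν.resolve_left (by simp)) (hzero p (fun s hs => ?_) t₁ (right_mem_Icc.2 ht.le))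
    obtain ⟨h1, h2⟩ := hp s hs
    rw [zero_smul, add_zero] at h1 h2
    rw [partialQ_zero, partialZ_zero, zero_sub, zero_sub, h2, neg_zero]
    exact ⟨h1, rfl⟩
  -- the pair `(p, ν)` solves the equations for `-ν L`, so `p` is divided by `-ν`
  have hmul : IsMultiplier l C.ψ t₀ t₁ (fun s => C.q (S.proj (a s))) (fun s => C.z (a s))
      (fun s => (-ν⁻¹) • p s) := fun s hs => by
    obtain ⟨h1, h2⟩ := hp s hs
    constructor
    · refine (h1.const_smul (-ν⁻¹)).congr_deriv ?_
      dsimp only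
      rw [ContinuousLinearMap.smul_comp, neg_smul, smul_neg, neg_neg, smul_add, smul_smul,
        inv_mul_cancel₀ hν, one_smul]
      module
    · rw [ContinuousLinearMap.smul_comp, eq_neg_of_add_eq_zero_left h2, smul_neg, neg_smul,
        neg_neg, smul_smul, inv_mul_cancel₀ hν, one_smul]
      exact sub_self _
  refine ⟨fun s => C.contactPoint (a s) ((-ν⁻¹) • p s),
    ⟨C.isFreeExtremal_contactPoint ht hl hlL ha.isAdmissible hV hA hmul, ha.proj_eq⟩,
    fun c' hc' s hs => ?_⟩
  obtain ⟨hc, hcγ⟩ := hc'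
  have hca : ∀ s ∈ Icc t₀ t₁, (c' s).base = S.proj (a s) := fun s hs =>
    (hcγ s hs).trans (ha.proj_eq s hs).symm
  have hpt := C.pt_eq_of_isFreeExtremal ht hL hc ha.isAdmissible hV hca
  have hV' : ∀ s ∈ Icc t₀ t₁, (c' s).base ∈ C.eV.source := fun s hs => by
    rw [hca s hs]
    exact hV s hs
  have hmul' := (C.isMultiplier_of_isFreeExtremal ht hL hl hlL hc hV' fun s hs => by
    rw [hpt s hs]
    exact hA s hs).congr (x' := fun s => C.q (S.proj (a s))) (z' := fun s => C.z (a s))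
      (p' := fun s => C.momentum (c' s)) (fun s hs => by simp only [hca s hs])
      (fun s hs => by simp only [hpt s hs]) fun _ _ => rfl
  -- the difference of two multipliers is abnormal
  have hsub := hzero _ (hmul'.sub hmul) s hs
  rw [Pi.sub_apply, sub_eq_zero] at hsub
  change c' s = C.contactPoint (a s) ((-ν⁻¹) • p s)
  rw [← hsub, ← hpt s hs, C.contactPoint_momentum (hV' s hs)]
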